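/- Let $D\ge 1$. A closed $(D+1)$-colored graph is a finite bipartite multigraph (white and black vertices, every line joining a white and a black vertex) whose lines carry colors $0,1,\dots,D$ such that every vertex is incident to exactly one line of each color. If it has $2p$ vertices and $F$ faces (connected components of the subgraphs formed by the lines of two given colors $i<j$), its degree $\omega(\mathcal G)$ is defined by $$F=\frac{D(D-1)}{2}\,p+D-\frac{2}{(D-1)!}\,\omega(\mathcal G).$$ The associated $D$-dimensional pseudomanifold $|\mathcal G|$ is obtained by taking one $D$-simplex for each vertex of $\mathcal G$, with its facets (and the apices opposite to them) colored by $0,\dots,D$, and, for each line of color $i$, gluing the facets of color $i$ of the simplices of its two end vertices by the affine map that respects all colors. Theorem. Let $\mathcal G$ be a closed connected $(D+1)$-colored graph of degree $\omega(\mathcal G)=0$. 1. If $D\ge 3$, then $\mathcal G$ is melonic: up to isomorphism it arises from the elementary dipole (two vertices joined by $D+1$ lines) by repeatedly inserting, on an arbitrary line, a pair of vertices joined by $D$ lines (the two vertices are joined by one line of each color other than the color of the chosen line, and the chosen line is cut into two lines of its color, each joining one end of it to one of the new vertices). 2. For every $D\ge 1$, $|\mathcal G|$ is homeomorphic to the sphere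 $S^D$, and it is a PL sphere: there is a piecewise linear homeomorphism from $|\mathcal G|$ onto the boundary of the $(D+1)$-simplex. -/

import Mathlib

universe u

/-- A closed bipartite `(D+1)`-colored graph: finitely many white and black vertices, every vertex
being the end of exactly one line of each color `0, …, D`, and every line joining a white and a
black vertex. The lines of color `i` are thus a bijection `edge i` from white to black vertices.
Multiple lines (of different colors) between two vertices are allowed. -/
structure ColoredGraph (D : ℕ) where
  /-- white vertices -/
  W : Type u
  /-- black vertices -/
  B : Type u
  finite_W : Finite W
  finite_B : Finite B
  /-- `edge i w` is the black end of the line of color `i` that starts at the white vertex `w` -/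
  edge : Fin (D + 1) → W ≃ B

namespace ColoredGraph

variable {D : ℕ}

/-- The vertices, white or black. -/
abbrev Vertex (G : ColoredGraph.{u} D) : Type u := G.W ⊕ G.B

/-- Adjacency in the subgraph that keeps all vertices and the lines with color in `S`. -/
def colorGraph (G : ColoredGraph.{u} D) (S : Set (Fin (D + 1))) : SimpleGraph G.Vertex :=
  SimpleGraph.fromRel fun u v => ∃ i ∈ S, ∃ w : G.W, u = Sum.inl w ∧ v = Sum.inr (G.edge i w)

/-- The graph is connected (in particular nonempty). -/
def IsConnected (G : ColoredGraph.{u} D) : Prop := (G.colorGraph Set.univ).Connected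

/-- Number of faces: connected subgraphs with exactly two colors `i < j`. -/
noncomputable def numFaces (G : ColoredGraph.{u} D) : ℕ :=
  ∑ i : Fin (D + 1), ∑ j ∈ Finset.Ioi i, Nat.card (G.colorGraph {i, j}).ConnectedComponent

/-- Half the number of vertices, i.e. the number of white vertices. -/
noncomputable def halfOrder (G : ColoredGraph.{u} D) : ℕ := Nat.card G.W

/-- The degree `ω` of a `(D+1)`-colored graph (`D ≥ 1`) with `2p` vertices and `F` faces, fixed by
`F = D(D-1)/2 * p + D - 2/(D-1)! * ω`; see `numFaces_eq`. -/
noncomputable def degree (G : ColoredGraph.{u} D) : ℚ :=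
  ((D - 1).factorial : ℚ) / 2 *
    ((D : ℚ) * ((D : ℚ) - 1) / 2 * (G.halfOrder : ℚ) + (D : ℚ) - (G.numFaces : ℚ))

theorem numFaces_eq (G : ColoredGraph.{u} D) :
    (G.numFaces : ℚ) = (D : ℚ) * ((D : ℚ) - 1) / 2 * (G.halfOrder : ℚ) + (D : ℚ)
      - 2 / ((D - 1).factorial : ℚ) * G.degree := by
  have h : ((D - 1).factorial : ℚ) ≠ 0 := by positivity
  unfold degree
  field_simp
  ring

/-- Isomorphism of colored graphs: bijections on white and on black vertices that respect the lines
of every color. -/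
structure Iso (G H : ColoredGraph.{u} D) where
  onW : G.W ≃ H.W
  onB : G.B ≃ H.B
  map_edge : ∀ (i : Fin (D + 1)) (w : G.W), onB (G.edge i w) = H.edge i (onW w)

/-- The elementary dipole: one white and one black vertex joined by `D + 1` lines. -/
def dipole (D : ℕ) : ColoredGraph.{u} D where
  W := PUnit
  B := PUnit
  finite_W := inferInstance
  finite_B := inferInstance
  edge _ := Equiv.refl _

/-- Insertion of a pair of vertices joined by `D` lines on the line of color `i` that starts at the
white vertex `w`. The new vertices are `none`; they are joined by all colors but `i`, and the line
`w -- edge i w` is replaced by the two lines of color `i`, `w -- none` and `none -- edge i w`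
(see `insertPair_edge_*`). -/
noncomputable def insertPair (G : ColoredGraph.{u} D) (i : Fin (D + 1)) (w : G.W) : ColoredGraph.{u} D where
  W := Option G.W
  B := Option G.B
  finite_W := by have := G.finite_W; infer_instance
  finite_B := by have := G.finite_B; infer_instance
  edge j :=
    letI := Classical.decEq G.W
    if j = i then (Equiv.swap none (some w)).trans (Equiv.optionCongr (G.edge i))
    else Equiv.optionCongr (G.edge j)

theorem insertPair_edge_of_ne (G : ColoredGraph.{u} D) {i j : Fin (D + 1)} (w : G.W) (h : j ≠ i) :
    (G.insertPair i w).edge j = Equiv.optionCongr (G.edge j) := by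
  simp [insertPair, h]

theorem insertPair_edge_some_self (G : ColoredGraph.{u} D) (i : Fin (D + 1)) (w : G.W) :
    (G.insertPair i w).edge i (some w) = (none : Option G.B) := by
  classical
  simp only [insertPair, if_true]
  change Equiv.optionCongr (G.edge i) (Equiv.swap none (some w) (some w)) = _
  simp

theorem insertPair_edge_none (G : ColoredGraph.{u} D) (i : Fin (D + 1)) (w : G.W) :
    (G.insertPair i w).edge i (none : Option G.W) = some (G.edge i w) := by
  classical
  simp only [insertPair, if_true]
  change Equiv.optionCongr (G.edge i) (Equiv.swap none (some w) none) = _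
  simp

theorem insertPair_edge_some_of_ne (G : ColoredGraph.{u} D) (i : Fin (D + 1)) (w x : G.W)
    (h : x ≠ w) : (G.insertPair i w).edge i (some x) = some (G.edge i x) := by
  classical
  simp only [insertPair, if_true]
  change Equiv.optionCongr (G.edge i) (Equiv.swap none (some w) (some x)) = _
  rw [Equiv.swap_apply_of_ne_of_ne (by simp) (by simpa using h)]
  rfl

/-- Melonic graphs: those obtained, up to isomorphism, from the elementary dipole by repeated
insertion of pairs of vertices joined by `D` lines on arbitrary lines. -/
inductive IsMelonic : ColoredGraph.{u} D → Prop
  | dipole : IsMelonic (dipole D)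
  | insert (G : ColoredGraph.{u} D) (i : Fin (D + 1)) (w : G.W) :
      IsMelonic G → IsMelonic (G.insertPair i w)
  | iso (G H : ColoredGraph.{u} D) : Nonempty (Iso G H) → IsMelonic G → IsMelonic H

/-- The gluing of simplices. In the simplex of each vertex, coordinate `i` belongs to the apex
opposite to the facet of color `i`, which is therefore `x i = 0`. A line of color `i` glues the
facets of color `i` of the simplices at its ends by the map that respects all colors, that is,
point by point in barycentric coordinates. -/
inductive Glue (G : ColoredGraph.{u} D) :
    (Σ _ : G.Vertex, stdSimplex ℝ (Fin (D + 1))) →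
    (Σ _ : G.Vertex, stdSimplex ℝ (Fin (D + 1))) → Prop
  | line (i : Fin (D + 1)) (w : G.W) (x : stdSimplex ℝ (Fin (D + 1))) (hx : x.1 i = 0) :
      Glue G ⟨Sum.inl w, x⟩ ⟨Sum.inr (G.edge i w), x⟩

/-- The `D`-dimensional pseudomanifold of the graph: one `D`-simplex for each vertex, glued along
the lines, with the quotient topology. -/
def Space (G : ColoredGraph.{u} D) : Type u := Quot G.Glue

instance (G : ColoredGraph.{u} D) : TopologicalSpace G.Space :=
  inferInstanceAs (TopologicalSpace (Quot G.Glue))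

/-- The characteristic map of the simplex of the vertex `v`. -/
def simplexMap (G : ColoredGraph.{u} D) (v : G.Vertex) (x : stdSimplex ℝ (Fin (D + 1))) :
    G.Space :=
  Quot.mk G.Glue ⟨v, x⟩

end ColoredGraph

/-- `f` is piecewise affine on `s`: `s` is a union of finitely many polytopes on each of which `f`
is the restriction of an affine map. -/
def PiecewiseAffine {E F : Type*} [AddCommGroup E] [Module ℝ E] [AddCommGroup F] [Module ℝ F]
    (s : Set E) (f : s → F) : Prop :=
  ∃ P : Set (Finset E), P.Finite ∧ (⋃ t ∈ P, convexHull ℝ (t : Set E)) = s ∧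
    ∀ t ∈ P, ∃ g : E →ᵃ[ℝ] F, ∀ x : s, (x : E) ∈ convexHull ℝ (t : Set E) → f x = g x

/-- The standard PL sphere of dimension `D`: the boundary of the standard `(D+1)`-simplex. -/
def simplexBoundary (D : ℕ) : Set (Fin (D + 2) → ℝ) :=
  {x | x ∈ stdSimplex ℝ (Fin (D + 2)) ∧ ∃ i, x i = 0}

/-- The pseudomanifold of `G` is a PL sphere: some homeomorphism onto the boundary of the
`(D+1)`-simplex is piecewise linear on each simplex of the pseudomanifold. (The inverse of such a
homeomorphism is then piecewise linear too.) -/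
def ColoredGraph.IsPLSphere {D : ℕ} (G : ColoredGraph.{u} D) : Prop :=
  ∃ φ : G.Space ≃ₜ simplexBoundary D, ∀ v : G.Vertex,
    PiecewiseAffine (stdSimplex ℝ (Fin (D + 1)))
      (fun x => ((φ (G.simplexMap v x) : simplexBoundary D) : Fin (D + 2) → ℝ))

/-! The proof runs on `excess`, which is 4ω/(D-1)! on connected graphs and additive over components.
Delete a white vertex `w` and a black vertex `b` and splice the severed half-lines color by color.
If `s` lines join `w` to `b`, and the `m` spliced lines lie in `q` components of the remainder, a
count of faces and components shows that the excess drops by at least 2(m-q)(s+q-2)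
(`excess_remove_le`). For s ≥ 1 this is nonnegative; hence `excess_nonneg`, and removing two
adjacent vertices preserves excess zero. For s ≥ 2 and excess zero it forces m = q: the spliced
lines lie in pairwise different components (`strand_separated`).

For D ≥ 3, excess zero forces a face with two vertices, even if those through one prescribed line
are disregarded (`exists_parallel`). Hence a branch hanging off two vertices joined by several lines
contains another such pair, which is either joined by exactly D lines or has a smaller branch of its
own. The descent ends at a pair joined by D lines (`hasDipole_of_branch`). Removing that pair undoes
an insertion and keeps connectedness and excess zero, so the graph is melonic by induction.

The sphere statement is an induction along the same reductions, each realized by a piecewise linear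
bijection between two subdivided complexes (`IsPolyhedralSphere.of_model`). The base is two
simplices glued along their boundaries; an insertion subdivides one simplex into three pieces. For D
= 2 the space is a triangulated surface, degree zero means Euler characteristic 2, and a pair joined
by two lines may be missing. Then some face has four vertices, that is, some vertex of the
triangulation has degree four, and five triangles filling a pentagon are replaced by three
(`Square.isPolyhedralSphere`). -/

namespace ColoredGraph

/-! ### Components counted on white vertices, and the excess -/

variable {D : ℕ}

/-- Two white vertices with a common black neighbor along colors in `T`. -/
def WhiteRel (G : ColoredGraph.{u} D) (T : Set (Fin (D + 1))) (a a' : G.W) : Prop :=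
  ∃ i ∈ T, ∃ j ∈ T, G.edge i a = G.edge j a'

theorem WhiteRel.mono {G : ColoredGraph.{u} D} {S T : Set (Fin (D + 1))} (h : S ⊆ T) {a a' : G.W} :
    G.WhiteRel S a a' → G.WhiteRel T a a' := by
  rintro ⟨i, hi, j, hj, e⟩
  exact ⟨i, h hi, j, h hj, e⟩

/-- The components of the subgraph with colors in `T`, as classes of white vertices. -/
abbrev Comp (G : ColoredGraph.{u} D) (T : Set (Fin (D + 1))) : Type u := Quot (G.WhiteRel T)

/-- The number of components of the subgraph with colors in `T`. -/
noncomputable def numComp (G : ColoredGraph.{u} D) (T : Set (Fin (D + 1))) : ℕ :=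
  Nat.card (G.Comp T)

instance (G : ColoredGraph.{u} D) : Finite G.W := G.finite_W
instance (G : ColoredGraph.{u} D) : Finite G.B := G.finite_B
instance (G : ColoredGraph.{u} D) (T : Set (Fin (D + 1))) : Finite (G.Comp T) :=
  inferInstanceAs (Finite (Quot _))

/-- The class of the white vertex `a` in the subgraph with colors in `T`. -/
abbrev comp (G : ColoredGraph.{u} D) (T : Set (Fin (D + 1))) (a : G.W) : G.Comp T :=
  Quot.mk _ a

theorem comp_eq {G : ColoredGraph.{u} D} {T : Set (Fin (D + 1))} {i j : Fin (D + 1)} (hi : i ∈ T)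
    (hj : j ∈ T) {a a' : G.W} (h : G.edge i a = G.edge j a') : G.comp T a = G.comp T a' :=
  Quot.sound ⟨i, hi, j, hj, h⟩

theorem comp_eq_mono {G : ColoredGraph.{u} D} {S T : Set (Fin (D + 1))} (h : S ⊆ T) {a a' : G.W}
    (e : G.comp S a = G.comp S a') : G.comp T a = G.comp T a' := by
  have := congrArg (Quot.lift (G.comp T) fun _ _ r => Quot.sound (r.mono h)) e
  exact this

theorem colorGraph_adj {G : ColoredGraph.{u} D} {T : Set (Fin (D + 1))} {i : Fin (D + 1)}
    (hi : i ∈ T) (w : G.W) : (G.colorGraph T).Adj (Sum.inl w) (Sum.inr (G.edge i w)) := by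
  simp only [colorGraph, SimpleGraph.fromRel_adj]
  exact ⟨by simp, Or.inl ⟨i, hi, w, rfl, rfl⟩⟩

/-- A color in `T` matches every black vertex with a white one of its component, so classes of white
vertices suffice. For empty `T` the isolated black vertices would be lost. -/
theorem card_connectedComponent (G : ColoredGraph.{u} D) {T : Set (Fin (D + 1))}
    (hT : T.Nonempty) : Nat.card (G.colorGraph T).ConnectedComponent = G.numComp T := by
  obtain ⟨i₀, hi₀⟩ := hT
  let f : G.Vertex → G.Comp T := Sum.elim (G.comp T) fun b => G.comp T ((G.edge i₀).symm b)
  have hedge : ∀ i ∈ T, ∀ w, f (Sum.inl w) = f (Sum.inr (G.edge i w)) := by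
    intro i hi w
    exact comp_eq hi hi₀ (by simp)
  have hadj : ∀ u v, (G.colorGraph T).Adj u v → f u = f v := by
    intro u v h
    simp only [colorGraph, SimpleGraph.fromRel_adj] at h
    obtain ⟨-, ⟨i, hi, w, rfl, rfl⟩ | ⟨i, hi, w, rfl, rfl⟩⟩ := h
    · exact hedge i hi w
    · exact (hedge i hi w).symm
  have hreach : ∀ u v, (G.colorGraph T).Reachable u v → f u = f v := by
    rintro u v ⟨p⟩
    induction p with
    | nil => rfl
    | cons h _ ih => exact (hadj _ _ h).trans ih
  refine (Nat.card_congr (Equiv.ofBijective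
    (Quot.lift (fun a => (G.colorGraph T).connectedComponentMk (Sum.inl a)) ?_) ⟨?_, ?_⟩)).symm
  · rintro a a' ⟨i, hi, j, hj, e⟩
    refine SimpleGraph.ConnectedComponent.sound ?_
    exact (colorGraph_adj hi a).reachable.trans
      (by rw [e]; exact (colorGraph_adj hj a').symm.reachable)
  · rintro ⟨a⟩ ⟨a'⟩ h
    exact hreach _ _ (SimpleGraph.ConnectedComponent.exact h)
  · intro c
    induction c using SimpleGraph.ConnectedComponent.ind with
    | h v =>
      rcases v with a | b
      · exact ⟨G.comp T a, rfl⟩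
      · refine ⟨G.comp T ((G.edge i₀).symm b), SimpleGraph.ConnectedComponent.sound ?_⟩
        have := (colorGraph_adj (G := G) hi₀ ((G.edge i₀).symm b)).reachable
        simpa using this

/-- Twice the number of faces, counted over ordered pairs of colors. -/
noncomputable def faces₂ (G : ColoredGraph.{u} D) : ℤ :=
  ∑ i, ∑ j ∈ Finset.univ.erase i, (G.numComp {i, j} : ℤ)

/-- `4 ω / (D-1)!` with the degree extended additively to disconnected graphs. -/
noncomputable def excess (G : ColoredGraph.{u} D) : ℤ :=
  2 * D * G.numComp Set.univ + D * (D - 1) * Nat.card G.W - G.faces₂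

/-- Ordered pairs of colors keep the order of the colors out of all later counts; each face is then
seen twice. -/
theorem two_mul_numFaces (G : ColoredGraph.{u} D) : 2 * (G.numFaces : ℤ) = G.faces₂ := by
  have h1 : (G.numFaces : ℤ) = ∑ i, ∑ j ∈ Finset.Ioi i, (G.numComp {i, j} : ℤ) := by
    unfold numFaces
    push_cast
    refine Finset.sum_congr rfl fun i _ => Finset.sum_congr rfl fun j _ => ?_
    rw [card_connectedComponent G ⟨i, by simp⟩]
  have h2 : (G.numFaces : ℤ) = ∑ i, ∑ j ∈ Finset.Iio i, (G.numComp {i, j} : ℤ) := by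
    rw [h1, Finset.sum_comm' (t' := Finset.univ) (s' := fun j => Finset.Iio j) (by simp)]
    refine Finset.sum_congr rfl fun i _ => Finset.sum_congr rfl fun j _ => ?_
    rw [Set.pair_comm]
  rw [two_mul]
  nth_rewrite 1 [h1]
  rw [h2, ← Finset.sum_add_distrib]
  refine Finset.sum_congr rfl fun i _ => ?_
  rw [← Finset.sum_union]
  · refine Finset.sum_congr ?_ fun _ _ => rfl
    ext j
    simp [lt_or_lt_iff_ne, ne_comm]
  · rw [Finset.disjoint_left]
    intro j h h'
    simp only [Finset.mem_Ioi, Finset.mem_Iio] at h h'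
    exact absurd h (by order)

theorem IsConnected.numComp_univ {G : ColoredGraph.{u} D} (h : G.IsConnected) :
    G.numComp Set.univ = 1 := by
  rw [← card_connectedComponent G ⟨0, Set.mem_univ _⟩]
  have := h.nonempty
  have := h.preconnected.subsingleton_connectedComponent
  exact Nat.card_unique

theorem excess_eq_zero {G : ColoredGraph.{u} D} (h : G.IsConnected) (hdeg : G.degree = 0) :
    G.excess = 0 := by
  have h1 := G.two_mul_numFaces
  have h2 : (G.numFaces : ℚ) = _ := G.numFaces_eq
  rw [hdeg] at h2
  unfold excess
  rw [h.numComp_univ, ← h1]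
  have : ((2 * D * (1 : ℕ) + D * (D - 1) * Nat.card G.W - 2 * G.numFaces : ℤ) : ℚ) = 0 := by
    push_cast
    rw [h2]
    unfold halfOrder
    ring
  exact_mod_cast this

/-! ### Isomorphisms -/

namespace Iso

variable {G H : ColoredGraph.{u} D}

/-- The inverse. -/
def symm (e : Iso G H) : Iso H G :=
  ⟨e.onW.symm, e.onB.symm, fun i w => by
    apply e.onB.injective
    rw [e.map_edge]
    simp⟩

end Iso

/-! ### Removal of a pair of vertices -/

/-- Remove `w` and `b`, and if `σ` does not match them, match their former partners. -/
noncomputable def contractEquiv {W B : Type u} (σ : W ≃ B) (w : W) (b : B) :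
    {a // a ≠ w} ≃ {y // y ≠ b} := by
  classical
  exact
  { toFun := fun a => if h : σ a = b then
        ⟨σ w, fun h' => a.2 (σ.injective (h.trans h'.symm))⟩ else ⟨σ a, h⟩
    invFun := fun y => if h : σ.symm y = w then
        ⟨σ.symm b, fun h' => y.2 (σ.symm.injective (h.trans h'.symm))⟩ else ⟨σ.symm y, h⟩
    left_inv := by
      rintro ⟨a, ha⟩
      by_cases h : σ a = b
      · subst h
        simp
      · simp [h, ha]
    right_inv := by
      rintro ⟨y, hy⟩
      by_cases h : σ.symm y = w
      · subst h
        simp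
      · simp [h, hy] }

theorem contractEquiv_of_eq {W B : Type u} (σ : W ≃ B) {w : W} {b : B} (a : {a // a ≠ w})
    (h : σ a = b) : (contractEquiv σ w b a : B) = σ w := by
  simp [contractEquiv, h]

theorem contractEquiv_of_ne {W B : Type u} (σ : W ≃ B) {w : W} {b : B} (a : {a // a ≠ w})
    (h : σ a ≠ b) : (contractEquiv σ w b a : B) = σ a := by
  simp [contractEquiv, h]

/-- Delete the vertices `w` and `b`, with the lines between them, and for every other color join
the two remaining half-lines. -/
noncomputable def remove (G : ColoredGraph.{u} D) (w : G.W) (b : G.B) : ColoredGraph.{u} D where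
  W := {a // a ≠ w}
  B := {y // y ≠ b}
  finite_W := inferInstance
  finite_B := inferInstance
  edge i := contractEquiv (G.edge i) w b

section remove

variable {G : ColoredGraph.{u} D} {w : G.W} {b : G.B}

/-- A black vertex of `G - {w, b}` as a vertex of `G`. -/
def baseB (y : (G.remove w b).B) : G.B := Subtype.val (p := fun y => y ≠ b) y

theorem remove_edge_of_eq {i : Fin (D + 1)} {a : G.W} (ha : a ≠ w) (h : G.edge i a = b) :
    baseB ((G.remove w b).edge i ⟨a, ha⟩) = G.edge i w :=
  contractEquiv_of_eq (G.edge i) ⟨a, ha⟩ h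

theorem remove_edge_of_ne {i : Fin (D + 1)} {a : G.W} (ha : a ≠ w) (h : G.edge i a ≠ b) :
    baseB ((G.remove w b).edge i ⟨a, ha⟩) = G.edge i a :=
  contractEquiv_of_ne (G.edge i) ⟨a, ha⟩ h

theorem card_remove (G : ColoredGraph.{u} D) (w : G.W) (b : G.B) :
    Nat.card G.W = Nat.card (G.remove w b).W + 1 := by
  classical
  rw [← Nat.card_congr (Equiv.optionSubtypeNe w)]
  exact Finite.card_option

/-- The white end of the line of color `i` at `b`, if it is not `w`. -/
def strand {i : Fin (D + 1)} (h : G.edge i w ≠ b) : (G.remove w b).W :=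
  ⟨(G.edge i).symm b, fun e => h (by rw [← e]; simp)⟩

theorem edge_strand {i : Fin (D + 1)} (h : G.edge i w ≠ b) : G.edge i (strand h).1 = b := by
  simp [strand]

theorem strand_eq {i : Fin (D + 1)} (h : G.edge i w ≠ b) {a : G.W} (ha : a ≠ w)
    (e : G.edge i a = b) : strand h = ⟨a, ha⟩ := by
  apply Subtype.ext
  simp [strand, ← e]

theorem ne_of_edge {i : Fin (D + 1)} {a : G.W} (ha : a ≠ w) (e : G.edge i a = b) :
    G.edge i w ≠ b := fun h => ha ((G.edge i).injective (e.trans h.symm))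

theorem remove_edge_strand {i : Fin (D + 1)} (h : G.edge i w ≠ b) :
    baseB ((G.remove w b).edge i (strand h)) = G.edge i w :=
  remove_edge_of_eq _ (edge_strand h)

theorem remove_edge_eq_iff {i j : Fin (D + 1)} {a a' : (G.remove w b).W} :
    (G.remove w b).edge i a = (G.remove w b).edge j a' ↔
      baseB ((G.remove w b).edge i a) =
        baseB ((G.remove w b).edge j a') :=
  Subtype.ext_iff

theorem remove_comp_eq {T : Set (Fin (D + 1))} {i j : Fin (D + 1)} (hi : i ∈ T) (hj : j ∈ T)
    {a a' : G.W} (ha : a ≠ w) (ha' : a' ≠ w) (h : G.edge i a = G.edge j a')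
    (hb : G.edge i a ≠ b) :
    (G.remove w b).comp T ⟨a, ha⟩ = (G.remove w b).comp T ⟨a', ha'⟩ := by
  refine comp_eq hi hj (remove_edge_eq_iff.2 ?_)
  rw [remove_edge_of_ne ha hb, remove_edge_of_ne ha' (h ▸ hb), h]

theorem numComp_le_of_surjective {G H : ColoredGraph.{u} D} {S T : Set (Fin (D + 1))}
    (f : H.Comp S → G.Comp T) (hf : Function.Surjective f) : G.numComp T ≤ H.numComp S :=
  Nat.card_le_card_of_surjective f hf

/-- Restoring a pair of vertices adds at most one component. -/
theorem numComp_le_remove_add_one (T : Set (Fin (D + 1))) :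
    G.numComp T ≤ (G.remove w b).numComp T + 1 := by
  classical
  by_cases hT : T.Nonempty
  swap
  -- Without colors the components are the single white vertices, and `w` is the extra one.
  · rw [Set.not_nonempty_iff_eq_empty] at hT
    subst hT
    let f : Option ((G.remove w b).Comp ∅) → G.Comp ∅ := fun o =>
      o.elim (G.comp ∅ w) (Quot.lift (fun a => G.comp ∅ a.1) (by rintro _ _ ⟨_, h, _⟩; exact h.elim))
    have hf : Function.Surjective f := by
      rintro ⟨a⟩
      by_cases ha : a = w
      · exact ⟨none, by rw [ha]; rfl⟩
      · exact ⟨some ((G.remove w b).comp ∅ ⟨a, ha⟩), rfl⟩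
    have := Nat.card_le_card_of_surjective f hf
    rwa [Finite.card_option] at this
  obtain ⟨i₀, hi₀⟩ := hT
  set z : G.Comp T := G.comp T ((G.edge i₀).symm b) with hz
  have hzb : ∀ i ∈ T, ∀ a, G.edge i a = b → G.comp T a = z := fun i hi a h =>
    comp_eq hi hi₀ (by simp [h])
  -- A spliced line joins a neighbor of `b` to a neighbor of `w`, possibly from two different
  -- classes of `G`. Redirecting the class of `w` to that of `b` makes the map well defined; the
  -- value lost in this way is the image of `none`.
  let g : G.W → G.Comp T := fun a => if G.comp T a = G.comp T w then z else G.comp T a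
  have gz : ∀ i ∈ T, ∀ a, G.edge i a = b → g a = z := fun i hi a h => by
    simp only [g]; split_ifs with h1
    · rfl
    · exact hzb i hi a h
  have gw : ∀ a, G.comp T a = G.comp T w → g a = z := fun a h => by simp [g, h]
  let f : Option ((G.remove w b).Comp T) → G.Comp T := fun o =>
    o.elim (G.comp T w) (Quot.lift (fun a => g a.1) (by
      rintro ⟨a, ha⟩ ⟨a', ha'⟩ ⟨i, hi, j, hj, e⟩
      replace e := remove_edge_eq_iff.1 e
      by_cases h : G.edge i a = b <;> by_cases h' : G.edge j a' = b
      · exact (gz i hi a h).trans (gz j hj a' h').symm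
      · rw [remove_edge_of_eq ha h, remove_edge_of_ne ha' h'] at e
        exact (gz i hi a h).trans (gw a' (comp_eq hi hj e).symm).symm
      · rw [remove_edge_of_ne ha h, remove_edge_of_eq ha' h'] at e
        exact (gw a (comp_eq hi hj e)).trans (gz j hj a' h').symm
      · rw [remove_edge_of_ne ha h, remove_edge_of_ne ha' h'] at e
        have := comp_eq hi hj e
        simp only [g, this]))
  have hf : Function.Surjective f := by
    rintro ⟨a⟩
    by_cases ha : G.comp T a = G.comp T w
    · exact ⟨none, ha.symm⟩
    · have : a ≠ w := fun h => ha (by rw [h])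
      exact ⟨some ((G.remove w b).comp T ⟨a, this⟩), by simp [f, g, ha]⟩
  have := Nat.card_le_card_of_surjective f hf
  rwa [Finite.card_option] at this

/-- If `w` and `b` lie in the same component, components of `G - {w, b}` map to those of `G`. -/
noncomputable def compOfRemove {T : Set (Fin (D + 1))}
    (hwb : ∀ i ∈ T, ∀ a, G.edge i a = b → G.comp T a = G.comp T w) :
    (G.remove w b).Comp T → G.Comp T :=
  Quot.lift (fun a => G.comp T a.1) (by
      rintro ⟨a, ha⟩ ⟨a', ha'⟩ ⟨i, hi, j, hj, e⟩
      replace e := remove_edge_eq_iff.1 e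
      by_cases h : G.edge i a = b <;> by_cases h' : G.edge j a' = b
      · exact (hwb i hi a h).trans (hwb j hj a' h').symm
      · rw [remove_edge_of_eq ha h, remove_edge_of_ne ha' h'] at e
        exact (hwb i hi a h).trans (comp_eq hi hj e)
      · rw [remove_edge_of_ne ha h, remove_edge_of_eq ha' h'] at e
        exact (comp_eq hi hj e).trans (hwb j hj a' h').symm
      · rw [remove_edge_of_ne ha h, remove_edge_of_ne ha' h'] at e
        exact comp_eq hi hj e)

theorem compOfRemove_surjective {T : Set (Fin (D + 1))}
    (hwb : ∀ i ∈ T, ∀ a, G.edge i a = b → G.comp T a = G.comp T w) {j : Fin (D + 1)} (hj : j ∈ T)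
    (hjb : G.edge j w ≠ b) : Function.Surjective (compOfRemove hwb) := by
  rintro ⟨a⟩
  by_cases ha : a = w
  · exact ⟨(G.remove w b).comp T (strand hjb), by
      rw [ha]; exact hwb j hj _ (edge_strand hjb)⟩
  · exact ⟨(G.remove w b).comp T ⟨a, ha⟩, rfl⟩

/-- The line of color `i` puts `w` and `b` into one component, and the spliced line of color `j`
survives in it, so no component vanishes on removal. -/
theorem numComp_le_remove {T : Set (Fin (D + 1))} {i j : Fin (D + 1)} (hi : i ∈ T) (hj : j ∈ T)
    (hib : G.edge i w = b) (hjb : G.edge j w ≠ b) :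
    G.numComp T ≤ (G.remove w b).numComp T := by
  have hwb : ∀ k ∈ T, ∀ a, G.edge k a = b → G.comp T a = G.comp T w := fun k hk a h =>
    comp_eq hk hi (h.trans hib.symm)
  exact numComp_le_of_surjective _ (compOfRemove_surjective hwb hj hjb)

/-- If the reconnected lines of colors `i` and `j` lie in different faces, then restoring the pair
merges these faces. -/
theorem numComp_add_one_le_remove {i j : Fin (D + 1)} (hi : G.edge i w ≠ b) (hj : G.edge j w ≠ b)
    (hne : (G.remove w b).comp {i, j} (strand hi) ≠ (G.remove w b).comp {i, j} (strand hj)) :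
    G.numComp {i, j} + 1 ≤ (G.remove w b).numComp {i, j} := by
  set T : Set (Fin (D + 1)) := {i, j} with hT
  have hiT : i ∈ T := by simp [hT]
  have hjT : j ∈ T := by simp [hT]
  have hxx : G.comp T (strand hi).1 = G.comp T (strand hj).1 :=
    comp_eq hiT hjT ((edge_strand hi).trans (edge_strand hj).symm)
  -- `π` walks along a face two lines at a time. Starting from the neighbor of `b` by color `j`, it
  -- goes round to the neighbor of `b` by color `i`.
  let π : Equiv.Perm G.W := (G.edge i).trans (G.edge j).symm
  have hπ : ∀ a, G.edge i a = G.edge j (π a) := fun a => by simp [π]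
  have hπx : π (strand hi).1 = (strand hj).1 := by simp [π, strand]
  -- Otherwise the face through `b` misses `w`, so this walk survives in `G - {w, b}` and connects
  -- the two strands, against `hne`.
  have key : G.comp T w = G.comp T (strand hi).1 := by
    by_contra hcon
    have step : ∀ n : ℕ, ∃ h : (π ^ n) (strand hj).1 ≠ w,
        (G.remove w b).comp T ⟨_, h⟩ = (G.remove w b).comp T (strand hj) ∧
          G.comp T ((π ^ n) (strand hj).1) = G.comp T (strand hi).1 := by
      intro n
      induction n with
      | zero => exact ⟨(strand hj).2, rfl, hxx.symm⟩
      | succ n ih =>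
        obtain ⟨h, h1, h2⟩ := ih
        rw [pow_succ', Equiv.Perm.mul_apply]
        generalize (π ^ n) (strand hj).1 = c at h h1 h2
        have h3 : G.comp T (π c) = G.comp T (strand hi).1 :=
          (comp_eq hiT hjT (hπ c)).symm.trans h2
        have h4 : π c ≠ w := fun e => hcon (by rw [← h3, e])
        refine ⟨h4, ?_, h3⟩
        by_cases hc : G.edge i c = b
        · exact absurd (by rw [strand_eq hi h hc, h1]) hne
        · rw [← h1]
          exact (remove_comp_eq hiT hjT h h4 (hπ c) hc).symm
    -- `π` sends the strand of color `i` to that of color `j`, and by finiteness its inverse is a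
    -- natural power of `π`.
    obtain ⟨n, hn⟩ : ∃ n : ℕ, (π ^ n) (strand hj).1 = (strand hi).1 := by
      obtain ⟨n, hn⟩ := (isOfFinOrder_of_finite π).mem_powers_iff_mem_zpowers.2
        (Subgroup.inv_mem _ (Subgroup.mem_zpowers π))
      refine ⟨n, ?_⟩
      simp only at hn
      rw [hn, ← hπx]
      simp
    obtain ⟨h, h1, -⟩ := step n
    apply hne
    rw [← h1]
    congr 1
    exact Subtype.ext hn.symm
  have hwb : ∀ k ∈ T, ∀ a, G.edge k a = b → G.comp T a = G.comp T w := fun k hk a h => by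
    rw [key]
    exact comp_eq hk hiT (h.trans (edge_strand hi).symm)
  have := Fintype.ofFinite (G.Comp T)
  have := Fintype.ofFinite ((G.remove w b).Comp T)
  simp only [numComp, Nat.card_eq_fintype_card]
  refine Fintype.card_lt_of_surjective_not_injective _ (compOfRemove_surjective hwb hiT hi) ?_
  intro hinj
  exact hne (hinj hxx)

end remove

end ColoredGraph

/-! ### Change of the excess under removal of a pair -/

/-- The left side is the sum of the squares of the class sizes. With k classes, the sizes diminished
by one are nonnegative with sum |M| - k, so their squares add up to at most (|M| - k)²; the extreme
case is a single class with more than one element. -/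
theorem sum_eq_indicator_le {ι κ : Type*} [DecidableEq κ] (M : Finset ι) (K : ι → κ) :
    ∑ i ∈ M, ∑ j ∈ M, (if K i = K j then 1 else 0 : ℤ) ≤
      ((M.card : ℤ) - (M.image K).card) ^ 2 + 2 * M.card - (M.image K).card := by
  let n : κ → ℤ := fun c => (M.filter fun i => K i = c).card
  have hmaps : ∀ i ∈ M, K i ∈ M.image K := fun i hi => Finset.mem_image_of_mem K hi
  have hsum : ∑ c ∈ M.image K, n c = M.card := by
    simp only [n]
    exact_mod_cast (Finset.card_eq_sum_card_fiberwise hmaps).symm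
  have hQ : ∑ i ∈ M, ∑ j ∈ M, (if K i = K j then 1 else 0 : ℤ) = ∑ c ∈ M.image K, n c ^ 2 := by
    have : ∀ i ∈ M, ∑ j ∈ M, (if K i = K j then 1 else 0 : ℤ) = n (K i) := by
      intro i _
      simp only [n, Finset.sum_boole, eq_comm]
    rw [Finset.sum_congr rfl this, ← Finset.sum_fiberwise_of_maps_to hmaps]
    refine Finset.sum_congr rfl fun c _ => ?_
    rw [Finset.sum_congr rfl (g := fun _ => n c)
      (fun i hi => by rw [(Finset.mem_filter.1 hi).2]), Finset.sum_const, sq]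
    simp [n]
  have hpos : ∀ c ∈ M.image K, 0 ≤ n c - 1 := by
    intro c hc
    obtain ⟨i, hi, rfl⟩ := Finset.mem_image.1 hc
    have : 0 < (M.filter fun j => K j = K i).card :=
      Finset.card_pos.2 ⟨i, by simp [hi]⟩
    simp only [n]
    omega
  have h := Finset.sum_sq_le_sq_sum_of_nonneg hpos
  have e1 : ∑ c ∈ M.image K, (n c - 1) = M.card - (M.image K).card := by
    rw [Finset.sum_sub_distrib, hsum]
    simp
  have e2 : ∑ c ∈ M.image K, (n c - 1) ^ 2 =
      ∑ c ∈ M.image K, n c ^ 2 - 2 * M.card + (M.image K).card := by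
    rw [← hsum, Finset.mul_sum, ← Finset.sum_sub_distrib]
    rw [Finset.card_eq_sum_ones]
    push_cast
    rw [← Finset.sum_add_distrib]
    refine Finset.sum_congr rfl fun c _ => ?_
    ring
  rw [e1, e2] at h
  rw [hQ]
  linarith

/-- The largest change of the number of faces of colors with classes `x` and `y`. -/
def faceChange {κ : Type*} [DecidableEq κ] (x y : Option κ) : ℤ :=
  if x = y then 1 else if x = none ∨ y = none then 0 else -1

/-- The class `none` contributes s(s-1) and mixed pairs contribute 0. The other classes contribute
2Q - m² - m, where Q counts ordered pairs within one class and the final m removes the diagonal;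
`sum_eq_indicator_le` bounds Q. -/
theorem sum_faceChange_le {ι κ : Type*} [Fintype ι] [DecidableEq ι] [DecidableEq κ]
    (K : ι → Option κ) {s m q : ℤ} (hs : (Finset.univ.filter fun i => K i = none).card = s)
    (hm : (Finset.univ.filter fun i => K i ≠ none).card = m)
    (hq : ((Finset.univ.filter fun i => K i ≠ none).image K).card = q) :
    ∑ i, ∑ j ∈ Finset.univ.erase i, faceChange (K i) (K j) ≤
      s * (s - 1) - m * (m - 1) + 2 * ((m - q) ^ 2 + (m - q)) := by
  set M := Finset.univ.filter fun i => K i ≠ none with hM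
  have hQ := sum_eq_indicator_le M K
  rw [hm, hq] at hQ
  let c : ι → ℤ := fun i => if K i = none then 1 else 0
  let d : ι → ℤ := fun i => if K i ≠ none then 1 else 0
  have hc : ∑ i, c i = s := by simp [c, ← hs]
  have hd : ∑ i, d i = m := by simp only [d, Finset.sum_boole, ← hm, M]
  have hcd : ∀ i, c i + d i = 1 := by
    intro i
    simp only [c, d]
    split_ifs <;> simp_all
  have hQ' : ∑ i ∈ M, ∑ j ∈ M, (if K i = K j then 1 else 0 : ℤ) =
      ∑ i, ∑ j, d i * d j * (if K i = K j then 1 else 0) := by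
    rw [hM, Finset.sum_filter]
    refine Finset.sum_congr rfl fun i _ => ?_
    rw [Finset.sum_filter]
    by_cases h : K i = none
    · simp [d, h]
    · simp only [ne_eq, h, not_false_eq_true, if_true, d, one_mul]
      refine Finset.sum_congr rfl fun j _ => ?_
      split_ifs <;> simp
  have hF : ∀ i j, faceChange (K i) (K j) =
      c i * c j + 2 * (d i * d j * (if K i = K j then 1 else 0)) - d i * d j := by
    intro i j
    simp only [faceChange, c, d]
    rcases h : K i with _ | x <;> rcases h' : K j with _ | y <;> simp
    split_ifs <;> norm_num
  have htot : ∑ i, ∑ j, faceChange (K i) (K j) = s * s - m * m +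
      2 * ∑ i ∈ M, ∑ j ∈ M, (if K i = K j then 1 else 0 : ℤ) := by
    rw [hQ']
    simp only [hF, Finset.sum_sub_distrib, Finset.sum_add_distrib, ← Finset.mul_sum,
      ← Finset.sum_mul, hc, hd]
    ring
  have hdiag : ∑ i, ∑ j ∈ Finset.univ.erase i, faceChange (K i) (K j) =
      ∑ i, ∑ j, faceChange (K i) (K j) - (s + m) := by
    rw [← hc, ← hd, ← Finset.sum_add_distrib, ← Finset.sum_sub_distrib]
    refine Finset.sum_congr rfl fun i _ => ?_
    rw [hcd, ← Finset.add_sum_erase _ _ (Finset.mem_univ i)]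
    simp [faceChange]
  rw [hdiag, htot]
  nlinarith

namespace ColoredGraph

variable {D : ℕ} {G : ColoredGraph.{u} D}

/-- The component of `G - {w, b}` containing the reconnected line of color `i`, or `none` if there
is no such line. -/
noncomputable def strandComp (G : ColoredGraph.{u} D) (w : G.W) (b : G.B) (i : Fin (D + 1)) :
    Option ((G.remove w b).Comp Set.univ) := by
  classical
  exact if h : G.edge i w ≠ b then some ((G.remove w b).comp Set.univ (strand h)) else none

theorem strandComp_of_ne {w : G.W} {b : G.B} {i : Fin (D + 1)} (h : G.edge i w ≠ b) :
    G.strandComp w b i = some ((G.remove w b).comp Set.univ (strand h)) := by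
  simp [strandComp, h]

theorem strandComp_eq_none {w : G.W} {b : G.B} {i : Fin (D + 1)} :
    G.strandComp w b i = none ↔ G.edge i w = b := by
  simp [strandComp]

open Classical in
-- The `q` components of the remainder that contain a spliced line are collapsed to one point, which
-- also receives `w`; the others are components of `G` already. So the components of `G` surject
-- onto a set whose size is the number of components of the remainder, plus 1, minus `q`.
theorem numComp_remove_univ_le (w : G.W) (b : G.B) :
    (G.remove w b).numComp Set.univ + 1 ≤ G.numComp Set.univ +
      ((Finset.univ.filter fun i => G.strandComp w b i ≠ none).image (G.strandComp w b)).card := by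
  set X := (Finset.univ.filter fun i => G.strandComp w b i ≠ none).image (G.strandComp w b) with hX
  have hXs : ∀ {i : Fin (D + 1)} (h : G.edge i w ≠ b),
      some ((G.remove w b).comp Set.univ (strand h)) ∈ X := by
    intro i h
    rw [hX, Finset.mem_image]
    refine ⟨i, ?_, strandComp_of_ne h⟩
    simp [strandComp_eq_none, h]
  have hXa : ∀ (i : Fin (D + 1)) (a : G.W) (ha : a ≠ w), G.edge i a = b →
      some ((G.remove w b).comp Set.univ ⟨a, ha⟩) ∈ X := by
    intro i a ha h
    have := hXs (ne_of_edge ha h)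
    rwa [strand_eq _ ha h] at this
  -- collapse all components through `w` or `b`
  let Y := {c : Option ((G.remove w b).Comp Set.univ) // c ∉ X}
  have hnone : none ∉ X := by simp [hX]
  let f : G.W → Y := fun a => if ha : a = w then ⟨none, hnone⟩ else
    if h : some ((G.remove w b).comp Set.univ ⟨a, ha⟩) ∈ X then ⟨none, hnone⟩ else ⟨_, h⟩
  have fw : f w = ⟨none, hnone⟩ := by simp [f]
  have fX : ∀ a (ha : a ≠ w), some ((G.remove w b).comp Set.univ ⟨a, ha⟩) ∈ X → f a = ⟨none, hnone⟩ := by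
    intro a ha h
    simp [f, h]
  have fne : ∀ a (ha : a ≠ w) (h : some ((G.remove w b).comp Set.univ ⟨a, ha⟩) ∉ X), f a = ⟨_, h⟩ := by
    intro a ha h
    simp [f, ha, h]
  have fG' : ∀ a a' (ha : a ≠ w) (ha' : a' ≠ w),
      (G.remove w b).comp Set.univ ⟨a, ha⟩ = (G.remove w b).comp Set.univ ⟨a', ha'⟩ → f a = f a' := by
    intro a a' ha ha' e
    by_cases h : some ((G.remove w b).comp Set.univ ⟨a, ha⟩) ∈ X
    · rw [fX a ha h, fX a' ha' (e ▸ h)]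
    · have h' := h
      rw [e] at h'
      rw [fne a ha h, fne a' ha' h']
      exact Subtype.ext (congrArg some e)
  have fwa : ∀ i j a, a ≠ w → G.edge i w = G.edge j a → f a = f w := by
    intro i j a ha e
    rw [fw]
    by_cases hb : G.edge j a = b
    · exact fX a ha (hXa j a ha hb)
    · refine fX a ha ?_
      have hi : G.edge i w ≠ b := e ▸ hb
      have : (G.remove w b).comp Set.univ ⟨a, ha⟩ = (G.remove w b).comp Set.univ (strand hi) := by
        refine comp_eq (i := j) (j := i) (Set.mem_univ _) (Set.mem_univ _) (remove_edge_eq_iff.2 ?_)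
        rw [remove_edge_of_ne ha hb, remove_edge_strand, e]
      rw [this]
      exact hXs hi
  let F : G.Comp Set.univ → Y := Quot.lift f (by
    rintro a a' ⟨i, -, j, -, e⟩
    by_cases ha : a = w <;> by_cases ha' : a' = w
    · rw [ha, ha']
    · subst ha
      exact (fwa i j a' ha' e).symm
    · subst ha'
      exact fwa j i a ha e.symm
    · by_cases hb : G.edge i a = b
      · rw [fX a ha (hXa i a ha hb), fX a' ha' (hXa j a' ha' (e ▸ hb))]
      · exact fG' a a' ha ha' (remove_comp_eq (Set.mem_univ _) (Set.mem_univ _) ha ha' e hb))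
  have hF : Function.Surjective F := by
    rintro ⟨o, ho⟩
    rcases o with _ | ⟨⟨a, ha⟩⟩
    · exact ⟨G.comp Set.univ w, fw⟩
    · exact ⟨G.comp Set.univ a, fne a ha ho⟩
  have h1 := Nat.card_le_card_of_surjective F hF
  have := Fintype.ofFinite ((G.remove w b).Comp Set.univ)
  have h2 : Nat.card Y = Fintype.card (Option ((G.remove w b).Comp Set.univ)) - X.card := by
    rw [Nat.card_eq_fintype_card, Fintype.card_subtype_compl, Fintype.card_coe]
  rw [h2, Fintype.card_option] at h1
  simp only [numComp, Nat.card_eq_fintype_card] at h1 ⊢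
  omega

open Classical in
/-- The change of the excess under removal of two vertices `w` and `b`, where `s` lines join `w` and
`b`, and the `m` reconnected lines lie in `q` components of the result. -/
theorem excess_remove_le (w : G.W) (b : G.B) {s m q : ℤ}
    (hs : (Finset.univ.filter fun i => G.strandComp w b i = none).card = s)
    (hm : (Finset.univ.filter fun i => G.strandComp w b i ≠ none).card = m)
    (hq : ((Finset.univ.filter fun i => G.strandComp w b i ≠ none).image
      (G.strandComp w b)).card = q) :
    (G.remove w b).excess + 2 * ((m - q) * (s + q - 2)) ≤ G.excess := by
  have hD : s + m = D + 1 := by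
    rw [← hs, ← hm]
    have := Finset.card_filter_add_card_filter_not (s := (Finset.univ : Finset (Fin (D + 1))))
      (fun i => G.strandComp w b i = none)
    rw [Finset.card_univ, Fintype.card_fin] at this
    exact_mod_cast this
  have hc := numComp_remove_univ_le w b
  have hc' : ((G.remove w b).numComp Set.univ : ℤ) + 1 ≤ G.numComp Set.univ + q := by
    rw [← hq]
    exact_mod_cast hc
  -- Restoring the pair changes the number of faces of two given colors by at most +1 in general, by
  -- at most 0 if exactly one of the colors joins `w` to `b`, and by at most -1 if the two strands
  -- lie in different components, since their faces are then merged.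
  have hF : G.faces₂ ≤ (G.remove w b).faces₂ +
      ∑ i, ∑ j ∈ Finset.univ.erase i, faceChange (G.strandComp w b i) (G.strandComp w b j) := by
    unfold faces₂
    rw [← Finset.sum_add_distrib]
    refine Finset.sum_le_sum fun i _ => ?_
    rw [← Finset.sum_add_distrib]
    refine Finset.sum_le_sum fun j _ => ?_
    have hgen : (G.numComp {i, j} : ℤ) ≤ (G.remove w b).numComp {i, j} + 1 := by
      exact_mod_cast numComp_le_remove_add_one (w := w) (b := b) ({i, j} : Set (Fin (D + 1)))
    by_cases h : G.strandComp w b i = G.strandComp w b j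
    · simpa [faceChange, h] using hgen
    by_cases hi : G.edge i w = b
    · have hj : G.edge j w ≠ b := fun hj =>
        h ((strandComp_eq_none.2 hi).trans (strandComp_eq_none.2 hj).symm)
      have : faceChange (G.strandComp w b i) (G.strandComp w b j) = 0 := by
        rw [faceChange, if_neg h, if_pos (Or.inl (strandComp_eq_none.2 hi))]
      rw [this, add_zero]
      exact_mod_cast numComp_le_remove (T := {i, j}) (by simp) (by simp) hi hj
    by_cases hj : G.edge j w = b
    · have : faceChange (G.strandComp w b i) (G.strandComp w b j) = 0 := by
        rw [faceChange, if_neg h, if_pos (Or.inr (strandComp_eq_none.2 hj))]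
      rw [this, add_zero]
      exact_mod_cast numComp_le_remove (T := {i, j}) (i := j) (j := i) (by simp) (by simp) hj hi
    have h1 : faceChange (G.strandComp w b i) (G.strandComp w b j) = -1 := by
      simp only [faceChange, if_neg h, strandComp_eq_none, hi, hj, or_self, if_false]
    rw [h1]
    have : G.numComp {i, j} + 1 ≤ (G.remove w b).numComp {i, j} := by
      refine numComp_add_one_le_remove hi hj fun e => h ?_
      rw [strandComp_of_ne hi, strandComp_of_ne hj]
      exact congrArg some (comp_eq_mono (Set.subset_univ _) e)
    have : (G.numComp {i, j} : ℤ) + 1 ≤ (G.remove w b).numComp {i, j} := by exact_mod_cast this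
    linarith
  have hsum := sum_faceChange_le (G.strandComp w b) hs hm hq
  have hp : (Nat.card G.W : ℤ) = Nat.card (G.remove w b).W + 1 := by
    exact_mod_cast card_remove G w b
  have hDm : (D : ℤ) = s + m - 1 := by linarith
  have hD0 : (0 : ℤ) ≤ D := by positivity
  unfold excess
  rw [hp]
  have := mul_le_mul_of_nonneg_left hc' hD0
  -- With D = s + m - 1 the contributions of components, vertices and faces combine into this
  -- product.
  have e1 : 2 * ((m - q) * (s + q - 2)) =
    2 * D * (1 - q) + D * (D - 1) - (s * (s - 1) - m * (m - 1) + 2 * ((m - q) ^ 2 + (m - q))) := by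
    rw [hDm]
    ring
  rw [e1]
  nlinarith

open Classical in
-- Here s ≥ 1, and q ≥ 1 unless m = q = 0. In both cases the term (m-q)(s+q-2) of `excess_remove_le`
-- is nonnegative.
theorem excess_remove_le_excess {w : G.W} {b : G.B} {i : Fin (D + 1)} (hi : G.edge i w = b) :
    (G.remove w b).excess ≤ G.excess := by
  have h := excess_remove_le w b rfl rfl rfl
  set M := Finset.univ.filter fun i => G.strandComp w b i ≠ none
  have hqm : (M.image (G.strandComp w b)).card ≤ M.card := Finset.card_image_le
  have hs : 0 < (Finset.univ.filter fun i => G.strandComp w b i = none).card :=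
    Finset.card_pos.2 ⟨i, by simp [strandComp_eq_none, hi]⟩
  have : 0 ≤ ((M.card : ℤ) - (M.image (G.strandComp w b)).card) *
      ((Finset.univ.filter fun i => G.strandComp w b i = none).card +
        (M.image (G.strandComp w b)).card - 2) := by
    rcases M.eq_empty_or_nonempty with h | h
    · simp [h]
    · have : 0 < (M.image (G.strandComp w b)).card := Finset.card_pos.2 (h.image _)
      apply mul_nonneg <;> omega
  linarith

/-- Removing the ends of a line lowers the number of vertices without raising the excess, and the
empty graph has excess zero. The removal may disconnect the graph, which is why the degree was
extended to disconnected graphs. -/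
theorem excess_nonneg (G : ColoredGraph.{u} D) : 0 ≤ G.excess := by
  induction hn : Nat.card G.W generalizing G with
  | zero =>
    have : IsEmpty G.W := (Nat.card_eq_zero.1 hn).resolve_right (by simpa using G.finite_W)
    have hN : ∀ T, G.numComp T = 0 := by
      intro T
      have : IsEmpty (G.Comp T) := ⟨fun c => by
        obtain ⟨a, -⟩ := Quot.exists_rep c
        exact this.elim a⟩
      exact Nat.card_of_isEmpty
    simp [excess, faces₂, hN]
  | succ n ih =>
    obtain ⟨w⟩ : Nonempty G.W := (Nat.card_pos_iff.1 (by omega)).1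
    exact (ih (G.remove w (G.edge 0 w)) (by have := card_remove G w (G.edge 0 w); omega)).trans
      (excess_remove_le_excess rfl)

theorem excess_remove_eq_zero (h0 : G.excess = 0) {w : G.W} {b : G.B} {i : Fin (D + 1)}
    (hi : G.edge i w = b) : (G.remove w b).excess = 0 :=
  le_antisymm (h0 ▸ excess_remove_le_excess hi) (excess_nonneg _)

open Classical in
/-- If two vertices joined by at least two lines are removed from a graph of degree zero, the
reconnected lines lie in different components. -/
theorem strand_separated (h0 : G.excess = 0) {w : G.W} {b : G.B} {i j : Fin (D + 1)} (hij : i ≠ j)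
    (hi : G.edge i w = b) (hj : G.edge j w = b) {k l : Fin (D + 1)} (hk : G.edge k w ≠ b)
    (hl : G.edge l w ≠ b)
    (h : (G.remove w b).comp Set.univ (strand hk) = (G.remove w b).comp Set.univ (strand hl)) :
    k = l := by
  have hle := excess_remove_le w b rfl rfl rfl
  rw [h0, excess_remove_eq_zero h0 hi] at hle
  set M := Finset.univ.filter fun i => G.strandComp w b i ≠ none with hM
  have hkM : k ∈ M := by simp [hM, strandComp_eq_none, hk]
  have hlM : l ∈ M := by simp [hM, strandComp_eq_none, hl]
  have hqm : (M.image (G.strandComp w b)).card ≤ M.card := Finset.card_image_le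
  have hq : 0 < (M.image (G.strandComp w b)).card := Finset.card_pos.2 ⟨_, Finset.mem_image_of_mem _ hkM⟩
  have hs : 1 < (Finset.univ.filter fun i => G.strandComp w b i = none).card :=
    Finset.one_lt_card.2 ⟨i, by simp [strandComp_eq_none, hi], j, by simp [strandComp_eq_none, hj],
      hij⟩
  -- Both excesses vanish, so (m-q)(s+q-2) ≤ 0, while s ≥ 2 and q ≥ 1 make the second factor
  -- positive. Hence q = m, and distinct colors give distinct components.
  have heq : (M.image (G.strandComp w b)).card = M.card := by
    by_contra hne
    have h1 : 0 < (M.card : ℤ) - (M.image (G.strandComp w b)).card := by omega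
    have h2 : 0 < ((Finset.univ.filter fun i => G.strandComp w b i = none).card : ℤ) +
        (M.image (G.strandComp w b)).card - 2 := by omega
    have := mul_pos h1 h2
    linarith
  refine Finset.card_image_iff.1 heq hkM hlM ?_
  rw [strandComp_of_ne hk, strandComp_of_ne hl, h]

open Classical in
/-- Removal of a pair of vertices keeps the graph connected if all reconnected lines lie in the same
component. -/
theorem numComp_remove_univ (h1 : G.numComp Set.univ = 1) {w : G.W} {b : G.B} {k : Fin (D + 1)}
    (hk : G.edge k w ≠ b)
    (h : ∀ l, ∀ hl : G.edge l w ≠ b, (G.remove w b).comp Set.univ (strand hl) =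
      (G.remove w b).comp Set.univ (strand hk)) :
    (G.remove w b).numComp Set.univ = 1 := by
  have hle := numComp_remove_univ_le w b
  have hq : ((Finset.univ.filter fun i => G.strandComp w b i ≠ none).image
      (G.strandComp w b)).card ≤ 1 := by
    rw [Finset.card_le_one]
    have : ∀ x ∈ (Finset.univ.filter fun i => G.strandComp w b i ≠ none).image (G.strandComp w b),
        x = some ((G.remove w b).comp Set.univ (strand hk)) := by
      intro x hx
      obtain ⟨l, hl, rfl⟩ := Finset.mem_image.1 hx
      have hl : G.edge l w ≠ b := by simpa [strandComp_eq_none] using hl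
      rw [strandComp_of_ne hl, h l hl]
    intro x hx y hy
    rw [this x hx, this y hy]
  have : 0 < (G.remove w b).numComp Set.univ :=
    Nat.card_pos_iff.2 ⟨⟨(G.remove w b).comp Set.univ (strand hk)⟩, inferInstance⟩
  omega

end ColoredGraph

namespace ColoredGraph

variable {D : ℕ} {G : ColoredGraph.{u} D}

theorem WhiteRel.symm {T : Set (Fin (D + 1))} {a a' : G.W} (h : G.WhiteRel T a a') :
    G.WhiteRel T a' a := by
  obtain ⟨i, hi, j, hj, e⟩ := h
  exact ⟨j, hj, i, hi, e.symm⟩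

theorem comp_induction {T : Set (Fin (D + 1))} {p : G.W → Prop}
    (h : ∀ a a', G.WhiteRel T a a' → p a → p a') {a a' : G.W} (e : G.comp T a = G.comp T a')
    (ha : p a) : p a' := by
  have := congrArg (Quot.lift p fun a a' r => propext ⟨h a a' r, h a' a r.symm⟩) e
  exact this.mp ha

/-! ### Restriction to a union of components -/

/-- The part of `G` formed by the components in `P`. -/
def restrict (G : ColoredGraph.{u} D) (P : Set (G.Comp Set.univ)) : ColoredGraph.{u} D where
  W := {a // G.comp Set.univ a ∈ P}
  B := {y // G.comp Set.univ ((G.edge 0).symm y) ∈ P}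
  finite_W := inferInstance
  finite_B := inferInstance
  edge i := (G.edge i).subtypeEquiv fun a => by
    rw [comp_eq (G := G) (T := Set.univ) (i := i) (j := 0) (a := a)
      (a' := (G.edge 0).symm (G.edge i a)) (Set.mem_univ _) (Set.mem_univ _) (by simp)]

theorem restrict_edge_eq_iff {P : Set (G.Comp Set.univ)} {i j : Fin (D + 1)}
    {a a' : (G.restrict P).W} :
    (G.restrict P).edge i a = (G.restrict P).edge j a' ↔ G.edge i a.1 = G.edge j a'.1 :=
  Subtype.ext_iff

theorem card_restrict (P : Set (G.Comp Set.univ)) :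
    Nat.card G.W = Nat.card (G.restrict P).W + Nat.card (G.restrict Pᶜ).W := by
  classical
  rw [← Nat.card_sum]
  exact Nat.card_congr (Equiv.sumCompl fun a => G.comp Set.univ a ∈ P).symm

theorem numComp_restrict (P : Set (G.Comp Set.univ)) (T : Set (Fin (D + 1))) :
    G.numComp T = (G.restrict P).numComp T + (G.restrict Pᶜ).numComp T := by
  classical
  let f : G.W → (G.restrict P).Comp T ⊕ (G.restrict Pᶜ).Comp T := fun a =>
    if h : G.comp Set.univ a ∈ P then Sum.inl ((G.restrict P).comp T ⟨a, h⟩)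
    else Sum.inr ((G.restrict Pᶜ).comp T ⟨a, h⟩)
  have hf : ∀ a a', G.WhiteRel T a a' → f a = f a' := by
    rintro a a' ⟨i, hi, j, hj, e⟩
    have hu : G.comp Set.univ a = G.comp Set.univ a' := comp_eq (Set.mem_univ _) (Set.mem_univ _) e
    by_cases h : G.comp Set.univ a ∈ P
    · have h' : G.comp Set.univ a' ∈ P := hu ▸ h
      simp only [f, h, h', dif_pos]
      exact congrArg Sum.inl (comp_eq hi hj (restrict_edge_eq_iff.2 e))
    · have h' : G.comp Set.univ a' ∉ P := hu ▸ h
      simp only [f, h, h', dif_neg, not_false_eq_true]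
      exact congrArg Sum.inr (comp_eq hi hj (restrict_edge_eq_iff.2 e))
  have back : ∀ Q : Set (G.Comp Set.univ), ∀ a a' : (G.restrict Q).W,
      (G.restrict Q).WhiteRel T a a' → G.comp T a.1 = G.comp T a'.1 := by
    rintro Q a a' ⟨i, hi, j, hj, e⟩
    exact comp_eq hi hj (restrict_edge_eq_iff.1 e)
  unfold numComp
  rw [← Nat.card_sum]
  refine Nat.card_congr
    { toFun := Quot.lift f hf
      invFun := Sum.elim (Quot.lift (fun a => G.comp T a.1) (back P))
        (Quot.lift (fun a => G.comp T a.1) (back Pᶜ))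
      left_inv := ?_
      right_inv := ?_ }
  · rintro ⟨a⟩
    by_cases h : G.comp Set.univ a ∈ P <;> simp [f, h]
  · rintro (⟨⟨a, h⟩⟩ | ⟨⟨a, h⟩⟩)
    · simp only [Sum.elim_inl, f, h, dif_pos]
    · simp only [Sum.elim_inr, f, show G.comp Set.univ a ∉ P from h, dif_neg, not_false_eq_true]

theorem excess_restrict (P : Set (G.Comp Set.univ)) :
    G.excess = (G.restrict P).excess + (G.restrict Pᶜ).excess := by
  unfold excess faces₂
  simp only [numComp_restrict P, card_restrict P]
  push_cast
  simp only [Finset.sum_add_distrib]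
  ring

/-- Both summands in `excess_restrict` are nonnegative, so excess zero passes to each. -/
theorem excess_restrict_eq_zero (h0 : G.excess = 0) (P : Set (G.Comp Set.univ)) :
    (G.restrict P).excess = 0 := by
  have := excess_restrict P
  have := excess_nonneg (G.restrict P)
  have := excess_nonneg (G.restrict Pᶜ)
  omega

/-! ### Short faces -/

/-- Faces with more than two vertices have at least four. -/
theorem two_mul_numComp_le (i j : Fin (D + 1)) :
    2 * G.numComp {i, j} ≤ Nat.card G.W + Nat.card {a : G.W // G.edge i a = G.edge j a} := by
  classical
  let π : Equiv.Perm G.W := (G.edge i).trans (G.edge j).symm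
  have hπ : ∀ a, G.edge i a = G.edge j (π a) := fun a => by simp [π]
  have hcomp : ∀ a, G.comp {i, j} (π a) = G.comp {i, j} a := fun a =>
    (comp_eq (by simp) (by simp) (hπ a)).symm
  have hout : ∀ c : G.Comp {i, j}, G.comp {i, j} c.out = c := fun c => Quot.out_eq c
  -- Each face contributes a representative and the next white vertex along it. If the two agree,
  -- the face has two vertices, and the second summand of the target supplies another copy.
  let f : G.Comp {i, j} ⊕ G.Comp {i, j} → G.W ⊕ {a : G.W // G.edge i a = G.edge j a} :=
    Sum.elim (fun c => Sum.inl c.out) fun c =>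
      if h : G.edge i c.out = G.edge j c.out then Sum.inr ⟨c.out, h⟩ else Sum.inl (π c.out)
  have hf : Function.Injective f := by
    have hmix : ∀ c c', f (Sum.inl c) ≠ f (Sum.inr c') := by
      intro c c' e
      simp only [f, Sum.elim_inl, Sum.elim_inr] at e
      split_ifs at e with h
      have e : c.out = π c'.out := Sum.inl_injective e
      have hcc : c = c' := by rw [← hout c, e, hcomp, hout]
      subst hcc
      exact h ((hπ _).trans (by rw [← e]))
    rintro (c | c) (c' | c') e
    · have e : c.out = c'.out := Sum.inl_injective e
      rw [← hout c, e, hout]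
    · exact (hmix _ _ e).elim
    · exact (hmix _ _ e.symm).elim
    · simp only [f, Sum.elim_inr] at e
      split_ifs at e
      · have e : c.out = c'.out := congrArg Subtype.val (Sum.inr_injective e)
        rw [← hout c, e, hout]
      · have e := π.injective (Sum.inl_injective e)
        rw [← hout c, e, hout]
  have := Nat.card_le_card_of_injective f hf
  rwa [Nat.card_sum, Nat.card_sum, ← two_mul] at this

/-- Otherwise every face with two vertices uses the line of color `k` at `x`: at most one for each
of the 2D ordered pairs of colors containing `k`, and none for the other pairs. With p white
vertices and c components, `two_mul_numComp_le` then gives 2 `faces₂` ≤ D(D+1)p + 2D, while excess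
zero gives 2 `faces₂` = 2D(D-1)p + 4Dc. This is impossible for D ≥ 3 and c ≥ 1. The line at `x` is
marked because in the application it is a spliced line, not a line of the larger graph. -/
theorem exists_parallel (hD : 3 ≤ D) (h0 : G.excess = 0) (x : G.W) (k : Fin (D + 1)) :
    ∃ i j a, i ≠ j ∧ G.edge i a = G.edge j a ∧ ¬(a = x ∧ (i = k ∨ j = k)) := by
  classical
  by_contra! hcon
  have hfix : ∀ i, ∀ j ∈ Finset.univ.erase i,
      (Nat.card {a : G.W // G.edge i a = G.edge j a} : ℤ) ≤
        (if i = k then 1 else 0) + (if j = k then 1 else 0) := by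
    intro i j hj
    have hij : i ≠ j := (Finset.ne_of_mem_erase hj).symm
    rcases isEmpty_or_nonempty {a : G.W // G.edge i a = G.edge j a} with h | ⟨⟨a, ha⟩⟩
    · rw [Nat.card_of_isEmpty]
      split_ifs <;> norm_num
    · have h1 : Nat.card {a : G.W // G.edge i a = G.edge j a} ≤ 1 := by
        rw [Finite.card_le_one_iff_subsingleton]
        exact ⟨fun a a' => Subtype.ext
          ((hcon i j a.1 hij a.2).1.trans (hcon i j a'.1 hij a'.2).1.symm)⟩
      have h1 : (Nat.card {a : G.W // G.edge i a = G.edge j a} : ℤ) ≤ 1 := by exact_mod_cast h1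
      refine h1.trans ?_
      rcases (hcon i j a hij ha).2 with h | h
      · rw [if_pos h]; split_ifs <;> norm_num
      · rw [if_pos h]; split_ifs <;> norm_num
  have hF : 2 * G.faces₂ ≤ (D + 1) * D * Nat.card G.W + 2 * D := by
    have h1 : 2 * G.faces₂ ≤ ∑ i, ∑ j ∈ Finset.univ.erase i, ((Nat.card G.W : ℤ) +
        ((if i = k then 1 else 0) + (if j = k then 1 else 0))) := by
      unfold faces₂
      rw [Finset.mul_sum]
      refine Finset.sum_le_sum fun i _ => ?_
      rw [Finset.mul_sum]
      refine Finset.sum_le_sum fun j hj => ?_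
      have := two_mul_numComp_le (G := G) i j
      have := hfix i j hj
      omega
    refine h1.trans (le_of_eq ?_)
    have h2 : ∀ i : Fin (D + 1), ((Finset.univ.erase i).card : ℤ) = D := by
      intro i
      simp
    have h3 : ∀ i : Fin (D + 1), ∑ j ∈ Finset.univ.erase i, (if j = k then 1 else 0 : ℤ) =
        1 - (if i = k then 1 else 0) := by
      intro i
      rw [Finset.sum_erase_eq_sub (Finset.mem_univ i)]
      simp
    simp only [Finset.sum_add_distrib, Finset.sum_const, nsmul_eq_mul, h2, h3,
      Finset.sum_sub_distrib, ← Finset.mul_sum]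
    simp
    ring
  have hN : 1 ≤ G.numComp Set.univ := Nat.card_pos_iff.2 ⟨⟨G.comp Set.univ x⟩, inferInstance⟩
  unfold excess at h0
  have hp : (0 : ℤ) ≤ Nat.card G.W := by positivity
  have hD' : (3 : ℤ) ≤ D := by exact_mod_cast hD
  have hN' : (1 : ℤ) ≤ G.numComp Set.univ := by exact_mod_cast hN
  generalize (Nat.card G.W : ℤ) = p at *
  generalize (G.numComp Set.univ : ℤ) = c at *
  generalize (D : ℤ) = d at *
  nlinarith [mul_nonneg (mul_nonneg (by linarith : 0 ≤ d) (by linarith : 0 ≤ d - 3)) hp,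
    mul_nonneg (by linarith : 0 ≤ d) (by linarith : 0 ≤ c - 1)]

/-! ### Dipoles -/

/-- Some pair of vertices is joined by exactly `D` lines. -/
def HasDipole (G : ColoredGraph.{u} D) : Prop :=
  ∃ (i : Fin (D + 1)) (w : G.W) (b : G.B), G.edge i w ≠ b ∧ ∀ j ≠ i, G.edge j w = b

/-- Two vertices joined by all D + 1 lines form a whole component. -/
theorem exists_edge_ne (h1 : G.numComp Set.univ = 1) (hp : 2 ≤ Nat.card G.W) (w : G.W) (b : G.B) :
    ∃ k, G.edge k w ≠ b := by
  by_contra! h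
  have hw : ∀ a, a = w := by
    intro a
    have : Subsingleton (G.Comp Set.univ) := Finite.card_le_one_iff_subsingleton.1 h1.le
    refine comp_induction (p := fun a => a = w) (T := Set.univ) ?_
      (Subsingleton.elim (G.comp Set.univ w) (G.comp Set.univ a)) rfl
    rintro a a' ⟨i, -, j, -, e⟩ rfl
    rw [h i, ← h j] at e
    exact ((G.edge j).injective e).symm
  have : Nat.card G.W ≤ 1 := Finite.card_le_one_iff_subsingleton.2
    ⟨fun a a' => (hw a).trans (hw a').symm⟩
  omega

/-- The white vertices of a component of `G - {w, b}`, as vertices of `G`. -/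
def branch (G : ColoredGraph.{u} D) (w : G.W) (b : G.B) (c : (G.remove w b).Comp Set.univ) :
    Set G.W :=
  {a | ∃ h : a ≠ w, (G.remove w b).comp Set.univ ⟨a, h⟩ = c}

/-- Descent on the size of a branch at two vertices joined by at least two lines. By
`strand_separated` the branch contains a single spliced line, so parallel lines that
`exists_parallel` finds in it away from that line are parallel in `G`. If their ends `a`, `y` are
not joined by D lines, they have at least two branches, at most one of which contains `w`; any other
one lies strictly inside the old branch. -/
theorem hasDipole_of_branch (hD : 3 ≤ D) (h1 : G.numComp Set.univ = 1) (h0 : G.excess = 0)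
    (n : ℕ) : ∀ (w : G.W) (b : G.B) (i j k : Fin (D + 1)), i ≠ j → G.edge i w = b →
      G.edge j w = b → ∀ hk : G.edge k w ≠ b,
      (G.branch w b ((G.remove w b).comp Set.univ (strand hk))).ncard = n → G.HasDipole := by
  induction n using Nat.strong_induction_on with
  | _ n ih =>
  intro w b i j k hij hi hj hk hn
  set c := (G.remove w b).comp Set.univ (strand hk) with hc
  have hcs : ∀ l, ∀ a (ha : a ≠ w), (G.remove w b).comp Set.univ ⟨a, ha⟩ = c → G.edge l a = b →
      l = k ∧ (⟨a, ha⟩ : (G.remove w b).W) = strand hk := by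
    intro l a ha hac e
    have hl := ne_of_edge ha e
    have hs := strand_eq hl ha e
    have hlk : l = k := strand_separated h0 hij hi hj hl hk (by rw [hs, hac])
    subst hlk
    exact ⟨rfl, hs.symm⟩
  have hH0 := excess_restrict_eq_zero (excess_remove_eq_zero h0 hi) {c}
  obtain ⟨i', j', ⟨⟨a, haw⟩, hac⟩, hij', hpar, hmark⟩ :=
    exists_parallel hD hH0 ⟨strand hk, rfl⟩ k
  have hac : (G.remove w b).comp Set.univ ⟨a, haw⟩ = c := hac
  have hpar := remove_edge_eq_iff.1 (restrict_edge_eq_iff.1 hpar)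
  have hib : G.edge i' a ≠ b := fun e =>
    hmark ⟨Subtype.ext (hcs i' a haw hac e).2, Or.inl (hcs i' a haw hac e).1⟩
  have hjb : G.edge j' a ≠ b := fun e =>
    hmark ⟨Subtype.ext (hcs j' a haw hac e).2, Or.inr (hcs j' a haw hac e).1⟩
  have hpar : G.edge i' a = G.edge j' a :=
    (remove_edge_of_ne haw hib).symm.trans (hpar.trans (remove_edge_of_ne haw hjb))
  set y := G.edge i' a with hy
  by_cases hM : ∃ l₁ l₂, l₁ ≠ l₂ ∧ G.edge l₁ a ≠ y ∧ G.edge l₂ a ≠ y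
  swap
  · push Not at hM
    have hp : 2 ≤ Nat.card G.W := by
      have : Nontrivial G.W := ⟨a, w, haw⟩
      exact Finite.one_lt_card
    obtain ⟨l, hl⟩ := exists_edge_ne h1 hp a y
    exact ⟨l, a, y, hl, fun l' hl' => hM l l' hl'.symm hl⟩
  have hwa : w ≠ a := haw.symm
  obtain ⟨l, hl, hlw⟩ : ∃ l, ∃ hl : G.edge l a ≠ y,
      (G.remove a y).comp Set.univ ⟨w, hwa⟩ ≠ (G.remove a y).comp Set.univ (strand hl) := by
    obtain ⟨l₁, l₂, hne, hl₁, hl₂⟩ := hM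
    by_contra! hcon
    exact hne (strand_separated h0 hij' hy.symm hpar.symm hl₁ hl₂
      ((hcon l₁ hl₁).symm.trans (hcon l₂ hl₂)))
  refine ih _ ?_ a y i' j' l hij' hy.symm hpar.symm hl rfl
  rw [← hn]
  set d := (G.remove a y).comp Set.univ (strand hl) with hd
  have hby : b ≠ y := hib.symm
  have hwb : ∀ t a' (ha' : a' ≠ a), (G.remove a y).comp Set.univ ⟨a', ha'⟩ = d →
      baseB ((G.remove a y).edge t ⟨a', ha'⟩) ≠ b := by
    intro t a' ha' hd' e
    apply hlw
    rw [← hd']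
    refine comp_eq (i := i) (j := t) (Set.mem_univ _) (Set.mem_univ _) (remove_edge_eq_iff.2 ?_)
    rw [remove_edge_of_ne hwa (by rw [hi]; exact hby), e, hi]
  have hmem : ∀ a' (ha' : a' ≠ a), (G.remove a y).comp Set.univ ⟨a', ha'⟩ = d →
      a' ∈ G.branch w b c := by
    intro a' ha' hd'
    -- A walk in the new branch meets neither `w` nor `b`. It therefore stays in the old branch: a
    -- step over a spliced line is replaced by a detour through `a` and `y`, which lie there too.
    let p : (G.remove a y).W → Prop := fun z =>
      (G.remove a y).comp Set.univ z = d ∧ z.1 ∈ G.branch w b c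
    have hstart : p (strand hl) := by
      refine ⟨rfl, fun e => hlw ?_, ?_⟩
      · rw [hd]
        congr 1
        exact Subtype.ext e.symm
      · rw [← hac]
        refine remove_comp_eq (i := l) (j := i') (Set.mem_univ _) (Set.mem_univ _) _ _ ?_ ?_
        · rw [edge_strand]
        · rw [edge_strand]; exact hby.symm
    refine (comp_induction (p := p) (T := Set.univ) ?_ hd'.symm hstart).2
    rintro ⟨a₁, h₁⟩ ⟨a₂, h₂⟩ hrel ⟨hd₁, hw₁, hc₁⟩
    have hd₂ : (G.remove a y).comp Set.univ ⟨a₂, h₂⟩ = d := (Quot.sound hrel).symm.trans hd₁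
    refine ⟨hd₂, ?_⟩
    have hw₂ : a₂ ≠ w := by
      rintro rfl
      exact hlw hd₂
    refine ⟨hw₂, ?_⟩
    obtain ⟨r, -, t, -, e⟩ := hrel
    replace e := remove_edge_eq_iff.1 e
    have hb₁ := hwb r a₁ h₁ hd₁
    have hb₂ := hwb t a₂ h₂ hd₂
    have hc₁ : (G.remove w b).comp Set.univ ⟨a₁, hw₁⟩ = c := hc₁
    by_cases e₁ : G.edge r a₁ = y <;> by_cases e₂ : G.edge t a₂ = y
    · rw [← hc₁]
      exact (remove_comp_eq (Set.mem_univ _) (Set.mem_univ _) hw₁ hw₂ (e₁.trans e₂.symm)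
        (by rw [e₁]; exact hby.symm)).symm
    · rw [remove_edge_of_eq h₁ e₁] at hb₁ e
      rw [remove_edge_of_ne h₂ e₂] at e
      rw [← hac]
      exact (remove_comp_eq (Set.mem_univ _) (Set.mem_univ _) haw hw₂ e hb₁).symm
    · rw [← hac]
      exact remove_comp_eq (Set.mem_univ _) (Set.mem_univ _) hw₂ haw (e₂.trans hy)
        (by rw [e₂]; exact hby.symm)
    · rw [remove_edge_of_ne h₁ e₁] at hb₁ e
      rw [remove_edge_of_ne h₂ e₂] at e
      rw [← hc₁]
      exact (remove_comp_eq (Set.mem_univ _) (Set.mem_univ _) hw₁ hw₂ e hb₁).symm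
  refine Set.ncard_lt_ncard ⟨?_, ?_⟩ (Set.toFinite _)
  · rintro a' ⟨ha', hd'⟩
    exact hmem a' ha' hd'
  -- The inclusion is strict because `a` belongs to the old branch and has been deleted from the new
  -- one.
  · intro hsub
    obtain ⟨h, -⟩ := hsub ⟨haw, hac⟩
    exact h rfl

end ColoredGraph

namespace ColoredGraph

variable {D : ℕ} {G : ColoredGraph.{u} D}

/-- Only one line is spliced, so removing the pair cannot disconnect the graph, and inserting a pair
on the spliced line restores it. The bound on `D` provides a line between the two vertices, which
keeps the excess zero. -/
theorem HasDipole.exists_insertPair (h : G.HasDipole) (h1 : G.numComp Set.univ = 1)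
    (h0 : G.excess = 0) (hD : 1 ≤ D) :
    ∃ (H : ColoredGraph.{u} D) (i : Fin (D + 1)) (w : H.W), Nonempty (Iso (H.insertPair i w) G) ∧
      H.numComp Set.univ = 1 ∧ H.excess = 0 ∧ Nat.card G.W = Nat.card H.W + 1 := by
  classical
  obtain ⟨i, w, b, hi, hj⟩ := h
  refine ⟨G.remove w b, i, strand hi, ⟨⟨Equiv.optionSubtypeNe w, Equiv.optionSubtypeNe b, ?_⟩⟩,
    ?_, ?_, card_remove G w b⟩
  · have hsome : ∀ j x, j ≠ i → Equiv.optionSubtypeNe b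
        (some ((G.remove w b).edge j x) : Option (G.remove w b).B) = G.edge j x.1 := by
      intro j x hji
      exact remove_edge_of_ne x.2 fun e => x.2 ((G.edge j).injective (e.trans (hj j hji).symm))
    intro j x
    by_cases hji : j = i
    · subst hji
      rcases x with _ | x
      · rw [insertPair_edge_none]
        exact remove_edge_strand hi
      · by_cases hx : x = strand hi
        · subst hx
          rw [insertPair_edge_some_self]
          exact (edge_strand hi).symm
        · rw [insertPair_edge_some_of_ne _ _ _ _ hx]
          exact remove_edge_of_ne x.2 fun e => hx (strand_eq hi x.2 e).symm
    · rw [insertPair_edge_of_ne _ _ hji]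
      rcases x with _ | x
      · exact (hj j hji).symm
      · exact hsome j x hji
  · refine numComp_remove_univ h1 hi fun l hl => ?_
    have : l = i := by
      by_contra hne
      exact hl (hj l hne)
    subst this
    rfl
  · obtain ⟨j, hji⟩ : ∃ j, j ≠ i := by
      have : Nontrivial (Fin (D + 1)) := Fin.nontrivial_iff_two_le.2 (by omega)
      exact exists_ne i
    exact excess_remove_eq_zero h0 (hj j hji)

theorem hasDipole_of_three_le (hD : 3 ≤ D) (h1 : G.numComp Set.univ = 1) (h0 : G.excess = 0)
    (hp : 2 ≤ Nat.card G.W) : G.HasDipole := by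
  obtain ⟨x⟩ : Nonempty G.W := (Nat.card_pos_iff.1 (by omega)).1
  obtain ⟨i, j, w, hij, he, -⟩ := exists_parallel hD h0 x 0
  obtain ⟨k, hk⟩ := exists_edge_ne h1 hp w (G.edge i w)
  exact hasDipole_of_branch hD h1 h0 _ w _ i j k hij rfl he.symm hk rfl

theorem hasDipole_of_one {G : ColoredGraph.{u} 1} (h1 : G.numComp Set.univ = 1)
    (hp : 2 ≤ Nat.card G.W) : G.HasDipole := by
  obtain ⟨w⟩ : Nonempty G.W := (Nat.card_pos_iff.1 (by omega)).1
  obtain ⟨k, hk⟩ := exists_edge_ne h1 hp w (G.edge 0 w)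
  have hk0 : k ≠ 0 := by rintro rfl; exact hk rfl
  refine ⟨k, w, _, hk, fun j hj => ?_⟩
  have : j = 0 := by omega
  rw [this]

/-- A graph with one white vertex is the elementary dipole. -/
theorem nonempty_iso_dipole (h : Nat.card G.W = 1) : Nonempty (Iso (dipole D) G) := by
  obtain ⟨hs, ⟨w⟩⟩ := Nat.card_eq_one_iff_unique.1 h
  have hb : Subsingleton G.B := (G.edge 0).symm.subsingleton
  let := uniqueOfSubsingleton w
  let := uniqueOfSubsingleton (G.edge 0 w)
  exact ⟨⟨(Equiv.ofUnique PUnit G.W : PUnit ≃ G.W), (Equiv.ofUnique PUnit G.B : PUnit ≃ G.B),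
    fun _ _ => Subsingleton.elim _ _⟩⟩

theorem isMelonic_of_excess (hD : 3 ≤ D) (n : ℕ) : ∀ G : ColoredGraph.{u} D,
    G.numComp Set.univ = 1 → G.excess = 0 → Nat.card G.W = n → G.IsMelonic := by
  induction n with
  | zero =>
    intro G h1 _ hn
    have : IsEmpty G.W := (Nat.card_eq_zero.1 hn).resolve_right (by simpa using G.finite_W)
    have : IsEmpty (G.Comp Set.univ) := ⟨fun c => this.elim (Quot.exists_rep c).choose⟩
    simp [numComp] at h1
  | succ n ih =>
    intro G h1 h0 hn
    by_cases hp : 2 ≤ Nat.card G.W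
    · obtain ⟨H, i, w, hiso, hH1, hH0, hc⟩ :=
        (hasDipole_of_three_le hD h1 h0 hp).exists_insertPair h1 h0 (by omega)
      exact .iso _ _ hiso (.insert H i w (ih H hH1 hH0 (by omega)))
    · exact .iso _ _ (nonempty_iso_dipole (by omega)) .dipole

/-! ### Three colors -/

/-- Faces with more than four vertices have at least six. -/
theorem three_mul_numComp_le {i j : Fin (D + 1)} (hfix : ∀ a, G.edge i a ≠ G.edge j a)
    (hsq : ∀ a a', a ≠ a' → G.edge i a = G.edge j a' → G.edge i a' ≠ G.edge j a) :
    3 * G.numComp {i, j} ≤ Nat.card G.W := by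
  let π : Equiv.Perm G.W := (G.edge i).trans (G.edge j).symm
  have hπ : ∀ a, G.edge i a = G.edge j (π a) := fun a => by simp [π]
  have hcomp : ∀ a, G.comp {i, j} (π a) = G.comp {i, j} a := fun a =>
    (comp_eq (by simp) (by simp) (hπ a)).symm
  have hout : ∀ c : G.Comp {i, j}, G.comp {i, j} c.out = c := fun c => Quot.out_eq c
  have h1 : ∀ a, π a ≠ a := fun a e => hfix a (by rw [hπ a, e])
  have h2 : ∀ a, π (π a) ≠ a := fun a e => hsq a (π a) (h1 a).symm (hπ a) (by rw [hπ (π a), e])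
  let f : G.Comp {i, j} ⊕ G.Comp {i, j} ⊕ G.Comp {i, j} → G.W :=
    Sum.elim (fun c => c.out) (Sum.elim (fun c => π c.out) fun c => π (π c.out))
  let g : G.Comp {i, j} ⊕ G.Comp {i, j} ⊕ G.Comp {i, j} → G.Comp {i, j} :=
    Sum.elim id (Sum.elim id id)
  have hfg : ∀ x, G.comp {i, j} (f x) = g x := by
    rintro (c | c | c)
    · exact hout c
    · exact (hcomp _).trans (hout c)
    · exact (hcomp _).trans ((hcomp _).trans (hout c))
  have hf : Function.Injective f := by
    intro x x' e
    have hg : g x = g x' := by rw [← hfg, e, hfg]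
    rcases x with c | c | c <;> rcases x' with c' | c' | c' <;>
      · simp only [g, Sum.elim_inl, Sum.elim_inr, id] at hg
        subst hg
        simp only [f, Sum.elim_inl, Sum.elim_inr] at e
        first
        | rfl
        | exact (h1 _ e.symm).elim
        | exact (h1 _ e).elim
        | exact (h2 _ e.symm).elim
        | exact (h2 _ e).elim
  have := Nat.card_le_card_of_injective f hf
  rw [Nat.card_sum, Nat.card_sum] at this
  unfold numComp
  omega

/-- A face with four vertices in a graph without faces with two vertices. -/
structure Square (G : ColoredGraph.{u} 2) where
  /-- the color of the lines leaving the face -/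
  i : Fin 3
  /-- the first color of the face -/
  j : Fin 3
  /-- the second color of the face -/
  k : Fin 3
  /-- a white vertex -/
  w₁ : G.W
  /-- the other white vertex -/
  w₂ : G.W
  hij : i ≠ j
  hik : i ≠ k
  hjk : j ≠ k
  hw : w₂ ≠ w₁
  edge_ne : ∀ {a b} (_ : a ≠ b) x, G.edge a x ≠ G.edge b x
  edge_jk : G.edge j w₁ = G.edge k w₂
  edge_kj : G.edge k w₁ = G.edge j w₂

/-- With three colors, a face with two vertices is a pair joined by D = 2 lines. If there are no
faces with two or four vertices, all have at least six, so 3 `faces₂` ≤ 6p, whereas excess zero and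
connectedness give `faces₂` = 2p + 4. -/
theorem hasDipole_or_square {G : ColoredGraph.{u} 2} (h1 : G.numComp Set.univ = 1)
    (h0 : G.excess = 0) (hp : 2 ≤ Nat.card G.W) : G.HasDipole ∨ Nonempty G.Square := by
  have hthird : ∀ i j : Fin 3, i ≠ j → ∃ k, k ≠ i ∧ k ≠ j ∧ ∀ l, l ≠ k → l = i ∨ l = j := by
    decide
  by_cases hne : ∀ i j : Fin 3, i ≠ j → ∀ a, G.edge i a ≠ G.edge j a
  swap
  · left
    push Not at hne
    obtain ⟨i, j, hij, a, e⟩ := hne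
    obtain ⟨k, hk⟩ := exists_edge_ne h1 hp a (G.edge i a)
    obtain ⟨k', hki, hkj, hall⟩ := hthird i j hij
    have hkk : k = k' := by
      by_contra hc
      rcases hall k hc with rfl | rfl
      · exact hk rfl
      · exact hk e.symm
    subst hkk
    refine ⟨k, a, _, hk, fun l hl => ?_⟩
    rcases hall l hl with rfl | rfl
    · rfl
    · exact e.symm
  · right
    by_contra hcon
    have hle : ∀ i : Fin 3, ∀ j ∈ Finset.univ.erase i,
        3 * (G.numComp {i, j} : ℤ) ≤ Nat.card G.W := by
      intro j k hk
      have hjk : j ≠ k := (Finset.ne_of_mem_erase hk).symm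
      have := three_mul_numComp_le (G := G) (i := j) (j := k) (hne j k hjk) (by
        intro a a' haa e e'
        obtain ⟨i, hij, hik, -⟩ := hthird j k hjk
        exact hcon ⟨⟨i, j, k, a, a', hij, hik, hjk, haa.symm, fun h x => hne _ _ h x, e, e'.symm⟩⟩)
      exact_mod_cast this
    have hF : 3 * G.faces₂ ≤ ∑ i : Fin 3, ∑ j ∈ Finset.univ.erase i, (Nat.card G.W : ℤ) := by
      unfold faces₂
      rw [Finset.mul_sum]
      refine Finset.sum_le_sum fun i _ => ?_
      rw [Finset.mul_sum]
      exact Finset.sum_le_sum (hle i)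
    have : ∑ i : Fin 3, ∑ j ∈ Finset.univ.erase i, (Nat.card G.W : ℤ) = 6 * Nat.card G.W := by
      simp
      ring
    rw [this] at hF
    unfold excess at h0
    rw [h1] at h0
    push_cast at h0
    omega

namespace Square

variable {G : ColoredGraph.{u} 2} (s : G.Square)

/-- The black vertex joined to `w₁` by the color leaving the face. -/
def b₀ : G.B := G.edge s.i s.w₁

theorem edge_j_ne : G.edge s.j s.w₁ ≠ s.b₀ := s.edge_ne s.hij.symm _

theorem edge_k_ne : G.edge s.k s.w₁ ≠ s.b₀ := s.edge_ne s.hik.symm _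

theorem color_cases (l : Fin 3) : l = s.i ∨ l = s.j ∨ l = s.k := by
  have : ∀ i j k : Fin 3, i ≠ j → i ≠ k → j ≠ k → ∀ l, l = i ∨ l = j ∨ l = k := by decide
  exact this _ _ _ s.hij s.hik s.hjk l

/-- The graph without the pair `w₁`, `b₀`. -/
noncomputable abbrev reduced : ColoredGraph.{u} 2 := G.remove s.w₁ s.b₀

/-- The spliced lines of colors `j` and `k` end at the two black vertices of the face, both of which
remain neighbors of `w₂`. -/
theorem numComp_reduced (h1 : G.numComp Set.univ = 1) : s.reduced.numComp Set.univ = 1 := by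
  have key : ∀ l (hl : G.edge l s.w₁ ≠ s.b₀), s.reduced.comp Set.univ (strand hl) =
      s.reduced.comp Set.univ ⟨s.w₂, s.hw⟩ := by
    intro l hl
    rcases s.color_cases l with rfl | rfl | rfl
    · exact (hl rfl).elim
    · refine comp_eq (i := s.j) (j := s.k) (Set.mem_univ _) (Set.mem_univ _)
        (remove_edge_eq_iff.2 ?_)
      rw [remove_edge_strand, remove_edge_of_ne s.hw (s.edge_jk ▸ s.edge_j_ne), s.edge_jk]
    · refine comp_eq (i := s.k) (j := s.j) (Set.mem_univ _) (Set.mem_univ _)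
        (remove_edge_eq_iff.2 ?_)
      rw [remove_edge_strand, remove_edge_of_ne s.hw (s.edge_kj ▸ s.edge_k_ne), s.edge_kj]
  exact numComp_remove_univ h1 s.edge_j_ne fun l hl => (key l hl).trans (key _ _).symm

theorem excess_reduced (h0 : G.excess = 0) : s.reduced.excess = 0 :=
  excess_remove_eq_zero h0 (i := s.i) rfl

end Square

end ColoredGraph

/-! ### Polyhedra -/

/-- Finite intersections of closed half-spaces. -/
def IsPolyhedron {E : Type*} [AddCommGroup E] [Module ℝ E] (P : Set E) : Prop :=
  ∃ s : Finset (E →ᵃ[ℝ] ℝ), P = {x | ∀ ℓ ∈ s, 0 ≤ ℓ x}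

namespace IsPolyhedron

section

variable {E F : Type*} [AddCommGroup E] [Module ℝ E] [AddCommGroup F] [Module ℝ F]

theorem inter {P Q : Set E} (hP : IsPolyhedron P) (hQ : IsPolyhedron Q) : IsPolyhedron (P ∩ Q) := by
  classical
  obtain ⟨s, rfl⟩ := hP
  obtain ⟨t, rfl⟩ := hQ
  refine ⟨s ∪ t, ?_⟩
  ext x
  simp only [Set.mem_inter_iff, Set.mem_ofPred_eq, Finset.mem_union]
  exact ⟨fun h ℓ hℓ => hℓ.elim (h.1 ℓ) (h.2 ℓ),
    fun h => ⟨fun ℓ hℓ => h ℓ (Or.inl hℓ), fun ℓ hℓ => h ℓ (Or.inr hℓ)⟩⟩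

theorem preimage {Q : Set F} (hQ : IsPolyhedron Q) (g : E →ᵃ[ℝ] F) : IsPolyhedron (g ⁻¹' Q) := by
  classical
  obtain ⟨t, rfl⟩ := hQ
  refine ⟨t.image fun ℓ => ℓ.comp g, ?_⟩
  ext x
  simp

theorem halfSpace (ℓ : E →ᵃ[ℝ] ℝ) : IsPolyhedron {x | 0 ≤ ℓ x} :=
  ⟨{ℓ}, by simp⟩

theorem univ : IsPolyhedron (Set.univ : Set E) := ⟨∅, by simp⟩

theorem of_forall {ι : Type*} [Fintype ι] (ℓ : ι → E →ᵃ[ℝ] ℝ) :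
    IsPolyhedron {x | ∀ i, 0 ≤ ℓ i x} := by
  classical
  exact ⟨Finset.univ.image ℓ, by simp⟩

end

variable {E : Type*} [NormedAddCommGroup E] [NormedSpace ℝ E] {P : Set E}

theorem isClosed [FiniteDimensional ℝ E] (hP : IsPolyhedron P) : IsClosed P := by
  obtain ⟨s, rfl⟩ := hP
  simp only [Set.ofPred_forall]
  exact isClosed_biInter fun ℓ _ => isClosed_le continuous_const ℓ.continuous_of_finiteDimensional

theorem convex (hP : IsPolyhedron P) : Convex ℝ P := by
  obtain ⟨s, rfl⟩ := hP
  simp only [Set.ofPred_forall]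
  exact convex_iInter₂ fun ℓ _ => (convex_Ici (0 : ℝ)).affine_preimage ℓ

theorem finite_extremePoints (hP : IsPolyhedron P) : (P.extremePoints ℝ).Finite := by
  classical
  obtain ⟨s, rfl⟩ := hP
  -- an extreme point is determined by the constraints that are tight at it
  refine Set.Finite.of_finite_image (f := fun x => s.filter fun ℓ => ℓ x = 0)
    ((Finset.finite_toSet s.powerset).subset ?_) ?_
  · rintro _ ⟨x, -, rfl⟩
    exact Finset.mem_coe.2 (Finset.mem_powerset.2 (Finset.filter_subset _ _))
  · intro x hx y hy hxy
    simp only at hxy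
    have hseg : ∀ (ℓ : E →ᵃ[ℝ] ℝ) (ε : ℝ), ℓ (AffineMap.lineMap x y (-ε)) =
        ℓ x - ε * (ℓ y - ℓ x) := by
      intro ℓ ε
      rw [AffineMap.apply_lineMap, AffineMap.lineMap_apply_module']
      simp
      ring
    -- The segment from `y` to `x` can be prolonged a little beyond `x` inside the polyhedron:
    -- constraints tight at `x` are tight at `y` and vanish on the whole line, the others persist by
    -- continuity. So `x` is interior to a segment ending at `y`, and extremality gives x = y.
    have hev : ∀ᶠ ε : ℝ in nhdsWithin 0 (Set.Ioi 0), ∀ ℓ ∈ s,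
        0 ≤ ℓ (AffineMap.lineMap x y (-ε)) := by
      rw [Filter.eventually_all_finset]
      intro ℓ hℓ
      rcases (hx.1 ℓ hℓ).eq_or_lt with h0 | hpos
      · have : ℓ y = 0 := by
          have : ℓ ∈ s.filter fun ℓ => ℓ x = 0 := by simp [hℓ, ← h0]
          rw [hxy] at this
          exact (Finset.mem_filter.1 this).2
        refine Filter.Eventually.of_forall fun ε => ?_
        rw [hseg, this, ← h0]
        simp
      · have hc : Filter.Tendsto (fun ε : ℝ => ℓ x - ε * (ℓ y - ℓ x)) (nhdsWithin 0 (Set.Ioi 0))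
            (nhds (ℓ x - 0 * (ℓ y - ℓ x))) :=
          Filter.Tendsto.mono_left (Continuous.tendsto (by fun_prop) _) nhdsWithin_le_nhds
        have := hc.eventually_const_le (u := 0) (by simpa using hpos)
        filter_upwards [this] with ε h
        rwa [hseg]
    obtain ⟨ε, hz, hε⟩ := (hev.and self_mem_nhdsWithin).exists
    have hε : 0 < ε := hε
    have hmem : x ∈ openSegment ℝ (AffineMap.lineMap x y (-ε)) y := by
      refine ⟨1 / (1 + ε), ε / (1 + ε), by positivity, by positivity, by field_simp, ?_⟩
      rw [AffineMap.lineMap_apply_module, smul_add, smul_smul, smul_smul, add_assoc, ← add_smul]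
      have e1 : 1 / (1 + ε) * (1 - -ε) = 1 := by field_simp; ring
      have e2 : 1 / (1 + ε) * -ε + ε / (1 + ε) = 0 := by field_simp; ring
      rw [e1, e2]
      simp
    exact ((mem_extremePoints.1 hx).2 _ hz _ hy.1 hmem).2.symm

/-- A compact polyhedron is the convex hull of finitely many points. -/
theorem exists_convexHull [FiniteDimensional ℝ E] (hP : IsPolyhedron P) (hc : IsCompact P) :
    ∃ t : Finset E, convexHull ℝ (t : Set E) = P := by
  have hf := hP.finite_extremePoints
  refine ⟨hf.toFinset, ?_⟩
  rw [hf.coe_toFinset, ← (hf.isClosed_convexHull ℝ).closure_eq,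
    closure_convexHull_extremePoints hc hP.convex]

end IsPolyhedron

theorem isPolyhedron_stdSimplex (n : ℕ) : IsPolyhedron (stdSimplex ℝ (Fin n)) := by
  let σ : (Fin n → ℝ) →ᵃ[ℝ] ℝ := (∑ i, LinearMap.proj i : (Fin n → ℝ) →ₗ[ℝ] ℝ).toAffineMap
  have hσ : ∀ x, σ x = ∑ i, x i := fun x => by simp [σ]
  have h := ((IsPolyhedron.of_forall fun i : Fin n =>
    (LinearMap.proj i : (Fin n → ℝ) →ₗ[ℝ] ℝ).toAffineMap).inter
    (IsPolyhedron.halfSpace (σ - AffineMap.const ℝ _ 1))).inter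
    (IsPolyhedron.halfSpace (AffineMap.const ℝ _ 1 - σ))
  refine (congrArg IsPolyhedron (Set.ext fun x => ?_)).mp h
  have h1 : x ∈ stdSimplex ℝ (Fin n) ↔ (∀ i, 0 ≤ x i) ∧ ∑ i, x i = 1 := Iff.rfl
  rw [h1, ← hσ]
  simp only [Set.mem_ofPred_eq, Set.mem_inter_iff, LinearMap.coe_toAffineMap,
    LinearMap.proj_apply, AffineMap.coe_sub, Pi.sub_apply, AffineMap.const_apply, and_assoc]
  exact and_congr_right fun _ =>
    ⟨fun h => by linarith [h.1, h.2], fun h => ⟨by linarith, by linarith⟩⟩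

/-- Functions that are affine on the pieces of a finite cover by polyhedra. -/
def IsPL {E F : Type*} [AddCommGroup E] [Module ℝ E] [AddCommGroup F] [Module ℝ F] (s : Set E)
    (f : s → F) : Prop :=
  ∃ 𝒮 : Set (Set E), 𝒮.Finite ∧ (∀ P ∈ 𝒮, IsPolyhedron P) ∧ (∀ x : s, ∃ P ∈ 𝒮, (x : E) ∈ P) ∧
    ∀ P ∈ 𝒮, ∃ g : E →ᵃ[ℝ] F, ∀ x : s, (x : E) ∈ P → f x = g x

/-- Half-spaces behave well under intersections and preimages; cut with the compact simplex, each
polyhedron becomes the convex hull of a finite set. -/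
theorem IsPL.piecewiseAffine {n : ℕ} {F : Type*} [AddCommGroup F] [Module ℝ F]
    {f : stdSimplex ℝ (Fin n) → F} (h : IsPL _ f) : PiecewiseAffine _ f := by
  classical
  obtain ⟨𝒮, hfin, hpoly, hcov, haff⟩ := h
  have hex : ∀ P ∈ 𝒮, ∃ t : Finset (Fin n → ℝ), convexHull ℝ (t : Set (Fin n → ℝ)) =
      stdSimplex ℝ (Fin n) ∩ P := fun P hP =>
    ((isPolyhedron_stdSimplex n).inter (hpoly P hP)).exists_convexHull
      ((isCompact_stdSimplex ℝ (Fin n)).inter_right (hpoly P hP).isClosed)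
  choose! t ht using hex
  refine ⟨t '' 𝒮, hfin.image t, ?_, ?_⟩
  · ext x
    simp only [Set.mem_iUnion, Set.biUnion_image, exists_prop]
    constructor
    · rintro ⟨P, hP, hx⟩
      rw [ht P hP] at hx
      exact hx.1
    · intro hx
      obtain ⟨P, hP, hxP⟩ := hcov ⟨x, hx⟩
      refine ⟨P, hP, ?_⟩
      rw [ht P hP]
      exact ⟨hx, hxP⟩
  · rintro _ ⟨P, hP, rfl⟩
    obtain ⟨g, hg⟩ := haff P hP
    refine ⟨g, fun x hx => hg x ?_⟩
    rw [ht P hP] at hx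
    exact hx.2

/-- Composition with a piecewise affine map: each piece is cut by the preimages of the pieces of `φ
a`. -/
theorem IsPL.of_pieces {E E' F : Type*} [AddCommGroup E] [Module ℝ E] [AddCommGroup E']
    [Module ℝ E'] [AddCommGroup F] [Module ℝ F] {s : Set E} {s' : Set E'} {f : s → F}
    {ι : Type*} [Finite ι] {P : ι → Set E} (hP : ∀ a, IsPolyhedron (P a))
    (hcov : ∀ x : s, ∃ a, (x : E) ∈ P a) {φ : ι → s' → F} (hφ : ∀ a, IsPL s' (φ a))
    (g : ι → E →ᵃ[ℝ] E') (hg : ∀ a (x : s), (x : E) ∈ P a → ∃ h : g a x ∈ s', f x = φ a ⟨g a x, h⟩) :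
    IsPL s f := by
  choose 𝒬 hfin hpoly hcov' haff using hφ
  refine ⟨⋃ a, (fun Q => P a ∩ g a ⁻¹' Q) '' 𝒬 a, Set.finite_iUnion fun a => (hfin a).image _,
    ?_, ?_, ?_⟩
  · intro R hR
    obtain ⟨a, Q, hQ, rfl⟩ := Set.mem_iUnion.1 hR
    exact (hP a).inter ((hpoly a Q hQ).preimage (g a))
  · intro x
    obtain ⟨a, hx⟩ := hcov x
    obtain ⟨h, -⟩ := hg a x hx
    obtain ⟨Q, hQ, hxQ⟩ := hcov' a ⟨g a x, h⟩
    exact ⟨_, Set.mem_iUnion.2 ⟨a, Q, hQ, rfl⟩, hx, hxQ⟩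
  · intro R hR
    obtain ⟨a, Q, hQ, rfl⟩ := Set.mem_iUnion.1 hR
    obtain ⟨k, hk⟩ := haff a Q hQ
    refine ⟨k.comp (g a), fun x hx => ?_⟩
    obtain ⟨h, e⟩ := hg a x hx.1
    rw [e, hk ⟨g a x, h⟩ hx.2]
    rfl

theorem IsPL.of_cover {E F : Type*} [AddCommGroup E] [Module ℝ E] [AddCommGroup F] [Module ℝ F]
    {s : Set E} {f : s → F} {ι : Type*} [Finite ι] {P : ι → Set E} (hP : ∀ a, IsPolyhedron (P a))
    (hcov : ∀ x : s, ∃ a, (x : E) ∈ P a) (g : ι → E →ᵃ[ℝ] F)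
    (hg : ∀ a (x : s), (x : E) ∈ P a → f x = g a x) : IsPL s f := by
  refine ⟨Set.range P, Set.finite_range P, ?_, ?_, ?_⟩
  · rintro _ ⟨a, rfl⟩
    exact hP a
  · intro x
    obtain ⟨a, hx⟩ := hcov x
    exact ⟨_, ⟨a, rfl⟩, hx⟩
  · rintro _ ⟨a, rfl⟩
    exact ⟨g a, hg a⟩

/-! ### The boundary of the simplex is a sphere -/

section Sphere

open Metric

variable (n : ℕ)

/-- The simplex with vertices the origin and the standard basis vectors. -/
def cornerSimplex : Set (EuclideanSpace ℝ (Fin n)) :=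
  {z | (∀ i, 0 ≤ z i) ∧ ∑ i, z i ≤ 1}

variable {n}

theorem isClosed_cornerSimplex : IsClosed (cornerSimplex n) := by
  have h1 : IsClosed {z : EuclideanSpace ℝ (Fin n) | ∀ i, 0 ≤ z i} := by
    simp only [Set.ofPred_forall]
    exact isClosed_iInter fun i => isClosed_le continuous_const (by fun_prop)
  have h2 : IsClosed {z : EuclideanSpace ℝ (Fin n) | ∑ i, z i ≤ 1} :=
    isClosed_le (by fun_prop) continuous_const
  exact h1.inter h2

theorem convex_cornerSimplex : Convex ℝ (cornerSimplex n) := by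
  rintro x ⟨hx, hx'⟩ y ⟨hy, hy'⟩ a b ha hb hab
  refine ⟨fun i => ?_, ?_⟩
  · have := hx i
    have := hy i
    simp only [PiLp.add_apply, PiLp.smul_apply, smul_eq_mul]
    positivity
  · simp only [PiLp.add_apply, PiLp.smul_apply, smul_eq_mul, Finset.sum_add_distrib,
      ← Finset.mul_sum]
    nlinarith

theorem isBounded_cornerSimplex : Bornology.IsBounded (cornerSimplex n) := by
  rw [isBounded_iff_forall_norm_le]
  refine ⟨√n, fun z hz => ?_⟩
  rw [EuclideanSpace.norm_eq]
  refine Real.sqrt_le_sqrt ?_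
  have : ∀ i ∈ Finset.univ, ‖z i‖ ^ 2 ≤ 1 := by
    intro i _
    have h1 : z i ≤ ∑ j, z j := Finset.single_le_sum (fun j _ => hz.1 j) (Finset.mem_univ i)
    have h2 := hz.1 i
    have h3 : z i ≤ 1 := h1.trans hz.2
    rw [Real.norm_eq_abs, sq_abs]
    nlinarith
  refine (Finset.sum_le_sum this).trans ?_
  simp

theorem interior_cornerSimplex :
    interior (cornerSimplex (n + 1)) = {z | (∀ i, 0 < z i) ∧ ∑ i, z i < 1} := by
  let p : Fin (n + 1) → (EuclideanSpace ℝ (Fin (n + 1)) →L[ℝ] ℝ) := fun i => EuclideanSpace.proj i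
  let σ : EuclideanSpace ℝ (Fin (n + 1)) →L[ℝ] ℝ := ∑ i, p i
  have hp : ∀ i z, p i z = z i := fun _ _ => rfl
  have hσ : ∀ z, σ z = ∑ i, z i := fun z => by simp [σ, hp]
  have hpo : ∀ i, IsOpenMap (p i) := fun i => by
    refine ContinuousLinearMap.isOpenMap_of_ne_zero _ fun h => ?_
    have := congrArg (fun ℓ => ℓ (EuclideanSpace.single i 1)) h
    simp [hp] at this
  have hσo : IsOpenMap σ := by
    refine ContinuousLinearMap.isOpenMap_of_ne_zero _ fun h => ?_
    have := congrArg (fun ℓ => ℓ (EuclideanSpace.single 0 1)) h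
    simp [hσ] at this
  have e : cornerSimplex (n + 1) = (⋂ i, p i ⁻¹' Set.Ici 0) ∩ σ ⁻¹' Set.Iic 1 := by
    ext z
    simp [cornerSimplex, hp, hσ]
  rw [e, interior_inter, interior_iInter_of_finite,
    ← hσo.preimage_interior_eq_interior_preimage σ.continuous, interior_Iic]
  simp only [← (hpo _).preimage_interior_eq_interior_preimage (p _).continuous, interior_Ici]
  ext z
  simp [hp, hσ]

theorem frontier_cornerSimplex :
    frontier (cornerSimplex (n + 1)) =
      {z | z ∈ cornerSimplex (n + 1) ∧ ((∃ i, z i = 0) ∨ ∑ i, z i = 1)} := by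
  rw [isClosed_cornerSimplex.frontier_eq, interior_cornerSimplex]
  ext z
  simp only [Set.mem_sdiff, Set.mem_ofPred_eq, and_congr_right_iff]
  rintro ⟨h0, h1⟩
  constructor
  · intro h
    by_contra! hcon
    exact h ⟨fun i => lt_of_le_of_ne (h0 i) (hcon.1 i).symm, lt_of_le_of_ne h1 hcon.2⟩
  · rintro (⟨i, hi⟩ | h) ⟨h2, h3⟩
    · exact (h2 i).ne' hi
    · exact h3.ne h

/-- Dropping the first barycentric coordinate. -/
noncomputable def simplexBoundaryHomeo (D : ℕ) :
    simplexBoundary D ≃ₜ frontier (cornerSimplex (D + 1)) where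
  toFun y := ⟨WithLp.toLp 2 fun i => y.1 i.succ, by
    obtain ⟨y, ⟨h0, h1⟩, i, hi⟩ := y
    rw [Fin.sum_univ_succ] at h1
    rw [frontier_cornerSimplex]
    refine ⟨⟨fun i => h0 _, ?_⟩, ?_⟩
    · have := h0 0
      simp only
      linarith
    · refine Fin.cases (fun h => Or.inr ?_) (fun j h => Or.inl ⟨j, h⟩) i hi
      simp only
      linarith⟩
  invFun z := ⟨Fin.cons (1 - ∑ i, z.1 i) z.1, by
    obtain ⟨z, hz⟩ := z
    rw [frontier_cornerSimplex] at hz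
    obtain ⟨⟨h0, h1⟩, h⟩ := hz
    refine ⟨⟨fun i => ?_, ?_⟩, ?_⟩
    · refine Fin.cases ?_ (fun j => ?_) i
      · simpa using h1
      · simpa using h0 j
    · rw [Fin.sum_univ_succ]
      simp
    · rcases h with ⟨i, hi⟩ | h
      · exact ⟨i.succ, by simpa using hi⟩
      · exact ⟨0, by simp [h]⟩⟩
  left_inv y := by
    obtain ⟨y, ⟨h0, h1⟩, h⟩ := y
    rw [Fin.sum_univ_succ] at h1
    ext i
    refine Fin.cases ?_ (fun j => ?_) i
    · simp only [Fin.cons_zero]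
      linarith
    · simp
  right_inv z := by
    ext i
    simp
  continuous_toFun := by
    refine Continuous.subtype_mk ?_ _
    exact (PiLp.continuous_toLp 2 _).comp
      (continuous_pi fun i => (continuous_apply _).comp continuous_subtype_val)
  continuous_invFun := by
    refine Continuous.subtype_mk (continuous_pi fun i => ?_) _
    refine Fin.cases ?_ (fun j => ?_) i
    · simp only [Fin.cons_zero]
      fun_prop
    · simp only [Fin.cons_succ]
      fun_prop

/-- Dropping one barycentric coordinate turns the boundary into the frontier of a bounded convex set
with nonempty interior (the barycenter is an interior point), and such frontiers are spheres. -/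
theorem nonempty_simplexBoundary_homeo_sphere (D : ℕ) :
    Nonempty (simplexBoundary D ≃ₜ sphere (0 : EuclideanSpace ℝ (Fin (D + 1))) 1) := by
  have hne : (interior (cornerSimplex (D + 1))).Nonempty := by
    rw [interior_cornerSimplex]
    refine ⟨WithLp.toLp 2 fun _ => 1 / (D + 2), fun i => ?_, ?_⟩
    · simp only
      positivity
    · simp only [Finset.sum_const, Finset.card_univ, Fintype.card_fin, nsmul_eq_mul]
      push_cast
      rw [mul_one_div, div_lt_one (by positivity)]
      linarith
  obtain ⟨h, -, -, hf⟩ := exists_homeomorph_image_interior_closure_frontier_eq_unitBall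
    convex_cornerSimplex hne isBounded_cornerSimplex
  exact ⟨(simplexBoundaryHomeo D).trans ((h.image _).trans (Homeomorph.setCongr hf))⟩

end Sphere

theorem IsPL.continuous {E F : Type*} [NormedAddCommGroup E] [NormedSpace ℝ E]
    [FiniteDimensional ℝ E] [NormedAddCommGroup F] [NormedSpace ℝ F] {s : Set E} {f : s → F}
    (h : IsPL s f) : Continuous f := by
  obtain ⟨S, hfin, hpoly, hcov, haff⟩ := h
  have := hfin.to_subtype
  refine LocallyFinite.continuous (f := fun P : S => ((↑) : s → E) ⁻¹' P.1)
    (locallyFinite_of_finite _) ?_ ?_ ?_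
  · rw [Set.eq_univ_iff_forall]
    intro x
    obtain ⟨P, hP, hx⟩ := hcov x
    exact Set.mem_iUnion.2 ⟨⟨P, hP⟩, hx⟩
  · exact fun P => (hpoly P.1 P.2).isClosed.preimage continuous_subtype_val
  · rintro ⟨P, hP⟩
    obtain ⟨g, hg⟩ := haff P hP
    exact ((g.continuous_of_finiteDimensional.comp continuous_subtype_val).continuousOn).congr
      fun x hx => hg x hx

/-! ### Polyhedral spheres and common subdivisions -/

namespace ColoredGraph

variable {D : ℕ}

instance (G : ColoredGraph.{u} D) : CompactSpace G.Space :=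
  inferInstanceAs (CompactSpace (Quot G.Glue))

/-- Some bijection onto the boundary of the simplex is piecewise linear on each simplex. -/
def IsPolyhedralSphere (G : ColoredGraph.{u} D) : Prop :=
  ∃ f : G.Space → simplexBoundary D, Function.Bijective f ∧ ∀ v : G.Vertex,
    IsPL (stdSimplex ℝ (Fin (D + 1)))
      (fun x => ((f (G.simplexMap v x) : simplexBoundary D) : Fin (D + 2) → ℝ))

variable {G G' : ColoredGraph.{u} D}

/-- Piecewise linearity on the simplices gives continuity, and a continuous bijection from a compact
space to a Hausdorff space is a homeomorphism. -/
theorem IsPolyhedralSphere.isPLSphere (h : G.IsPolyhedralSphere) : G.IsPLSphere := by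
  obtain ⟨f, hbij, hpl⟩ := h
  have hf : Continuous f := by
    refine continuous_quot_lift (f := fun p => f (Quot.mk G.Glue p))
      (fun a b h => congrArg f (Quot.sound h)) ?_ |>.congr ?_
    · exact continuous_sigma fun v => continuous_induced_rng.2 (hpl v).continuous
    · rintro ⟨p⟩
      rfl
  refine ⟨hf.homeoOfEquivCompactToT2 (f := Equiv.ofBijective f hbij), fun v => ?_⟩
  exact (hpl v).piecewiseAffine

theorem simplexMap_eq {i : Fin (D + 1)} (w : G.W) (x : stdSimplex ℝ (Fin (D + 1)))
    (hx : x.1 i = 0) :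
    G.simplexMap (Sum.inl w) x = G.simplexMap (Sum.inr (G.edge i w)) x :=
  Quot.sound (.line i w x hx)

theorem simplexMap_eq' {i : Fin (D + 1)} {w : G.W} {b : G.B} {x : stdSimplex ℝ (Fin (D + 1))}
    (hb : G.edge i w = b) (hx : x.1 i = 0) :
    G.simplexMap (Sum.inl w) x = G.simplexMap (Sum.inr b) x := by
  rw [← hb]
  exact simplexMap_eq w x hx

/-- A function on the pseudomanifold of `G` is a compatible family of functions on the simplices. -/
def Space.lift {X : Type*} (f : G.Vertex → stdSimplex ℝ (Fin (D + 1)) → X)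
    (h : ∀ i w x, x.1 i = 0 → f (Sum.inl w) x = f (Sum.inr (G.edge i w)) x) : G.Space → X :=
  Quot.lift (fun p => f p.1 p.2) (by rintro _ _ ⟨i, w, x, hx⟩; exact h i w x hx)

theorem Space.ind {p : G.Space → Prop} (h : ∀ v x, p (G.simplexMap v x)) (z : G.Space) : p z := by
  obtain ⟨v, x⟩ := z
  exact h v x

/-- If the pseudomanifolds of `G` and `G'` are subdivided into the same model `Y`, and one is a
polyhedral sphere, so is the other. -/
theorem IsPolyhedralSphere.of_model (hG' : G'.IsPolyhedralSphere) {Y : Type*}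
    (f : G.Vertex → stdSimplex ℝ (Fin (D + 1)) → Y)
    (f' : G'.Vertex → stdSimplex ℝ (Fin (D + 1)) → Y)
    (inj : ∀ v x u y, f v x = f u y → G.simplexMap v x = G.simplexMap u y)
    (inj' : ∀ v x u y, f' v x = f' u y → G'.simplexMap v x = G'.simplexMap u y)
    (surj' : ∀ v' y, ∃ v x, f v x = f' v' y)
    (glue : ∀ i w x, x.1 i = 0 → ∃ v' y u' z, f (Sum.inl w) x = f' v' y ∧
      f (Sum.inr (G.edge i w)) x = f' u' z ∧ G'.simplexMap v' y = G'.simplexMap u' z)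
    (glue' : ∀ i w x, x.1 i = 0 → ∃ v y u z, f v y = f' (Sum.inl w) x ∧
      f u z = f' (Sum.inr (G'.edge i w)) x ∧ G.simplexMap v y = G.simplexMap u z)
    (pieces : ∀ v, ∃ (ι : Type) (_ : Finite ι) (P : ι → Set (Fin (D + 1) → ℝ))
      (v' : ι → G'.Vertex) (g : ι → (Fin (D + 1) → ℝ) →ᵃ[ℝ] (Fin (D + 1) → ℝ)),
      (∀ a, IsPolyhedron (P a)) ∧ (∀ x : stdSimplex ℝ (Fin (D + 1)), ∃ a, x.1 ∈ P a) ∧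
      ∀ a (x : stdSimplex ℝ (Fin (D + 1))), x.1 ∈ P a →
        ∃ hx : g a x.1 ∈ stdSimplex ℝ (Fin (D + 1)), f v x = f' (v' a) ⟨g a x.1, hx⟩) :
    G.IsPolyhedralSphere := by
  have surj : ∀ v x, ∃ p : G'.Vertex × stdSimplex ℝ (Fin (D + 1)), f v x = f' p.1 p.2 := by
    intro v x
    obtain ⟨ι, -, P, v', g, -, hcov, hg⟩ := pieces v
    obtain ⟨a, ha⟩ := hcov x
    obtain ⟨hx, e⟩ := hg a x ha
    exact ⟨(v' a, ⟨g a x.1, hx⟩), e⟩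
  have surj' : ∀ v' y, ∃ p : G.Vertex × stdSimplex ℝ (Fin (D + 1)), f p.1 p.2 = f' v' y := by
    intro v' y
    obtain ⟨v, x, e⟩ := surj' v' y
    exact ⟨(v, x), e⟩
  choose s hs using surj
  choose s' hs' using surj'
  -- `Y` need not carry all the gluings. By `inj` and `inj'`, points with the same image in `Y` are
  -- glued already, and `glue`, `glue'` account for the gluings that `Y` does not see. So matching
  -- points with equal images descends to mutually inverse maps `h` and `k`.
  let h : G.Space → G'.Space := Space.lift (fun v x => G'.simplexMap (s v x).1 (s v x).2) (by
    intro i w x hx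
    obtain ⟨v', y, u', z, e1, e2, e3⟩ := glue i w x hx
    exact (inj' _ _ _ _ ((hs _ _).symm.trans e1)).trans
      (e3.trans (inj' _ _ _ _ (e2.symm.trans (hs _ _)))))
  let k : G'.Space → G.Space := Space.lift (fun v x => G.simplexMap (s' v x).1 (s' v x).2) (by
    intro i w x hx
    obtain ⟨v', y, u', z, e1, e2, e3⟩ := glue' i w x hx
    exact (inj _ _ _ _ ((hs' _ _).trans e1.symm)).trans
      (e3.trans (inj _ _ _ _ (e2.trans (hs' _ _).symm))))
  have hh : ∀ v x v' y, f v x = f' v' y → h (G.simplexMap v x) = G'.simplexMap v' y :=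
    fun v x v' y e => inj' _ _ _ _ ((hs v x).symm.trans e)
  have hk : ∀ v x v' y, f v x = f' v' y → k (G'.simplexMap v' y) = G.simplexMap v x :=
    fun v x v' y e => inj _ _ _ _ ((hs' v' y).trans e.symm)
  have hbij : Function.Bijective h := by
    refine Function.bijective_iff_has_inverse.2 ⟨k, ?_, ?_⟩
    · refine Space.ind fun v x => ?_
      rw [hh v x _ _ (hs v x), hk v x _ _ (hs v x)]
    · refine Space.ind fun v' y => ?_
      rw [hk _ _ v' y (hs' v' y), hh _ _ v' y (hs' v' y)]
  obtain ⟨F, hF, hpl⟩ := hG'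
  refine ⟨F ∘ h, hF.comp hbij, fun v => ?_⟩
  obtain ⟨ι, hι, P, v', g, hpoly, hcov, hg⟩ := pieces v
  refine IsPL.of_pieces hpoly hcov (fun a => hpl (v' a)) g fun a x hx => ?_
  obtain ⟨hx', e⟩ := hg a x hx
  refine ⟨hx', ?_⟩
  rw [Function.comp_apply, hh v x _ _ e]

/-- The cover by a single piece. -/
theorem exists_pieces_of_affine {Y : Type*} {f₀ : stdSimplex ℝ (Fin (D + 1)) → Y}
    {f' : G'.Vertex → stdSimplex ℝ (Fin (D + 1)) → Y} (v' : G'.Vertex)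
    (g : (Fin (D + 1) → ℝ) →ᵃ[ℝ] (Fin (D + 1) → ℝ))
    (hg : ∀ x : stdSimplex ℝ (Fin (D + 1)), ∃ hx : g x.1 ∈ stdSimplex ℝ (Fin (D + 1)),
      f₀ x = f' v' ⟨g x.1, hx⟩) :
    ∃ (ι : Type) (_ : Finite ι) (P : ι → Set (Fin (D + 1) → ℝ))
      (v' : ι → G'.Vertex) (g : ι → (Fin (D + 1) → ℝ) →ᵃ[ℝ] (Fin (D + 1) → ℝ)),
      (∀ a, IsPolyhedron (P a)) ∧ (∀ x : stdSimplex ℝ (Fin (D + 1)), ∃ a, x.1 ∈ P a) ∧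
      ∀ a (x : stdSimplex ℝ (Fin (D + 1))), x.1 ∈ P a →
        ∃ hx : g a x.1 ∈ stdSimplex ℝ (Fin (D + 1)), f₀ x = f' (v' a) ⟨g a x.1, hx⟩ :=
  ⟨Unit, inferInstance, fun _ => Set.univ, fun _ => v', fun _ => g, fun _ => .univ,
    fun _ => ⟨(), trivial⟩, fun _ x _ => hg x⟩

theorem IsPolyhedralSphere.of_iso (hG' : G'.IsPolyhedralSphere) (e : Iso G G') :
    G.IsPolyhedralSphere := by
  refine hG'.of_model (Y := G'.Vertex × stdSimplex ℝ (Fin (D + 1)))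
    (fun v x => (Sum.map e.onW e.onB v, x)) (fun v x => (v, x)) ?_ ?_ ?_ ?_ ?_ ?_
  · intro v x u y h
    obtain ⟨h1, rfl⟩ := Prod.ext_iff.1 h
    have : v = u := (Sum.map_injective.2 ⟨e.onW.injective, e.onB.injective⟩) h1
    rw [this]
  · intro v x u y h
    obtain ⟨rfl, rfl⟩ := Prod.ext_iff.1 h
    rfl
  · intro v' y
    refine ⟨Sum.map e.onW.symm e.onB.symm v', y, ?_⟩
    rcases v' with v' | v' <;> simp
  · intro i w x hx
    refine ⟨_, x, _, x, rfl, rfl, ?_⟩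
    exact simplexMap_eq' (e.map_edge i w).symm hx
  · intro i w x hx
    refine ⟨Sum.inl (e.onW.symm w), x, Sum.inr (G.edge i (e.onW.symm w)), x, by simp, ?_,
      simplexMap_eq _ x hx⟩
    simp [e.map_edge]
  · intro v
    exact exists_pieces_of_affine _ (AffineMap.id ℝ _) fun x => ⟨x.2, rfl⟩

end ColoredGraph

/-! ### The dipole -/

section MinCoord

variable {n : ℕ} {s : Finset (Fin n)} (hs : s.Nonempty)

/-- The least coordinate among those in `s`. -/
noncomputable def minCoord (hs : s.Nonempty) (x : Fin n → ℝ) : ℝ := s.inf' hs x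

theorem minCoord_le (x : Fin n → ℝ) {j : Fin n} (hj : j ∈ s) : minCoord hs x ≤ x j :=
  Finset.inf'_le x hj

theorem exists_minCoord_eq (x : Fin n → ℝ) : ∃ k ∈ s, x k = minCoord hs x ∧ ∀ j ∈ s, x k ≤ x j := by
  obtain ⟨k, hk, e⟩ := Finset.exists_mem_eq_inf' hs x
  exact ⟨k, hk, e.symm, fun j hj => e ▸ Finset.inf'_le x hj⟩

theorem minCoord_eq {x : Fin n → ℝ} {k : Fin n} (hk : k ∈ s) (h : ∀ j ∈ s, x k ≤ x j) :
    minCoord hs x = x k :=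
  le_antisymm (minCoord_le hs x hk) (Finset.le_inf' hs x h)

theorem minCoord_nonneg {x : Fin n → ℝ} (h : ∀ j, 0 ≤ x j) : 0 ≤ minCoord hs x :=
  Finset.le_inf' hs x fun j _ => h j

theorem minCoord_add {x y : Fin n → ℝ} {c : ℝ} (h : ∀ j ∈ s, y j = x j + c) :
    minCoord hs y = minCoord hs x + c := by
  obtain ⟨k, hk, e, hle⟩ := exists_minCoord_eq hs x
  rw [← e, ← h k hk]
  refine minCoord_eq hs hk fun j hj => ?_
  rw [h k hk, h j hj]
  linarith [hle j hj]

theorem isPolyhedron_le (k : Fin n) (s : Finset (Fin n)) :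
    IsPolyhedron {x : Fin n → ℝ | ∀ j ∈ s, x k ≤ x j} := by
  have h := IsPolyhedron.of_forall fun j : s =>
    ((LinearMap.proj j.1 : (Fin n → ℝ) →ₗ[ℝ] ℝ) - LinearMap.proj k).toAffineMap
  refine (congrArg IsPolyhedron (Set.ext fun x => ?_)).mp h
  simp

end MinCoord

namespace ColoredGraph

variable {D : ℕ}

/-- Two simplices are glued along their whole boundary. The white one becomes the facet of vanishing
coordinate 0. The black one becomes the union of the other facets: its least coordinate t is
subtracted from all coordinates, and the total (D+1)t is put into coordinate 0. The two maps agree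
where t = 0, that is, on the boundary. -/
theorem isPolyhedralSphere_dipole (D : ℕ) : (dipole.{u} D).IsPolyhedralSphere := by
  have hs : (Finset.univ : Finset (Fin (D + 1))).Nonempty := ⟨0, Finset.mem_univ _⟩
  have hne : ((D : ℝ) + 1) ≠ 0 := by positivity
  set t : (Fin (D + 1) → ℝ) → ℝ := minCoord hs with ht
  let p : (Fin (D + 1) → ℝ) → ℝ → (Fin (D + 2) → ℝ) := fun x c =>
    Fin.cons ((D + 1) * c) fun j => x j - c
  have hp0 : ∀ x c, p x c 0 = (D + 1) * c := fun _ _ => rfl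
  have hps : ∀ x c j, p x c (Fin.succ j) = x j - c := fun _ _ _ => rfl
  have hmem : ∀ x ∈ stdSimplex ℝ (Fin (D + 1)), ∀ c, 0 ≤ c → (∀ j, c ≤ x j) →
      p x c ∈ stdSimplex ℝ (Fin (D + 2)) := by
    rintro x ⟨h0, h1⟩ c hc hj
    refine ⟨fun i => ?_, ?_⟩
    · refine Fin.cases ?_ (fun j => ?_) i
      · rw [hp0]; positivity
      · rw [hps]; linarith [hj j]
    · rw [Fin.sum_univ_succ, hp0]
      simp only [hps, Finset.sum_sub_distrib, h1]
      simp
  have htle : ∀ x j, t x ≤ x j := fun x j => minCoord_le hs x (Finset.mem_univ j)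
  let f : (dipole.{u} D).Vertex → stdSimplex ℝ (Fin (D + 1)) → simplexBoundary D
    | Sum.inl _, x => ⟨p x.1 0, hmem x.1 x.2 0 le_rfl x.2.1, 0, by simp [hp0]⟩
    | Sum.inr _, x => ⟨p x.1 (t x.1), hmem x.1 x.2 _ (minCoord_nonneg hs x.2.1) (htle _), by
        obtain ⟨k, -, e, -⟩ := exists_minCoord_eq hs x.1
        exact ⟨k.succ, by rw [hps, e]; simp [ht]⟩⟩
  have hglue : ∀ x : stdSimplex ℝ (Fin (D + 1)), t x.1 = 0 →
      (dipole.{u} D).simplexMap (Sum.inl ⟨⟩) x = (dipole.{u} D).simplexMap (Sum.inr ⟨⟩) x := by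
    intro x hx
    obtain ⟨k, -, e, -⟩ := exists_minCoord_eq hs x.1
    exact simplexMap_eq' (i := k) rfl (e.trans hx)
  have hpinj : ∀ x y c d, p x c = p y d → c = d ∧ x = y := by
    intro x y c d h
    have h0 := congrFun h 0
    rw [hp0, hp0] at h0
    have hcd := mul_left_cancel₀ hne h0
    refine ⟨hcd, funext fun j => ?_⟩
    have := congrFun h j.succ
    rw [hps, hps] at this
    linarith
  refine ⟨Space.lift f ?_, ⟨?_, ?_⟩, ?_⟩
  · intro i w x hx
    have : t x.1 = 0 := le_antisymm (hx ▸ htle _ i) (minCoord_nonneg hs x.2.1)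
    exact Subtype.ext (by simp only [f, this])
  · refine Space.ind fun v x => Space.ind fun u y => ?_
    intro h
    have h : (f v x).1 = (f u y).1 := congrArg Subtype.val h
    rcases v with ⟨⟩ | ⟨⟩ <;> rcases u with ⟨⟩ | ⟨⟩
    · obtain ⟨-, e⟩ := hpinj _ _ _ _ h
      rw [Subtype.ext e]
      rfl
    · obtain ⟨e0, e⟩ := hpinj _ _ _ _ h
      obtain rfl := Subtype.ext e
      exact hglue x e0.symm
    · obtain ⟨e0, e⟩ := hpinj _ _ _ _ h
      obtain rfl := Subtype.ext e
      exact (hglue x e0).symm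
    · obtain ⟨-, e⟩ := hpinj _ _ _ _ h
      rw [Subtype.ext e]
      rfl
  · rintro ⟨y, ⟨h0, h1⟩, hi⟩
    rw [Fin.sum_univ_succ] at h1
    by_cases hy : y 0 = 0
    · refine ⟨(dipole.{u} D).simplexMap (Sum.inl ⟨⟩) ⟨fun j => y j.succ, fun j => h0 _, ?_⟩, ?_⟩
      · linarith
      · refine Subtype.ext (funext fun i => ?_)
        change p _ 0 i = y i
        refine Fin.cases ?_ (fun j => ?_) i
        · rw [hp0, hy, mul_zero]
        · rw [hps, sub_zero]
    -- Off the facet 0 some other coordinate vanishes, so spreading coordinate 0 evenly over the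
    -- others makes y 0 / (D + 1) the least of them.
    · have hc : 0 ≤ y 0 / (D + 1) := div_nonneg (h0 0) (by positivity)
      let x : Fin (D + 1) → ℝ := fun j => y j.succ + y 0 / (D + 1)
      have hx : x ∈ stdSimplex ℝ (Fin (D + 1)) := by
        refine ⟨fun j => add_nonneg (h0 _) hc, ?_⟩
        simp only [x, Finset.sum_add_distrib, Finset.sum_const, Finset.card_univ, Fintype.card_fin,
          nsmul_eq_mul]
        push_cast
        rw [mul_div_cancel₀ _ hne]
        linarith
      have htx : t x = y 0 / (D + 1) := by
        obtain ⟨i, hi⟩ := hi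
        obtain ⟨k, rfl⟩ : ∃ k : Fin (D + 1), i = k.succ :=
          Fin.exists_succ_eq_of_ne_zero (by rintro rfl; exact hy hi) |>.imp fun _ h => h.symm
        rw [ht, minCoord_eq hs (Finset.mem_univ k)]
        · simp [x, hi]
        · intro j _
          simp only [x, hi]
          linarith [h0 j.succ]
      refine ⟨(dipole.{u} D).simplexMap (Sum.inr ⟨⟩) ⟨x, hx⟩, Subtype.ext (funext fun i => ?_)⟩
      change p x (t x) i = y i
      rw [htx]
      refine Fin.cases ?_ (fun j => ?_) i
      · rw [hp0, mul_div_cancel₀ _ hne]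
      · rw [hps]
        simp [x]
  · let P : ((Fin (D + 1) → ℝ) →ₗ[ℝ] ℝ) → (Fin (D + 1) → ℝ) →ₗ[ℝ] (Fin (D + 2) → ℝ) := fun c =>
      LinearMap.pi (Fin.cons (((D : ℝ) + 1) • c) fun j => LinearMap.proj j - c)
    have hP : ∀ c x, P c x = p x (c x) := by
      intro c x
      ext i
      refine Fin.cases ?_ (fun j => ?_) i
      · simp [P, p]
      · simp [P, p]
    rintro (v | v)
    · refine IsPL.of_cover (ι := Unit) (P := fun _ => Set.univ) (fun _ => .univ)
        (fun _ => ⟨(), trivial⟩) (fun _ => (P 0).toAffineMap) fun _ x _ => ?_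
      rw [LinearMap.coe_toAffineMap, hP]
      rfl
    · refine IsPL.of_cover (ι := Fin (D + 1)) (P := fun k => {x | ∀ j ∈ Finset.univ, x k ≤ x j})
        (fun k => isPolyhedron_le k _) (fun x => ?_)
        (fun k => (P (LinearMap.proj k)).toAffineMap) fun k x hx => ?_
      · obtain ⟨k, -, -, h⟩ := exists_minCoord_eq hs x.1
        exact ⟨k, h⟩
      · rw [LinearMap.coe_toAffineMap, hP, LinearMap.proj_apply, ← minCoord_eq hs _ hx]
        · rfl
        · exact Finset.mem_univ k

end ColoredGraph

namespace ColoredGraph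

variable {D : ℕ}

/-! ### Insertion of a pair of vertices joined by `D` lines -/

section Shift

variable (i : Fin (D + 1))

/-- Translate the coordinates other than `i` by `p`, and replace the coordinate `i` by `D * r`. -/
def shift (p r : ℝ) (x : Fin (D + 1) → ℝ) : Fin (D + 1) → ℝ :=
  fun j => if j = i then D * r else x j + p

theorem shift_self (p r : ℝ) (x : Fin (D + 1) → ℝ) : shift i p r x i = D * r := by simp [shift]

theorem shift_of_ne {j : Fin (D + 1)} (h : j ≠ i) (p r : ℝ) (x : Fin (D + 1) → ℝ) :
    shift i p r x j = x j + p := by simp [shift, h]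

theorem sum_shift (p r : ℝ) (x : Fin (D + 1) → ℝ) :
    ∑ j, shift i p r x j = ∑ j, x j + D * p + D * r - x i := by
  rw [← Finset.add_sum_erase _ _ (Finset.mem_univ i),
    ← Finset.add_sum_erase _ x (Finset.mem_univ i), shift_self,
    Finset.sum_congr rfl fun j hj => shift_of_ne i (Finset.ne_of_mem_erase hj) p r x,
    Finset.sum_add_distrib]
  simp
  ring

theorem minCoord_shift (hs : (Finset.univ.erase i).Nonempty) (p r : ℝ) (x : Fin (D + 1) → ℝ) :
    minCoord hs (shift i p r x) = minCoord hs x + p :=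
  minCoord_add hs fun _ hj => shift_of_ne i (Finset.ne_of_mem_erase hj) p r x

/-- By `sum_shift` the sum of the coordinates changes by D p + D r - x i, which `h` makes zero. -/
theorem shift_mem (hs : (Finset.univ.erase i).Nonempty) {p r : ℝ} {x : Fin (D + 1) → ℝ}
    (hx : x ∈ stdSimplex ℝ (Fin (D + 1))) (hr : 0 ≤ r) (hp : 0 ≤ minCoord hs x + p)
    (h : D * (p + r) = x i) : shift i p r x ∈ stdSimplex ℝ (Fin (D + 1)) := by
  refine ⟨fun j => ?_, ?_⟩
  · by_cases hj : j = i
    · rw [hj, shift_self]; positivity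
    · rw [shift_of_ne i hj]
      linarith [minCoord_le hs x (Finset.mem_erase.2 ⟨hj, Finset.mem_univ j⟩)]
  · rw [sum_shift, hx.2]
    linarith

/-- `shift` with parameters depending linearly on the point. -/
def shiftLinear (p r : (Fin (D + 1) → ℝ) →ₗ[ℝ] ℝ) : (Fin (D + 1) → ℝ) →ₗ[ℝ] (Fin (D + 1) → ℝ) :=
  LinearMap.pi fun j => if j = i then (D : ℝ) • r else LinearMap.proj j + p

theorem shiftLinear_apply (p r : (Fin (D + 1) → ℝ) →ₗ[ℝ] ℝ) (x : Fin (D + 1) → ℝ) :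
    shiftLinear i p r x = shift i (p x) (r x) x := by
  ext j
  by_cases h : j = i <;> simp [shiftLinear, shift, h]

end Shift

/-- The insertion of a pair of vertices joined by `D` lines preserves polyhedral spheres: the simplex
at the chosen line is subdivided into images of itself and of the two new simplices. -/
theorem IsPolyhedralSphere.insertPair {H : ColoredGraph.{u} D} (hH : H.IsPolyhedralSphere)
    (hD : 1 ≤ D) (i : Fin (D + 1)) (w : H.W) : (H.insertPair i w).IsPolyhedralSphere := by
  classical
  have hD0 : (D : ℝ) ≠ 0 := by positivity
  have hDpos : (0 : ℝ) < D := by positivity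
  have hs : (Finset.univ.erase i).Nonempty := by
    have : Nontrivial (Fin (D + 1)) := Fin.nontrivial_iff_two_le.2 (by omega)
    obtain ⟨j, hj⟩ := exists_ne i
    exact ⟨j, by simp [hj]⟩
  -- With t the least coordinate other than i and ξ = x i / D, the shifts used below preserve t + ξ
  -- and the differences x j - t for j ≠ i. On each segment of constant t + ξ, parametrized by t,
  -- the maps `A`, `B`, `C` below are affine onto the first, middle and last third, with `B`
  -- reversed. Hence `A` is the identity where t = 0, `A` and `B` agree where ξ = 0, `B` and `C`
  -- agree where t = 0, and `C` is the identity where ξ = 0: exactly the gluings around the inserted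
  -- pair.
  set t : (Fin (D + 1) → ℝ) → ℝ := minCoord hs with ht
  let ξ : (Fin (D + 1) → ℝ) → ℝ := fun x => x i / D
  have hξ : ∀ x, x i = D * ξ x := fun x => by simp only [ξ]; field_simp
  have tshift : ∀ p r x, t (shift i p r x) = t x + p := minCoord_shift i hs
  have ξshift : ∀ p r x, ξ (shift i p r x) = r := fun p r x => by
    simp only [ξ, shift_self]; field_simp
  have t0 : ∀ x ∈ stdSimplex ℝ (Fin (D + 1)), 0 ≤ t x := fun x hx => minCoord_nonneg hs hx.1
  have ξ0 : ∀ x ∈ stdSimplex ℝ (Fin (D + 1)), 0 ≤ ξ x := fun x hx =>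
    div_nonneg (hx.1 i) hDpos.le
  have tle : ∀ x j, j ≠ i → t x ≤ x j := fun x j hj => minCoord_le hs x (by simp [hj])
  have tex : ∀ x, ∃ j, j ≠ i ∧ x j = t x := fun x => by
    obtain ⟨k, hk, e, -⟩ := exists_minCoord_eq hs x
    exact ⟨k, Finset.ne_of_mem_erase hk, e⟩
  have tzero : ∀ x ∈ stdSimplex ℝ (Fin (D + 1)), ∀ j, j ≠ i → x j = 0 → t x = 0 :=
    fun x hx j hj h => le_antisymm (h ▸ tle x j hj) (t0 x hx)
  have ξzero : ∀ x, x i = 0 → ξ x = 0 := fun x h => by simp [ξ, h]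
  -- the three maps
  let A : (Fin (D + 1) → ℝ) → (Fin (D + 1) → ℝ) := fun x =>
    shift i (-2 / 3 * t x) (ξ x + 2 / 3 * t x) x
  let B : (Fin (D + 1) → ℝ) → (Fin (D + 1) → ℝ) := fun x =>
    shift i (-2 / 3 * t x + 2 / 3 * ξ x) (2 / 3 * t x + 1 / 3 * ξ x) x
  let C : (Fin (D + 1) → ℝ) → (Fin (D + 1) → ℝ) := fun x =>
    shift i (2 / 3 * ξ x) (1 / 3 * ξ x) x
  have hmem : ∀ x ∈ stdSimplex ℝ (Fin (D + 1)), ∀ p r, 0 ≤ r → 0 ≤ t x + p → p + r = ξ x →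
      shift i p r x ∈ stdSimplex ℝ (Fin (D + 1)) := fun x hx p r hr hp h =>
    shift_mem i hs hx hr hp (by rw [h, hξ x])
  have hA : ∀ x ∈ stdSimplex ℝ (Fin (D + 1)), A x ∈ stdSimplex ℝ (Fin (D + 1)) := fun x hx =>
    hmem x hx _ _ (by linarith [t0 x hx, ξ0 x hx]) (by linarith [t0 x hx]) (by ring)
  have hB : ∀ x ∈ stdSimplex ℝ (Fin (D + 1)), B x ∈ stdSimplex ℝ (Fin (D + 1)) := fun x hx =>
    hmem x hx _ _ (by linarith [t0 x hx, ξ0 x hx]) (by linarith [t0 x hx, ξ0 x hx]) (by ring)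
  have hC : ∀ x ∈ stdSimplex ℝ (Fin (D + 1)), C x ∈ stdSimplex ℝ (Fin (D + 1)) := fun x hx =>
    hmem x hx _ _ (by linarith [ξ0 x hx]) (by linarith [t0 x hx, ξ0 x hx]) (by ring)
  have hsh : ∀ x y p r p' r', shift i p r x = shift i p' r' y →
      r = r' ∧ t x + p = t y + p' ∧ ∀ j, j ≠ i → x j + p = y j + p' := by
    intro x y p r p' r' e
    refine ⟨?_, ?_, fun j hj => ?_⟩
    · rw [← ξshift p r x, e, ξshift]
    · rw [← tshift p r x, e, tshift]
    · rw [← shift_of_ne i hj p r x, e, shift_of_ne i hj]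
  have hext : ∀ x y p, ξ x = ξ y → (∀ j, j ≠ i → x j + p = y j + p) → x = y := by
    intro x y p hi h
    funext j
    by_cases hj : j = i
    · rw [hj, hξ x, hξ y, hi]
    · linarith [h j hj]
  have hAA : ∀ x y, A x = A y → x = y := by
    intro x y e
    obtain ⟨e1, e2, e3⟩ := hsh _ _ _ _ _ _ e
    have h1 : t x = t y := by linarith
    have h2 : ξ x = ξ y := by linarith
    refine hext x y (-2 / 3 * t x) h2 fun j hj => ?_
    linarith [e3 j hj]
  have hBB : ∀ x y, B x = B y → x = y := by
    intro x y e
    obtain ⟨e1, e2, e3⟩ := hsh _ _ _ _ _ _ e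
    have h1 : t x = t y := by linarith
    have h2 : ξ x = ξ y := by linarith
    refine hext x y 0 h2 fun j hj => ?_
    linarith [e3 j hj]
  have hCC : ∀ x y, C x = C y → x = y := by
    intro x y e
    obtain ⟨e1, e2, e3⟩ := hsh _ _ _ _ _ _ e
    have h2 : ξ x = ξ y := by linarith
    refine hext x y 0 h2 fun j hj => ?_
    linarith [e3 j hj]
  have hAB : ∀ x ∈ stdSimplex ℝ (Fin (D + 1)), ∀ y ∈ stdSimplex ℝ (Fin (D + 1)), A x = B y →
      x = y ∧ x i = 0 := by
    intro x hx y hy e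
    obtain ⟨e1, e2, e3⟩ := hsh _ _ _ _ _ _ e
    have hx1 := ξ0 x hx
    have hy1 := ξ0 y hy
    have h1 : ξ x = 0 := by linarith
    have h2 : ξ y = 0 := by linarith
    refine ⟨hext x y 0 (h1.trans h2.symm) fun j hj => ?_, by rw [hξ x, h1, mul_zero]⟩
    linarith [e3 j hj]
  have hBC : ∀ x ∈ stdSimplex ℝ (Fin (D + 1)), ∀ y ∈ stdSimplex ℝ (Fin (D + 1)), B x = C y →
      x = y ∧ t x = 0 := by
    intro x hx y hy e
    obtain ⟨e1, e2, e3⟩ := hsh _ _ _ _ _ _ e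
    have hx1 := t0 x hx
    have hy1 := t0 y hy
    have h1 : t x = 0 := by linarith
    refine ⟨hext x y 0 (by linarith) fun j hj => ?_, h1⟩
    linarith [e3 j hj]
  have hAC : ∀ x ∈ stdSimplex ℝ (Fin (D + 1)), ∀ y ∈ stdSimplex ℝ (Fin (D + 1)), A x = C y →
      x = y ∧ x i = 0 ∧ t x = 0 := by
    intro x hx y hy e
    obtain ⟨e1, e2, e3⟩ := hsh _ _ _ _ _ _ e
    have hx1 := t0 x hx
    have hy1 := t0 y hy
    have hx2 := ξ0 x hx
    have hy2 := ξ0 y hy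
    have h1 : t x = 0 := by linarith
    have h2 : ξ x = 0 := by linarith
    refine ⟨hext x y 0 (by linarith) fun j hj => ?_, by rw [hξ x, h2, mul_zero], h1⟩
    linarith [e3 j hj]
  have hid : ∀ x p r, p = 0 → r = ξ x → shift i p r x = x := by
    rintro x p r rfl rfl
    refine hext _ _ 0 (ξshift _ _ _) fun j hj => ?_
    rw [shift_of_ne i hj, add_zero]
  have hA0 : ∀ x, t x = 0 → A x = x := fun x h => hid x _ _ (by rw [h]; ring) (by rw [h]; ring)
  have hC0 : ∀ x, x i = 0 → C x = x := fun x h =>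
    hid x _ _ (by rw [ξzero x h]; ring) (by rw [ξzero x h]; ring)
  have hABe : ∀ x, x i = 0 → A x = B x := fun x h => by simp only [A, B, ξzero x h]; ring_nf
  have hBCe : ∀ x, t x = 0 → B x = C x := fun x h => by simp only [B, C, h]; ring_nf
  let f : (H.insertPair i w).Vertex → stdSimplex ℝ (Fin (D + 1)) →
      H.Vertex × (Fin (D + 1) → ℝ)
    | Sum.inl none, x => (Sum.inl w, C x.1)
    | Sum.inl (some a), x => if a = w then (Sum.inl w, A x.1) else (Sum.inl a, x.1)
    | Sum.inr none, x => (Sum.inl w, B x.1)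
    | Sum.inr (some b), x => (Sum.inr b, x.1)
  have fw : ∀ x, f (Sum.inl (some w)) x = (Sum.inl w, A x.1) := fun x => if_pos rfl
  have fa : ∀ a, a ≠ w → ∀ x, f (Sum.inl (some a)) x = (Sum.inl a, x.1) := fun a h x => if_neg h
  have edge_none : ∀ j, j ≠ i → (H.insertPair i w).edge j none = none := fun j hj => by
    rw [insertPair_edge_of_ne _ _ hj]; rfl
  have edge_some : ∀ j, j ≠ i → ∀ a, (H.insertPair i w).edge j (some a) = some (H.edge j a) :=
    fun j hj a => by rw [insertPair_edge_of_ne _ _ hj]; rfl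
  have glueA : ∀ x : stdSimplex ℝ (Fin (D + 1)), x.1 i = 0 →
      (H.insertPair i w).simplexMap (Sum.inl (some w)) x =
        (H.insertPair i w).simplexMap (Sum.inr none) x :=
    fun x hx => simplexMap_eq' (insertPair_edge_some_self H i w) hx
  have glueB : ∀ x : stdSimplex ℝ (Fin (D + 1)), t x.1 = 0 →
      (H.insertPair i w).simplexMap (Sum.inl none) x =
        (H.insertPair i w).simplexMap (Sum.inr none) x := by
    intro x hx
    obtain ⟨j, hj, e⟩ := tex x.1
    exact simplexMap_eq' (edge_none j hj) (e.trans hx)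
  have injAux : ∀ v x u y, f v x = f u y → v = u ∧ x = y ∨
      (H.insertPair i w).simplexMap v x = (H.insertPair i w).simplexMap u y := by
    rintro ((_ | a) | (_ | b)) x ((_ | a') | (_ | b')) y e
    · exact Or.inl ⟨rfl, Subtype.ext (hCC _ _ (Prod.ext_iff.1 e).2)⟩
    · by_cases ha : a' = w
      · subst ha
        rw [fw] at e
        obtain ⟨e1, e2, e3⟩ := hAC _ y.2 _ x.2 (Prod.ext_iff.1 e).2.symm
        obtain rfl := Subtype.ext e1
        exact Or.inr ((glueB y e3).trans (glueA y e2).symm)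
      · rw [fa a' ha] at e
        exact (ha (Sum.inl_injective (Prod.ext_iff.1 e).1).symm).elim
    · obtain ⟨e1, e2⟩ := hBC _ y.2 _ x.2 (Prod.ext_iff.1 e).2.symm
      obtain rfl := Subtype.ext e1
      exact Or.inr (glueB y e2)
    · exact absurd (Prod.ext_iff.1 e).1 (by simp [f])
    · by_cases ha : a = w
      · subst ha
        rw [fw] at e
        obtain ⟨e1, e2, e3⟩ := hAC _ x.2 _ y.2 (Prod.ext_iff.1 e).2
        obtain rfl := Subtype.ext e1
        exact Or.inr ((glueA x e2).trans (glueB x e3).symm)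
      · rw [fa a ha] at e
        exact (ha (Sum.inl_injective (Prod.ext_iff.1 e).1)).elim
    · by_cases ha : a = w <;> by_cases ha' : a' = w
      · subst ha
        subst ha'
        rw [fw, fw] at e
        exact Or.inl ⟨rfl, Subtype.ext (hAA _ _ (Prod.ext_iff.1 e).2)⟩
      · subst ha
        rw [fw, fa a' ha'] at e
        exact (ha' (Sum.inl_injective (Prod.ext_iff.1 e).1).symm).elim
      · subst ha'
        rw [fw, fa a ha] at e
        exact (ha (Sum.inl_injective (Prod.ext_iff.1 e).1)).elim
      · rw [fa a ha, fa a' ha'] at e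
        obtain ⟨e1, e2⟩ := Prod.ext_iff.1 e
        exact Or.inl ⟨by rw [Sum.inl_injective e1], Subtype.ext e2⟩
    · by_cases ha : a = w
      · subst ha
        rw [fw] at e
        obtain ⟨e1, e2⟩ := hAB _ x.2 _ y.2 (Prod.ext_iff.1 e).2
        obtain rfl := Subtype.ext e1
        exact Or.inr (glueA x e2)
      · rw [fa a ha] at e
        exact (ha (Sum.inl_injective (Prod.ext_iff.1 e).1)).elim
    · by_cases ha : a = w
      · subst ha
        rw [fw] at e
        exact absurd (Prod.ext_iff.1 e).1 (by simp [f])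
      · rw [fa a ha] at e
        exact absurd (Prod.ext_iff.1 e).1 (by simp [f])
    · obtain ⟨e1, e2⟩ := hBC _ x.2 _ y.2 (Prod.ext_iff.1 e).2
      obtain rfl := Subtype.ext e1
      exact Or.inr (glueB x e2).symm
    · by_cases ha : a' = w
      · subst ha
        rw [fw] at e
        obtain ⟨e1, e2⟩ := hAB _ y.2 _ x.2 (Prod.ext_iff.1 e).2.symm
        obtain rfl := Subtype.ext e1
        exact Or.inr (glueA y e2).symm
      · rw [fa a' ha] at e
        exact (ha (Sum.inl_injective (Prod.ext_iff.1 e).1).symm).elim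
    · exact Or.inl ⟨rfl, Subtype.ext (hBB _ _ (Prod.ext_iff.1 e).2)⟩
    · exact absurd (Prod.ext_iff.1 e).1 (by simp [f])
    · exact absurd (Prod.ext_iff.1 e).1 (by simp [f])
    · by_cases ha : a' = w
      · subst ha
        rw [fw] at e
        exact absurd (Prod.ext_iff.1 e).1 (by simp [f])
      · rw [fa a' ha] at e
        exact absurd (Prod.ext_iff.1 e).1 (by simp [f])
    · exact absurd (Prod.ext_iff.1 e).1 (by simp [f])
    · obtain ⟨e1, e2⟩ := Prod.ext_iff.1 e
      exact Or.inl ⟨by rw [Sum.inr_injective e1], Subtype.ext e2⟩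
  refine hH.of_model f (fun v x => (v, x.1)) ?_ ?_ ?_ ?_ ?_ ?_
  · intro v x u y e
    rcases injAux v x u y e with ⟨rfl, rfl⟩ | h
    · rfl
    · exact h
  · intro v x u y e
    obtain ⟨rfl, e2⟩ := Prod.ext_iff.1 e
    rw [Subtype.ext e2]
  · rintro (a | b) y
    swap
    · exact ⟨Sum.inr (some b), y, rfl⟩
    by_cases ha : a = w
    swap
    · exact ⟨Sum.inl (some a), y, fa a ha y⟩
    subst ha
    have hinv : ∀ p r p' r', p + p' = 0 → r' = ξ y.1 → shift i p' r' (shift i p r y.1) = y.1 := by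
      intro p r p' r' h1 h2
      refine hext _ _ 0 ((ξshift _ _ _).trans h2) fun j hj => ?_
      rw [shift_of_ne i hj, shift_of_ne i hj]
      linarith
    have ht0 := t0 _ y.2
    have hξ0 := ξ0 _ y.2
    -- The cases are the first, last and middle third of the segment, and the witnesses invert `A`,
    -- `C` and `B`.
    by_cases h1 : 2 * t y.1 ≤ ξ y.1
    · refine ⟨Sum.inl (some a), ⟨shift i (2 * t y.1) (ξ y.1 - 2 * t y.1) y.1,
        hmem _ y.2 _ _ (by linarith) (by linarith) (by ring)⟩, ?_⟩
      rw [fw]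
      refine Prod.ext rfl (hinv _ _ _ _ ?_ ?_)
      · rw [tshift]; ring
      · rw [tshift, ξshift]; ring
    by_cases h2 : 2 * ξ y.1 ≤ t y.1
    · refine ⟨Sum.inl none, ⟨shift i (-2 * ξ y.1) (3 * ξ y.1) y.1,
        hmem _ y.2 _ _ (by linarith) (by linarith) (by ring)⟩, ?_⟩
      refine Prod.ext rfl (hinv _ _ _ _ ?_ ?_)
      · rw [ξshift]; ring
      · rw [ξshift]; ring
    · refine ⟨Sum.inr none, ⟨shift i (2 * ξ y.1 - 2 * t y.1) (2 * t y.1 - ξ y.1) y.1,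
        hmem _ y.2 _ _ (by linarith) (by linarith) (by ring)⟩, ?_⟩
      refine Prod.ext rfl (hinv _ _ _ _ ?_ ?_)
      · rw [tshift, ξshift]; ring
      · rw [tshift, ξshift]; ring
  · intro j a x hx
    by_cases hj : j = i
    · subst hj
      rcases a with _ | a
      · rw [insertPair_edge_none]
        exact ⟨Sum.inl w, x, Sum.inr (H.edge j w), x, Prod.ext rfl (hC0 _ hx), rfl,
          simplexMap_eq w x hx⟩
      · by_cases ha : a = w
        · subst ha
          rw [insertPair_edge_some_self]
          exact ⟨Sum.inl a, ⟨A x.1, hA _ x.2⟩, Sum.inl a, ⟨A x.1, hA _ x.2⟩, fw x,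
            Prod.ext rfl (hABe _ hx).symm, rfl⟩
        · rw [insertPair_edge_some_of_ne _ _ _ _ ha]
          exact ⟨Sum.inl a, x, Sum.inr (H.edge j a), x, fa a ha x, rfl, simplexMap_eq a x hx⟩
    · have htx := tzero _ x.2 j hj hx
      rcases a with _ | a
      · rw [edge_none j hj]
        exact ⟨Sum.inl w, ⟨C x.1, hC _ x.2⟩, Sum.inl w, ⟨C x.1, hC _ x.2⟩, rfl,
          Prod.ext rfl (hBCe _ htx), rfl⟩
      · rw [edge_some j hj]
        refine ⟨Sum.inl a, x, Sum.inr (H.edge j a), x, ?_, rfl, simplexMap_eq a x hx⟩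
        by_cases ha : a = w
        · subst ha
          rw [fw, hA0 _ htx]
        · exact fa a ha x
  · intro j a x hx
    by_cases ha : a = w
    · subst ha
      by_cases hj : j = i
      · subst hj
        exact ⟨Sum.inl none, x, Sum.inr (some (H.edge j a)), x, Prod.ext rfl (hC0 _ hx), rfl,
          simplexMap_eq' (insertPair_edge_none H j a) hx⟩
      · exact ⟨Sum.inl (some a), x, Sum.inr (some (H.edge j a)), x,
          (fw x).trans (Prod.ext rfl (hA0 _ (tzero _ x.2 j hj hx))), rfl,
          simplexMap_eq' (edge_some j hj a) hx⟩
    · refine ⟨Sum.inl (some a), x, Sum.inr (some (H.edge j a)), x, fa a ha x, rfl,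
        simplexMap_eq' ?_ hx⟩
      by_cases hj : j = i
      · subst hj
        exact insertPair_edge_some_of_ne H j w a ha
      · exact edge_some j hj a
  · let ξ' : (Fin (D + 1) → ℝ) →ₗ[ℝ] ℝ := (1 / D : ℝ) • LinearMap.proj i
    have hξ' : ∀ x, ξ' x = ξ x := fun x => by simp [ξ', ξ]; ring
    -- pieces on which the least coordinate is the one of color `k`
    have hpieces : ∀ (c d e g : ℝ) (F : (Fin (D + 1) → ℝ) → (Fin (D + 1) → ℝ)),
        (∀ x, F x = shift i (c * t x + d * ξ x) (e * t x + g * ξ x) x) →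
        (∀ x ∈ stdSimplex ℝ (Fin (D + 1)), F x ∈ stdSimplex ℝ (Fin (D + 1))) →
        ∃ (ι : Type) (_ : Finite ι) (P : ι → Set (Fin (D + 1) → ℝ))
          (v' : ι → H.Vertex) (g : ι → (Fin (D + 1) → ℝ) →ᵃ[ℝ] (Fin (D + 1) → ℝ)),
          (∀ a, IsPolyhedron (P a)) ∧ (∀ x : stdSimplex ℝ (Fin (D + 1)), ∃ a, x.1 ∈ P a) ∧
          ∀ a (x : stdSimplex ℝ (Fin (D + 1))), x.1 ∈ P a →
            ∃ _ : g a x.1 ∈ stdSimplex ℝ (Fin (D + 1)),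
              ((Sum.inl w, F x.1) : H.Vertex × (Fin (D + 1) → ℝ)) = (v' a, g a x.1) := by
      intro c d e g F hF hFm
      let L : Fin (D + 1) → (Fin (D + 1) → ℝ) →ₗ[ℝ] (Fin (D + 1) → ℝ) := fun k =>
        shiftLinear i (c • LinearMap.proj k + d • ξ') (e • LinearMap.proj k + g • ξ')
      have hL : ∀ k ∈ Finset.univ.erase i, ∀ x, (∀ j ∈ Finset.univ.erase i, x k ≤ x j) →
          L k x = F x := by
        intro k hk x hx
        rw [hF, shiftLinear_apply]
        simp only [LinearMap.add_apply, LinearMap.smul_apply, LinearMap.proj_apply, hξ',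
          smul_eq_mul]
        rw [ht, minCoord_eq hs hk hx]
      refine ⟨{k // k ∈ Finset.univ.erase i}, inferInstance,
        fun k => {x | ∀ j ∈ Finset.univ.erase i, x k.1 ≤ x j}, fun _ => Sum.inl w,
        fun k => (L k.1).toAffineMap, fun k => isPolyhedron_le k.1 _, fun x => ?_,
        fun k x hx => ?_⟩
      · obtain ⟨k, hk, -, h⟩ := exists_minCoord_eq hs x.1
        exact ⟨⟨k, hk⟩, h⟩
      · rw [LinearMap.coe_toAffineMap, hL k.1 k.2 _ hx]
        exact ⟨hFm _ x.2, rfl⟩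
    rintro ((_ | a) | (_ | b))
    · obtain ⟨ι, h, P, v', g, h1, h2, h3⟩ := hpieces 0 (2 / 3) 0 (1 / 3) C
        (fun x => by simp only [C]; ring_nf) hC
      exact ⟨ι, h, P, v', g, h1, h2, h3⟩
    · by_cases ha : a = w
      · subst ha
        obtain ⟨ι, h, P, v', g, h1, h2, h3⟩ := hpieces (-2 / 3) 0 (2 / 3) 1 A
          (fun x => by simp only [A]; ring_nf) hA
        exact ⟨ι, h, P, v', g, h1, h2, fun a x hx => by rw [fw]; exact h3 a x hx⟩
      · exact exists_pieces_of_affine (f' := fun v x => (v, x.1)) (Sum.inl a) (AffineMap.id ℝ _)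
          fun x => ⟨x.2, fa a ha x⟩
    · obtain ⟨ι, h, P, v', g, h1, h2, h3⟩ := hpieces (-2 / 3) (2 / 3) (2 / 3) (1 / 3) B
        (fun x => rfl) hB
      exact ⟨ι, h, P, v', g, h1, h2, h3⟩
    · exact exists_pieces_of_affine (f₀ := f (Sum.inr (some b))) (f' := fun v x => (v, x.1))
        (Sum.inr b) (AffineMap.id ℝ _) fun x => ⟨x.2, rfl⟩

end ColoredGraph

/-! ### Three colors: retriangulating a pentagon at a vertex of degree four -/

namespace ColoredGraph

/-- Extend a family `F` of functions on the simplices `vert k` by the identity on the others. -/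
noncomputable def overlay {V K E X : Type*} (vert : K → V) (F : K → E → X) (v : V) (x : E) :
    (V × E) ⊕ X := by
  classical
  exact if h : ∃ k, vert k = v then Sum.inr (F h.choose x) else Sum.inl (v, x)

theorem overlay_vert {V K E X : Type*} {vert : K → V} (hv : Function.Injective vert)
    (F : K → E → X) (k : K) (x : E) : overlay vert F (vert k) x = Sum.inr (F k x) := by
  have h : ∃ l, vert l = vert k := ⟨k, rfl⟩
  rw [overlay, dif_pos h, hv h.choose_spec]

theorem overlay_of_ne {V K E X : Type*} {vert : K → V} (F : K → E → X) {v : V}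
    (hv : ∀ k, vert k ≠ v) (x : E) : overlay vert F v x = Sum.inl (v, x) :=
  dif_neg fun ⟨k, hk⟩ => hv k hk

namespace Square

variable {G : ColoredGraph.{u} 2} (s : G.Square)

theorem sum_eq (x : Fin 3 → ℝ) : ∑ l, x l = x s.i + x s.j + x s.k := by
  have : (Finset.univ : Finset (Fin 3)) = {s.i, s.j, s.k} := by
    ext l
    simpa using s.color_cases l
  rw [this, Finset.sum_insert (by simp [s.hij, s.hik]), Finset.sum_pair s.hjk, add_assoc]

theorem mem_iff {x : Fin 3 → ℝ} : x ∈ stdSimplex ℝ (Fin 3) ↔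
    0 ≤ x s.i ∧ 0 ≤ x s.j ∧ 0 ≤ x s.k ∧ x s.i + x s.j + x s.k = 1 := by
  constructor
  · rintro ⟨h0, h1⟩
    exact ⟨h0 _, h0 _, h0 _, s.sum_eq x ▸ h1⟩
  · rintro ⟨hi, hj, hk, h⟩
    refine ⟨fun l => ?_, (s.sum_eq x).trans h⟩
    rcases s.color_cases l with rfl | rfl | rfl <;> assumption

theorem ext_coord {x y : Fin 3 → ℝ} (hi : x s.i = y s.i) (hj : x s.j = y s.j)
    (hk : x s.k = y s.k) : x = y := by
  funext l
  rcases s.color_cases l with rfl | rfl | rfl <;> assumption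

/-- The linear map with given components. -/
def coords {M : Type*} [AddCommGroup M] [Module ℝ M] (a b c : M →ₗ[ℝ] ℝ) :
    M →ₗ[ℝ] (Fin 3 → ℝ) :=
  LinearMap.pi fun l => if l = s.i then a else if l = s.j then b else c

section coords

variable {M : Type*} [AddCommGroup M] [Module ℝ M] (a b c : M →ₗ[ℝ] ℝ) (x : M)

@[simp] theorem coords_i : s.coords a b c x s.i = a x := by simp [coords]
@[simp] theorem coords_j : s.coords a b c x s.j = b x := by simp [coords, s.hij.symm]
@[simp] theorem coords_k : s.coords a b c x s.k = c x := by
  simp [coords, s.hik.symm, s.hjk.symm]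

end coords

/-- The affine triangle in the plane with the given vertices. -/
def tri (p q r : ℝ × ℝ) (x : Fin 3 → ℝ) : ℝ × ℝ :=
  (x s.i * p.1 + x s.j * q.1 + x s.k * r.1, x s.i * p.2 + x s.j * q.2 + x s.k * r.2)

/-- A pentagon cut into a square, coned from an interior point, and a triangle. -/
def big : Fin 5 → (Fin 3 → ℝ) → ℝ × ℝ
  | 0 => s.tri (0, 1) (-1, 0) (1, 0)
  | 1 => s.tri (0, 1) (1, 2) (1, 0)
  | 2 => s.tri (0, 1) (1, 2) (-1, 2)
  | 3 => s.tri (0, 1) (-1, 0) (-1, 2)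
  | 4 => s.tri (0, -1) (-1, 0) (1, 0)

/-- The same pentagon triangulated from one of its vertices. -/
def small : Fin 3 → (Fin 3 → ℝ) → ℝ × ℝ
  | 0 => s.tri (0, -1) (1, 2) (1, 0)
  | 1 => s.tri (0, -1) (1, 2) (-1, 2)
  | 2 => s.tri (0, -1) (-1, 0) (-1, 2)

/-- The pentagon. -/
def pentagon : Set (ℝ × ℝ) :=
  {p | p.1 ≤ 1 ∧ -1 ≤ p.1 ∧ p.2 ≤ 2 ∧ p.1 ≤ p.2 + 1 ∧ -p.1 ≤ p.2 + 1}

theorem big_mem {x : Fin 3 → ℝ} (hx : x ∈ stdSimplex ℝ (Fin 3)) (k : Fin 5) :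
    s.big k x ∈ pentagon := by
  obtain ⟨hi, hj, hk, h⟩ := s.mem_iff.1 hx
  fin_cases k <;> refine ⟨?_, ?_, ?_, ?_, ?_⟩ <;> simp only [big, tri] <;> linarith

theorem small_mem {x : Fin 3 → ℝ} (hx : x ∈ stdSimplex ℝ (Fin 3)) (k : Fin 3) :
    s.small k x ∈ pentagon := by
  obtain ⟨hi, hj, hk, h⟩ := s.mem_iff.1 hx
  fin_cases k <;> refine ⟨?_, ?_, ?_, ?_, ?_⟩ <;> simp only [small, tri] <;> linarith

theorem exists_big_eq {p : ℝ × ℝ} (hp : p ∈ pentagon) :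
    ∃ k, ∃ x : stdSimplex ℝ (Fin 3), s.big k x.1 = p := by
  obtain ⟨X, Y⟩ := p
  obtain ⟨h1, h2, h3, h4, h5⟩ := hp
  simp only at h1 h2 h3 h4 h5
  -- Linear maps out of ℝ, evaluated at 1, give the point with prescribed coordinates, so that
  -- `coords` can be reused.
  let q : ℝ → ℝ → ℝ → (Fin 3 → ℝ) := fun a b c =>
    s.coords (a • LinearMap.id) (b • LinearMap.id) (c • LinearMap.id) 1
  have hq : ∀ a b c, 0 ≤ a → 0 ≤ b → 0 ≤ c → a + b + c = 1 → q a b c ∈ stdSimplex ℝ (Fin 3) := by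
    intro a b c ha hb hc h
    refine s.mem_iff.2 ?_
    simp only [q, coords_i, coords_j, coords_k, LinearMap.smul_apply, LinearMap.id_coe, id,
      smul_eq_mul, mul_one]
    exact ⟨ha, hb, hc, h⟩
  have key : ∀ (k : Fin 5) a b c, 0 ≤ a → 0 ≤ b → 0 ≤ c → a + b + c = 1 →
      s.big k (q a b c) = (X, Y) → ∃ k, ∃ x : stdSimplex ℝ (Fin 3), s.big k x.1 = (X, Y) :=
    fun k a b c ha hb hc h e => ⟨k, ⟨_, hq a b c ha hb hc h⟩, e⟩
  -- The line Y = 0 separates the triangle of `b₀` from the square, and the diagonals Y - 1 = X and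
  -- Y - 1 = -X cut the square into the other four.
  by_cases hY : Y ≤ 0
  · refine key 4 (-Y) ((1 + Y - X) / 2) ((1 + Y + X) / 2) (by linarith) (by linarith)
      (by linarith) (by ring) ?_
    simp only [big, tri, q, coords_i, coords_j, coords_k, LinearMap.smul_apply, LinearMap.id_coe,
      id, smul_eq_mul, Prod.mk.injEq]
    constructor <;> ring
  by_cases ha : X ≤ 1 - Y <;> by_cases hb : -X ≤ 1 - Y
  · refine key 0 Y ((1 - Y - X) / 2) ((1 - Y + X) / 2) (by linarith) (by linarith)
      (by linarith) (by ring) ?_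
    simp only [big, tri, q, coords_i, coords_j, coords_k, LinearMap.smul_apply, LinearMap.id_coe,
      id, smul_eq_mul, Prod.mk.injEq]
    constructor <;> ring
  · refine key 3 (1 + X) ((1 - X - Y) / 2) ((Y - 1 - X) / 2) (by linarith) (by linarith)
      (by linarith) (by ring) ?_
    simp only [big, tri, q, coords_i, coords_j, coords_k, LinearMap.smul_apply, LinearMap.id_coe,
      id, smul_eq_mul, Prod.mk.injEq]
    constructor <;> ring
  · refine key 1 (1 - X) ((Y - 1 + X) / 2) ((X - Y + 1) / 2) (by linarith) (by linarith)
      (by linarith) (by ring) ?_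
    simp only [big, tri, q, coords_i, coords_j, coords_k, LinearMap.smul_apply, LinearMap.id_coe,
      id, smul_eq_mul, Prod.mk.injEq]
    constructor <;> ring
  · refine key 2 (2 - Y) ((Y - 1 + X) / 2) ((Y - 1 - X) / 2) (by linarith) (by linarith)
      (by linarith) (by ring) ?_
    simp only [big, tri, q, coords_i, coords_j, coords_k, LinearMap.smul_apply, LinearMap.id_coe,
      id, smul_eq_mul, Prod.mk.injEq]
    constructor <;> ring

/-- Barycentric coordinates with respect to the small triangles, where `σ` is the total weight. -/
noncomputable def smallCoords {M : Type*} [AddCommGroup M] [Module ℝ M] (X Y σ : M →ₗ[ℝ] ℝ) :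
    Fin 3 → M →ₗ[ℝ] (Fin 3 → ℝ)
  | 0 => s.coords (σ - X) ((1 / 2 : ℝ) • (Y + σ - X)) ((1 / 2 : ℝ) • ((3 : ℝ) • X - Y - σ))
  | 1 => s.coords ((1 / 3 : ℝ) • ((2 : ℝ) • σ - Y)) ((1 / 6 : ℝ) • (Y + σ + (3 : ℝ) • X))
      ((1 / 6 : ℝ) • (Y + σ - (3 : ℝ) • X))
  | 2 => s.coords (σ + X) ((1 / 2 : ℝ) • (-(3 : ℝ) • X - Y - σ)) ((1 / 2 : ℝ) • (Y + σ + X))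

theorem small_smallCoords {M : Type*} [AddCommGroup M] [Module ℝ M] {X Y σ : M →ₗ[ℝ] ℝ} {x : M}
    (hσ : σ x = 1) (l : Fin 3) : s.small l (s.smallCoords X Y σ l x) = (X x, Y x) := by
  fin_cases l <;>
  · simp only [small, smallCoords, tri, coords_i, coords_j, coords_k, LinearMap.smul_apply,
      LinearMap.add_apply, LinearMap.sub_apply, hσ, smul_eq_mul, Prod.mk.injEq]
    constructor <;> ring

theorem smallCoords_mem {M : Type*} [AddCommGroup M] [Module ℝ M] {X Y σ : M →ₗ[ℝ] ℝ} {x : M}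
    (hσ : σ x = 1) {l : Fin 3} (h : ∀ c, 0 ≤ s.smallCoords X Y σ l x c) :
    s.smallCoords X Y σ l x ∈ stdSimplex ℝ (Fin 3) := by
  refine s.mem_iff.2 ⟨h _, h _, h _, ?_⟩
  fin_cases l <;>
  · simp only [smallCoords, coords_i, coords_j, coords_k, LinearMap.smul_apply,
      LinearMap.add_apply, LinearMap.sub_apply, hσ, smul_eq_mul]
    ring

theorem exists_smallCoords_nonneg {M : Type*} [AddCommGroup M] [Module ℝ M] {X Y σ : M →ₗ[ℝ] ℝ}
    {x : M} (hσ : σ x = 1) (hp : (X x, Y x) ∈ pentagon) :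
    ∃ l, ∀ c, 0 ≤ s.smallCoords X Y σ l x c := by
  obtain ⟨h1, h2, h3, h4, h5⟩ := hp
  simp only at h1 h2 h3 h4 h5
  have key : ∀ l, 0 ≤ s.smallCoords X Y σ l x s.i → 0 ≤ s.smallCoords X Y σ l x s.j →
      0 ≤ s.smallCoords X Y σ l x s.k → ∃ l, ∀ c, 0 ≤ s.smallCoords X Y σ l x c := by
    intro l hi hj hk
    refine ⟨l, fun c => ?_⟩
    rcases s.color_cases c with rfl | rfl | rfl <;> assumption
  -- The small triangles are separated by the lines from (0, -1) to (1, 2) and to (-1, 2).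
  by_cases ha : Y x + 1 ≤ 3 * X x
  · refine key 0 ?_ ?_ ?_ <;>
    · simp only [smallCoords, coords_i, coords_j, coords_k, LinearMap.smul_apply,
        LinearMap.add_apply, LinearMap.sub_apply, hσ, smul_eq_mul]
      linarith
  by_cases hb : Y x + 1 ≤ -(3 * X x)
  · refine key 2 ?_ ?_ ?_ <;>
    · simp only [smallCoords, coords_i, coords_j, coords_k, LinearMap.smul_apply,
        LinearMap.add_apply, LinearMap.sub_apply, hσ, smul_eq_mul]
      linarith
  · refine key 1 ?_ ?_ ?_ <;>
    · simp only [smallCoords, coords_i, coords_j, coords_k, LinearMap.smul_apply,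
        LinearMap.add_apply, LinearMap.sub_apply, hσ, smul_eq_mul]
      linarith

/-- The horizontal and vertical coordinates of the big triangles, as linear maps. -/
theorem exists_linear_big (k : Fin 5) : ∃ X Y : (Fin 3 → ℝ) →ₗ[ℝ] ℝ, ∀ x, s.big k x = (X x, Y x) := by
  have h : ∀ p q r : ℝ × ℝ, ∃ X Y : (Fin 3 → ℝ) →ₗ[ℝ] ℝ, ∀ x, s.tri p q r x = (X x, Y x) := by
    intro p q r
    refine ⟨p.1 • LinearMap.proj s.i + q.1 • LinearMap.proj s.j + r.1 • LinearMap.proj s.k,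
      p.2 • LinearMap.proj s.i + q.2 • LinearMap.proj s.j + r.2 • LinearMap.proj s.k, fun x => ?_⟩
    simp [tri, mul_comm]
  fin_cases k <;> exact h _ _ _

/-- The total weight. -/
def weight : (Fin 3 → ℝ) →ₗ[ℝ] ℝ :=
  (LinearMap.proj s.i : (Fin 3 → ℝ) →ₗ[ℝ] ℝ) + LinearMap.proj s.j + LinearMap.proj s.k

theorem weight_eq_one {x : Fin 3 → ℝ} (hx : x ∈ stdSimplex ℝ (Fin 3)) : s.weight x = 1 :=
  (s.mem_iff.1 hx).2.2.2

theorem exists_small_eq (k : Fin 5) (x : stdSimplex ℝ (Fin 3)) :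
    ∃ l, ∃ y : stdSimplex ℝ (Fin 3), s.small l y.1 = s.big k x.1 := by
  obtain ⟨X, Y, h⟩ := s.exists_linear_big k
  have hσ := s.weight_eq_one x.2
  obtain ⟨l, hl⟩ := s.exists_smallCoords_nonneg hσ (h x.1 ▸ s.big_mem x.2 k)
  exact ⟨l, ⟨_, s.smallCoords_mem hσ hl⟩, (s.small_smallCoords hσ l).trans (h _).symm⟩

/-! #### The two complexes -/

/-- A black vertex of the face. -/
def b₁ : G.B := G.edge s.j s.w₁

/-- The other black vertex of the face. -/
def b₂ : G.B := G.edge s.k s.w₁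

theorem b₁_ne : s.b₁ ≠ s.b₀ := s.edge_j_ne
theorem b₂_ne : s.b₂ ≠ s.b₀ := s.edge_k_ne
theorem b₁_ne_b₂ : s.b₁ ≠ s.b₂ := s.edge_ne s.hjk _

/-- The vertices whose simplices are subdivided. -/
def vert : Fin 5 → G.Vertex
  | 0 => Sum.inl s.w₁
  | 1 => Sum.inr s.b₁
  | 2 => Sum.inl s.w₂
  | 3 => Sum.inr s.b₂
  | 4 => Sum.inr s.b₀

/-- The corresponding vertices of the reduced graph. -/
def vert' : Fin 3 → s.reduced.Vertex
  | 0 => Sum.inr ⟨s.b₁, s.b₁_ne⟩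
  | 1 => Sum.inl ⟨s.w₂, s.hw⟩
  | 2 => Sum.inr ⟨s.b₂, s.b₂_ne⟩

theorem vert_injective : Function.Injective s.vert := by
  have h1 := s.hw
  have h2 := s.b₁_ne
  have h3 := s.b₂_ne
  have h4 := s.b₁_ne_b₂
  intro k l h
  fin_cases k <;> fin_cases l <;> simp [vert, h1, h2, h3, h4, h1.symm, h2.symm, h3.symm, h4.symm] at h ⊢

/-- A vertex of the reduced graph as a vertex of `G`. -/
def base : s.reduced.Vertex → G.Vertex :=
  Sum.map (fun a => Subtype.val (p := fun a => a ≠ s.w₁) a) baseB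

theorem base_injective : Function.Injective s.base :=
  Sum.map_injective.2 ⟨Subtype.val_injective, Subtype.val_injective⟩

/-- The index on the right is l + 1: the triangles of `w₁` and `b₀`, with indices 0 and 4,
disappear. -/
theorem base_vert' (l : Fin 3) : s.base (s.vert' l) = s.vert (l.castSucc.succ.castLE (by simp)) := by
  fin_cases l <;> rfl

theorem vert'_injective : Function.Injective s.vert' := by
  intro k l h
  have := s.vert_injective ((s.base_vert' k).symm.trans ((congrArg s.base h).trans (s.base_vert' l)))
  simpa [Fin.ext_iff] using this

/-- Coinciding points of the big triangles are glued. -/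
theorem big_glued (k l : Fin 5) (x y : stdSimplex ℝ (Fin 3)) (e : s.big k x.1 = s.big l y.1) :
    G.simplexMap (s.vert k) x = G.simplexMap (s.vert l) y := by
  wlog hkl : k ≤ l generalizing k l x y
  · exact (this l k y x e.symm (le_of_not_ge hkl)).symm
  have g01 : ∀ x : stdSimplex ℝ (Fin 3), x.1 s.j = 0 →
      G.simplexMap (s.vert 0) x = G.simplexMap (s.vert 1) x := fun x hx => simplexMap_eq' rfl hx
  have g03 : ∀ x : stdSimplex ℝ (Fin 3), x.1 s.k = 0 →
      G.simplexMap (s.vert 0) x = G.simplexMap (s.vert 3) x := fun x hx => simplexMap_eq' rfl hx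
  have g04 : ∀ x : stdSimplex ℝ (Fin 3), x.1 s.i = 0 →
      G.simplexMap (s.vert 0) x = G.simplexMap (s.vert 4) x := fun x hx => simplexMap_eq' rfl hx
  have g21 : ∀ x : stdSimplex ℝ (Fin 3), x.1 s.k = 0 →
      G.simplexMap (s.vert 2) x = G.simplexMap (s.vert 1) x :=
    fun x hx => simplexMap_eq' s.edge_jk.symm hx
  have g23 : ∀ x : stdSimplex ℝ (Fin 3), x.1 s.j = 0 →
      G.simplexMap (s.vert 2) x = G.simplexMap (s.vert 3) x :=
    fun x hx => simplexMap_eq' s.edge_kj.symm hx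
  obtain ⟨xi, xj, xk, hx⟩ := s.mem_iff.1 x.2
  obtain ⟨yi, yj, yk, hy⟩ := s.mem_iff.1 y.2
  have hxy : x.1 s.i = y.1 s.i → x.1 s.j = y.1 s.j → x.1 s.k = y.1 s.k → x = y :=
    fun h1 h2 h3 => Subtype.ext (s.ext_coord h1 h2 h3)
  -- Each corner has the same color in all triangles containing it, so coinciding points have equal
  -- coordinates. Triangles with a common side are glued by one line, those sharing just a corner by
  -- a chain of two, and the triangles 2 and 4 are disjoint.
  fin_cases k <;> fin_cases l <;>
    first
    | exact absurd hkl (by decide)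
    | (simp only [big, tri, Prod.mk.injEq] at e
       obtain ⟨e1, e2⟩ := e
       first
       | (obtain rfl := hxy (by linarith) (by linarith) (by linarith)
          first
          | rfl
          | exact g01 x (by linarith)
          | exact g03 x (by linarith)
          | exact g04 x (by linarith)
          | exact (g21 x (by linarith)).symm
          | exact g23 x (by linarith)
          | exact (g01 x (by linarith)).trans (g21 x (by linarith)).symm
          | exact ((g01 x (by linarith)).symm.trans (g03 x (by linarith)))
          | exact ((g01 x (by linarith)).symm.trans (g04 x (by linarith)))
          | exact ((g03 x (by linarith)).symm.trans (g04 x (by linarith))))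
       | exact (by linarith : False).elim)

theorem reduced_edge_jk : s.reduced.edge s.k ⟨s.w₂, s.hw⟩ = (⟨s.b₁, s.b₁_ne⟩ : {y // y ≠ s.b₀}) :=
  Subtype.ext ((remove_edge_of_ne s.hw (s.edge_jk ▸ s.b₁_ne)).trans s.edge_jk.symm)

theorem reduced_edge_kj : s.reduced.edge s.j ⟨s.w₂, s.hw⟩ = (⟨s.b₂, s.b₂_ne⟩ : {y // y ≠ s.b₀}) :=
  Subtype.ext ((remove_edge_of_ne s.hw (s.edge_kj ▸ s.b₂_ne)).trans s.edge_kj.symm)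

/-- Coinciding points of the small triangles are glued. -/
theorem small_glued (k l : Fin 3) (x y : stdSimplex ℝ (Fin 3)) (e : s.small k x.1 = s.small l y.1) :
    s.reduced.simplexMap (s.vert' k) x = s.reduced.simplexMap (s.vert' l) y := by
  wlog hkl : k ≤ l generalizing k l x y
  · exact (this l k y x e.symm (le_of_not_ge hkl)).symm
  have g10 : ∀ x : stdSimplex ℝ (Fin 3), x.1 s.k = 0 →
      s.reduced.simplexMap (s.vert' 1) x = s.reduced.simplexMap (s.vert' 0) x :=
    fun x hx => simplexMap_eq' s.reduced_edge_jk hx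
  have g12 : ∀ x : stdSimplex ℝ (Fin 3), x.1 s.j = 0 →
      s.reduced.simplexMap (s.vert' 1) x = s.reduced.simplexMap (s.vert' 2) x :=
    fun x hx => simplexMap_eq' s.reduced_edge_kj hx
  obtain ⟨xi, xj, xk, hx⟩ := s.mem_iff.1 x.2
  obtain ⟨yi, yj, yk, hy⟩ := s.mem_iff.1 y.2
  have hxy : x.1 s.i = y.1 s.i → x.1 s.j = y.1 s.j → x.1 s.k = y.1 s.k → x = y :=
    fun h1 h2 h3 => Subtype.ext (s.ext_coord h1 h2 h3)
  fin_cases k <;> fin_cases l <;>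
    first
    | exact absurd hkl (by decide)
    | (simp only [small, tri, Prod.mk.injEq] at e
       obtain ⟨e1, e2⟩ := e
       obtain rfl := hxy (by linarith) (by linarith) (by linarith)
       first
       | rfl
       | exact (g10 x (by linarith)).symm
       | exact g12 x (by linarith)
       | exact (g10 x (by linarith)).symm.trans (g12 x (by linarith)))

end Square

end ColoredGraph

namespace ColoredGraph

namespace Square

variable {G : ColoredGraph.{u} 2} (s : G.Square)

theorem exists_base {v : G.Vertex} (hv : ∀ k, s.vert k ≠ v) : ∃ v', s.base v' = v := by
  rcases v with a | b
  · exact ⟨Sum.inl ⟨a, fun h => hv 0 (congrArg Sum.inl h.symm)⟩, rfl⟩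
  · exact ⟨Sum.inr (⟨b, fun h => hv 4 (congrArg Sum.inr h.symm)⟩ : {y // y ≠ s.b₀}), rfl⟩

theorem vert_ne_base {v : s.reduced.Vertex} (hv : ∀ l, s.vert' l ≠ v) (k : Fin 5) :
    s.vert k ≠ s.base v := by
  have h : ∀ l : Fin 3, s.vert (l.castSucc.succ.castLE (by simp)) ≠ s.base v := fun l e =>
    hv l (s.base_injective ((s.base_vert' l).trans e))
  fin_cases k
  · rcases v with ⟨a, ha⟩ | b
    · exact fun e => ha (Sum.inl_injective e).symm
    · exact fun e => by cases e
  · exact h 0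
  · exact h 1
  · exact h 2
  · rcases v with a | ⟨b, hb⟩
    · exact fun e => by cases e
    · exact fun e => hb (Sum.inr_injective e).symm

/-- Removal of the pair `w₁`, `b₀` at a face with four vertices: the five triangles at the face and
`b₀` are replaced by three triangles with the same union. -/
theorem isPolyhedralSphere (h : s.reduced.IsPolyhedralSphere) : G.IsPolyhedralSphere := by
  -- The model is a plane pentagon together with the remaining triangles, all kept apart. Gluings
  -- along the sides of the pentagon, possibly of one side to another, enter only through the
  -- conditions `glue` and `glue'` of `of_model`.
  let f : G.Vertex → stdSimplex ℝ (Fin 3) → (G.Vertex × stdSimplex ℝ (Fin 3)) ⊕ (ℝ × ℝ) :=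
    overlay s.vert fun k x => s.big k x.1
  let f' : s.reduced.Vertex → stdSimplex ℝ (Fin 3) →
      (G.Vertex × stdSimplex ℝ (Fin 3)) ⊕ (ℝ × ℝ) := fun v x =>
    (overlay s.vert' (fun k x => s.small k x.1) v x).map (Prod.map s.base id) id
  have fv : ∀ k x, f (s.vert k) x = Sum.inr (s.big k x.1) :=
    fun k x => overlay_vert s.vert_injective _ k x
  have fo : ∀ v, (∀ k, s.vert k ≠ v) → ∀ x, f v x = Sum.inl (v, x) :=
    fun v hv x => overlay_of_ne _ hv x
  have fv' : ∀ l x, f' (s.vert' l) x = Sum.inr (s.small l x.1) := fun l x => by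
    simp only [f', overlay_vert s.vert'_injective, Sum.map_inr, id]
  have fo' : ∀ v, (∀ l, s.vert' l ≠ v) → ∀ x, f' v x = Sum.inl (s.base v, x) := fun v hv x => by
    simp only [f', overlay_of_ne _ hv, Sum.map_inl, Prod.map, id]
  have ford : ∀ v, (∀ l, s.vert' l ≠ v) → ∀ x, f (s.base v) x = f' v x := fun v hv x => by
    rw [fo _ (s.vert_ne_base hv), fo' v hv]
  -- the facets of color `i` are not moved
  have hbd : ∀ v (x : stdSimplex ℝ (Fin 3)), x.1 s.i = 0 → f (s.base v) x = f' v x := by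
    intro v x hx
    by_cases hv : ∀ l, s.vert' l ≠ v
    · exact ford v hv x
    · push Not at hv
      obtain ⟨l, rfl⟩ := hv
      rw [s.base_vert', fv, fv']
      congr 1
      fin_cases l
      · change s.big 1 x.1 = s.small 0 x.1
        simp [big, small, tri, hx]
      · change s.big 2 x.1 = s.small 1 x.1
        simp [big, small, tri, hx]
      · change s.big 3 x.1 = s.small 2 x.1
        simp [big, small, tri, hx]
  have big_eq : ∀ k l (x : stdSimplex ℝ (Fin 3)), s.big k x.1 = s.big l x.1 →
      ∃ v' y u' z, f (s.vert k) x = f' v' y ∧ f (s.vert l) x = f' u' z ∧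
        s.reduced.simplexMap v' y = s.reduced.simplexMap u' z := by
    intro k l x e
    obtain ⟨m, y, hy⟩ := s.exists_small_eq k x
    exact ⟨s.vert' m, y, s.vert' m, y, by rw [fv, fv', hy], by rw [fv, fv', hy, e], rfl⟩
  have small_eq : ∀ k l (x : stdSimplex ℝ (Fin 3)), s.small k x.1 = s.small l x.1 →
      ∃ v y u z, f v y = f' (s.vert' k) x ∧ f u z = f' (s.vert' l) x ∧
        G.simplexMap v y = G.simplexMap u z := by
    intro k l x e
    obtain ⟨m, y, hy⟩ := s.exists_big_eq (s.small_mem x.2 k)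
    exact ⟨s.vert m, y, s.vert m, y, by rw [fv, fv', hy], by rw [fv, fv', hy, e], rfl⟩
  have hw₂ : ∀ c, c ≠ s.i → G.edge c s.w₂ ≠ s.b₀ := by
    intro c hc
    rcases s.color_cases c with rfl | rfl | rfl
    · exact (hc rfl).elim
    · exact s.edge_kj ▸ s.b₂_ne
    · exact s.edge_jk ▸ s.b₁_ne
  have edge_red : ∀ c a (ha : a ≠ s.w₁) (hb : G.edge c a ≠ s.b₀),
      s.reduced.edge c ⟨a, ha⟩ = (⟨G.edge c a, hb⟩ : {y // y ≠ s.b₀}) :=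
    fun c a ha hb => Subtype.ext (remove_edge_of_ne ha hb)
  -- away from the face, only the lines of color `i` reach the face
  have hordW : ∀ a (ha : a ≠ s.w₁), a ≠ s.w₂ → ∀ l, s.vert' l ≠ Sum.inl ⟨a, ha⟩ := by
    intro a ha ha₂ l e
    fin_cases l
    · cases e
    · exact ha₂ (congrArg Subtype.val (Sum.inl_injective e)).symm
    · cases e
  have hordB : ∀ c, c ≠ s.i → ∀ a, a ≠ s.w₁ → a ≠ s.w₂ → ∀ hb : G.edge c a ≠ s.b₀,
      ∀ l, s.vert' l ≠ Sum.inr (⟨G.edge c a, hb⟩ : {y // y ≠ s.b₀}) := by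
    intro c hc a ha ha₂ hb l e
    have hj₁ : G.edge c a ≠ s.b₁ := by
      rcases s.color_cases c with rfl | rfl | rfl
      · exact (hc rfl).elim
      · exact fun h => ha ((G.edge _).injective h)
      · exact fun h => ha₂ ((G.edge _).injective (h.trans s.edge_jk))
    have hj₂ : G.edge c a ≠ s.b₂ := by
      rcases s.color_cases c with rfl | rfl | rfl
      · exact (hc rfl).elim
      · exact fun h => ha₂ ((G.edge _).injective (h.trans s.edge_kj))
      · exact fun h => ha ((G.edge _).injective h)
    fin_cases l
    · exact hj₁ (congrArg Subtype.val (Sum.inr_injective e)).symm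
    · cases e
    · exact hj₂ (congrArg Subtype.val (Sum.inr_injective e)).symm
  -- the reconnected lines
  have hrec : ∀ c, c ≠ s.i → ∀ a (ha : a ≠ s.w₁), G.edge c a = s.b₀ →
      ∀ x : stdSimplex ℝ (Fin 3), x.1 c = 0 →
      f (s.vert 4) x = f' (Sum.inr (s.reduced.edge c ⟨a, ha⟩)) x := by
    intro c hc a ha hb x hx
    have he := remove_edge_of_eq ha hb
    rcases s.color_cases c with rfl | rfl | rfl
    · exact (hc rfl).elim
    · have : s.reduced.edge s.j ⟨a, ha⟩ = (⟨s.b₁, s.b₁_ne⟩ : {y // y ≠ s.b₀}) := Subtype.ext he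
      rw [this]
      refine (fv 4 x).trans (Eq.trans ?_ (fv' 0 x).symm)
      simp [big, small, tri, hx]
    · have : s.reduced.edge s.k ⟨a, ha⟩ = (⟨s.b₂, s.b₂_ne⟩ : {y // y ≠ s.b₀}) := Subtype.ext he
      rw [this]
      refine (fv 4 x).trans (Eq.trans ?_ (fv' 2 x).symm)
      simp [big, small, tri, hx]
  -- lines that are not subdivided
  have hline : ∀ c a (ha : a ≠ s.w₁), (c ≠ s.i → a ≠ s.w₂) →
      ∀ x : stdSimplex ℝ (Fin 3), x.1 c = 0 →
      f (Sum.inl a) x = f' (Sum.inl ⟨a, ha⟩) x ∧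
      f (Sum.inr (G.edge c a)) x = f' (Sum.inr (s.reduced.edge c ⟨a, ha⟩)) x := by
    intro c a ha h₂ x hx
    by_cases hc : c = s.i
    · subst hc
      have hb : G.edge s.i a ≠ s.b₀ := fun e => ha ((G.edge _).injective e)
      rw [edge_red _ a ha hb]
      exact ⟨hbd (Sum.inl ⟨a, ha⟩) x hx,
        hbd (Sum.inr (⟨G.edge s.i a, hb⟩ : {y // y ≠ s.b₀})) x hx⟩
    · have h₂ := h₂ hc
      refine ⟨ford (Sum.inl ⟨a, ha⟩) (hordW a ha h₂) x, ?_⟩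
      by_cases hb : G.edge c a = s.b₀
      · rw [hb]
        exact hrec c hc a ha hb x hx
      · rw [edge_red _ a ha hb]
        exact ford (Sum.inr (⟨G.edge c a, hb⟩ : {y // y ≠ s.b₀})) (hordB c hc a ha h₂ hb) x
  refine h.of_model f f' ?_ ?_ ?_ ?_ ?_ ?_
  · intro v x u y e
    by_cases hv : ∀ k, s.vert k ≠ v <;> by_cases hu : ∀ k, s.vert k ≠ u
    · rw [fo v hv, fo u hu] at e
      obtain ⟨rfl, rfl⟩ := Prod.ext_iff.1 (Sum.inl_injective e)
      rfl
    · push Not at hu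
      obtain ⟨l, rfl⟩ := hu
      rw [fo v hv, fv] at e
      cases e
    · push Not at hv
      obtain ⟨l, rfl⟩ := hv
      rw [fo u hu, fv] at e
      cases e
    · push Not at hv hu
      obtain ⟨k, rfl⟩ := hv
      obtain ⟨l, rfl⟩ := hu
      rw [fv, fv] at e
      exact s.big_glued k l x y (Sum.inr_injective e)
  · intro v x u y e
    by_cases hv : ∀ k, s.vert' k ≠ v <;> by_cases hu : ∀ k, s.vert' k ≠ u
    · rw [fo' v hv, fo' u hu] at e
      obtain ⟨e1, rfl⟩ := Prod.ext_iff.1 (Sum.inl_injective e)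
      rw [s.base_injective e1]
    · push Not at hu
      obtain ⟨l, rfl⟩ := hu
      rw [fo' v hv, fv'] at e
      cases e
    · push Not at hv
      obtain ⟨l, rfl⟩ := hv
      rw [fo' u hu, fv'] at e
      cases e
    · push Not at hv hu
      obtain ⟨k, rfl⟩ := hv
      obtain ⟨l, rfl⟩ := hu
      rw [fv', fv'] at e
      exact s.small_glued k l x y (Sum.inr_injective e)
  · intro v y
    by_cases hv : ∀ l, s.vert' l ≠ v
    · exact ⟨s.base v, y, ford v hv y⟩
    · push Not at hv
      obtain ⟨l, rfl⟩ := hv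
      obtain ⟨v, x, -, -, e, -, -⟩ := small_eq l l y rfl
      exact ⟨v, x, e⟩
  · intro c a x hx
    by_cases ha : a = s.w₁
    · subst ha
      rcases s.color_cases c with rfl | rfl | rfl
      · exact big_eq 0 4 x (by simp [big, tri, hx])
      · exact big_eq 0 1 x (by simp [big, tri, hx])
      · exact big_eq 0 3 x (by simp [big, tri, hx])
    by_cases h₂ : c ≠ s.i ∧ a = s.w₂
    · obtain ⟨hc, rfl⟩ := h₂
      rcases s.color_cases c with rfl | rfl | rfl
      · exact (hc rfl).elim
      · rw [← s.edge_kj]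
        exact big_eq 2 3 x (by simp [big, tri, hx])
      · rw [← s.edge_jk]
        exact big_eq 2 1 x (by simp [big, tri, hx])
    · obtain ⟨e1, e2⟩ := hline c a ha (fun hc h => h₂ ⟨hc, h⟩) x hx
      exact ⟨_, x, _, x, e1, e2, simplexMap_eq _ x hx⟩
  · rintro c ⟨a, ha⟩ x hx
    by_cases h₂ : c ≠ s.i ∧ a = s.w₂
    · obtain ⟨hc, rfl⟩ := h₂
      rcases s.color_cases c with rfl | rfl | rfl
      · exact (hc rfl).elim
      · rw [s.reduced_edge_kj]
        exact small_eq 1 2 x (by simp [small, tri, hx])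
      · rw [s.reduced_edge_jk]
        exact small_eq 1 0 x (by simp [small, tri, hx])
    · obtain ⟨e1, e2⟩ := hline c a ha (fun hc h => h₂ ⟨hc, h⟩) x hx
      exact ⟨_, x, _, x, e1, e2, simplexMap_eq _ x hx⟩
  · intro v
    by_cases hv : ∀ k, s.vert k ≠ v
    · obtain ⟨v', rfl⟩ := s.exists_base hv
      have hv' : ∀ l, s.vert' l ≠ v' := by
        rintro l rfl
        exact hv _ (s.base_vert' l).symm
      exact exists_pieces_of_affine v' (AffineMap.id ℝ _) fun x => ⟨x.2, ford v' hv' x⟩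
    · push Not at hv
      obtain ⟨k, rfl⟩ := hv
      obtain ⟨X, Y, hXY⟩ := s.exists_linear_big k
      let g : Fin 3 → (Fin 3 → ℝ) →ₗ[ℝ] (Fin 3 → ℝ) := s.smallCoords X Y s.weight
      refine ⟨Fin 3, inferInstance, fun l => {x | ∀ c, 0 ≤ g l x c}, s.vert',
        fun l => (g l).toAffineMap, fun l => ?_, fun x => ?_, fun l x hx => ?_⟩
      · exact IsPolyhedron.of_forall fun c => ((LinearMap.proj c).comp (g l)).toAffineMap
      · exact s.exists_smallCoords_nonneg (s.weight_eq_one x.2) (hXY x.1 ▸ s.big_mem x.2 k)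
      · refine ⟨s.smallCoords_mem (s.weight_eq_one x.2) hx, ?_⟩
        rw [fv, fv', hXY]
        exact congrArg Sum.inr (s.small_smallCoords (s.weight_eq_one x.2) l).symm

end Square

/-! ### The induction on the number of vertices -/

/-- For D = 1 and D ≥ 3 there is always a pair joined by D lines. For D = 2 there need not be one,
as the octahedron shows, and squares take over. -/
theorem isPolyhedralSphere_of_excess {D : ℕ} (hD : 1 ≤ D) (n : ℕ) : ∀ G : ColoredGraph.{u} D,
    G.numComp Set.univ = 1 → G.excess = 0 → Nat.card G.W = n → G.IsPolyhedralSphere := by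
  induction n with
  | zero =>
    intro G h1 _ hn
    have : IsEmpty G.W := (Nat.card_eq_zero.1 hn).resolve_right (by simpa using G.finite_W)
    have : IsEmpty (G.Comp Set.univ) := ⟨fun c => this.elim (Quot.exists_rep c).choose⟩
    simp [numComp] at h1
  | succ n ih =>
    intro G h1 h0 hn
    by_cases hp : 2 ≤ Nat.card G.W
    swap
    · obtain ⟨e⟩ := nonempty_iso_dipole (G := G) (by omega)
      exact (isPolyhedralSphere_dipole D).of_iso e.symm
    have hdip : G.HasDipole → G.IsPolyhedralSphere := by
      intro h
      obtain ⟨H, i, w, ⟨e⟩, hH1, hH0, hc⟩ := h.exists_insertPair h1 h0 hD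
      exact ((ih H hH1 hH0 (by omega)).insertPair hD i w).of_iso e.symm
    by_cases hD3 : 3 ≤ D
    · exact hdip (hasDipole_of_three_le hD3 h1 h0 hp)
    obtain rfl | rfl : D = 1 ∨ D = 2 := by omega
    · exact hdip (hasDipole_of_one h1 hp)
    · rcases hasDipole_or_square h1 h0 hp with h | ⟨⟨s⟩⟩
      · exact hdip h
      · refine s.isPolyhedralSphere (ih _ (s.numComp_reduced h1) (s.excess_reduced h0) ?_)
        have : Nat.card G.W = Nat.card s.reduced.W + 1 := card_remove G s.w₁ s.b₀
        omega

end ColoredGraph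

theorem mainTheorem2 (D : ℕ) (hD : 1 ≤ D) (G : ColoredGraph.{u} D) (hconn : G.IsConnected)
    (hdeg : G.degree = 0) :
    (3 ≤ D → G.IsMelonic) ∧
      G.IsPLSphere ∧
      Nonempty (G.Space ≃ₜ Metric.sphere (0 : EuclideanSpace ℝ (Fin (D + 1))) 1) := by
  have h1 := hconn.numComp_univ
  have h0 := ColoredGraph.excess_eq_zero hconn hdeg
  have hS := (ColoredGraph.isPolyhedralSphere_of_excess hD _ G h1 h0 rfl).isPLSphere
  refine ⟨fun h3 => ColoredGraph.isMelonic_of_excess h3 _ G h1 h0 rfl, hS, ?_⟩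
  obtain ⟨φ, -⟩ := hS
  obtain ⟨ψ⟩ := nonempty_simplexBoundary_homeo_sphere D
  exact ⟨φ.trans ψ⟩
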